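/- Let $\sigma$ be a finite relational vocabulary and let $\varphi$ be a fixed formula of $\mathrm{FO}(\perp,\mathrm{dep},\subseteq)$ over $\sigma$, that is, of first-order logic with negation only on atoms, extended by independence atoms $\bar x\perp_{\bar z}\bar y$, dependence atoms $\mathrm{dep}(\bar x,\bar y)$ and inclusion atoms $\bar x\subseteq\bar y$, under (lax) team semantics. A team of a finite $\sigma$-structure $\mathcal A$ is a set $X$ of assignments from the set $\mathrm{Fr}(\varphi)$ of free variables of $\varphi$ to the universe of $\mathcal A$. Consider the enumeration problem $\mathrm{E}\text{-}\mathrm{Sat}^{\mathrm{team}}_\varphi$: given a finite $\sigma$-structure $\mathcal A$, encoded as a binary word, enumerate the set $$\{\,X \mid \mathcal A\models_X\varphi \text{ and } X\neq\emptyset\,\}.$$ Then $\mathrm{E}\text{-}\mathrm{Sat}^{\mathrm{team}}_\varphi\in\mathrm{DelNP}$. That is, there are a language $L\in\mathrm{NP}$, a polynomial $p$ and a random access machine $M$ with oracle $L$ (all depending on $\sigma$ and $\varphi$ only) such that on every input $x$ the machine $M$ outputs every solution for $x$ exactly once, outputs nothing else, and halts; the time before the first output, between any two consecutive outputs, and between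 the last output and halting is at most $p(|x|)$; and all oracle queries have length at most $p(|x|)$. Here $M$ has unit-cost addition and truncated subtraction, and the numbers in its registers have at most $p(|x|)$ bits. A word $x$ that does not encode a structure has no solutions. -/

import Mathlib

namespace TeamLogic

/-! ### First-order team logic with dependence, inclusion and independence atoms -/

/-- A finite relational vocabulary: finitely many relation symbols of positive arity. -/
structure Vocabulary where
  numRel : ℕ
  arity : Fin numRel → ℕ
  arity_pos : ∀ i, 0 < arity i

/-- Formulas of first-order team logic with all three generalised dependency atoms. First-order
variables are natural numbers, tuples of variables are functions on `Fin k`. -/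
inductive Formula (σ : Vocabulary) : Type
  /-- `x = y` -/
  | eq (x y : ℕ) : Formula σ
  /-- `x ≠ y` -/
  | neq (x y : ℕ) : Formula σ
  /-- `R(x₁, …, xⱼ)` -/
  | rel (R : Fin σ.numRel) (x : Fin (σ.arity R) → ℕ) : Formula σ
  /-- `¬ R(x₁, …, xⱼ)` -/
  | nrel (R : Fin σ.numRel) (x : Fin (σ.arity R) → ℕ) : Formula σ
  /-- dependence atom: the tuple `x` determines the tuple `y` -/
  | dep {k l : ℕ} (x : Fin k → ℕ) (y : Fin l → ℕ) : Formula σ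
  /-- inclusion atom `x ⊆ y` -/
  | incl {k : ℕ} (x y : Fin k → ℕ) : Formula σ
  /-- independence atom `x ⊥_z y` -/
  | indep {k l m : ℕ} (x : Fin k → ℕ) (z : Fin m → ℕ) (y : Fin l → ℕ) : Formula σ
  | and (φ ψ : Formula σ) : Formula σ
  | or (φ ψ : Formula σ) : Formula σ
  | ex (x : ℕ) (φ : Formula σ) : Formula σ
  | all (x : ℕ) (φ : Formula σ) : Formula σ

/-- The variables that occur in a tuple. -/
def tupleVars {k : ℕ} (x : Fin k → ℕ) : Finset ℕ := Finset.univ.image x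

/-- The set of free variables of a formula. -/
def Formula.free {σ : Vocabulary} : Formula σ → Finset ℕ
  | .eq x y => {x, y}
  | .neq x y => {x, y}
  | .rel _ x => tupleVars x
  | .nrel _ x => tupleVars x
  | .dep x y => tupleVars x ∪ tupleVars y
  | .incl x y => tupleVars x ∪ tupleVars y
  | .indep x z y => tupleVars x ∪ tupleVars z ∪ tupleVars y
  | .and φ ψ => φ.free ∪ ψ.free
  | .or φ ψ => φ.free ∪ ψ.free
  | .ex x φ => φ.free.erase x
  | .all x φ => φ.free.erase x

/-- A `σ`-structure with universe `{0, …, n - 1}`. -/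
structure FinStructure (σ : Vocabulary) (n : ℕ) where
  rel : (R : Fin σ.numRel) → Set (Fin (σ.arity R) → Fin n)

/-- An assignment of variables to elements of `{0, …, n - 1}`, as a partial function. -/
abbrev Assignment (n : ℕ) : Type := ℕ → Option (Fin n)

/-- `s` is an assignment with domain `D`. -/
def Assignment.HasDomain {n : ℕ} (s : Assignment n) (D : Finset ℕ) : Prop :=
  ∀ x, (s x).isSome ↔ x ∈ D

/-- A team is a set of assignments with a common finite domain; the domain is imposed by
`Team.HasDomain`. Since the universe is finite as well, such a set is finite. -/
abbrev Team (n : ℕ) : Type := Set (Assignment n)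

/-- All assignments in the team `X` have domain `D`. -/
def Team.HasDomain {n : ℕ} (X : Team n) (D : Finset ℕ) : Prop :=
  ∀ s ∈ X, Assignment.HasDomain s D

/-- The assignment `s(a/x)`. -/
def Assignment.supp {n : ℕ} (s : Assignment n) (a : Fin n) (x : ℕ) : Assignment n :=
  Function.update s x (some a)

/-- The team `X[F/x]`. -/
def Team.suppFun {n : ℕ} (X : Team n) (F : Assignment n → Set (Fin n)) (x : ℕ) : Team n :=
  {t | ∃ s ∈ X, ∃ a ∈ F s, t = Assignment.supp s a x}

/-- The team `X[A/x]`, where `A` is the universe. -/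
def Team.suppAll {n : ℕ} (X : Team n) (x : ℕ) : Team n :=
  {t | ∃ s ∈ X, ∃ a : Fin n, t = Assignment.supp s a x}

/-- Team semantics (lax version). For an assignment `s` and a tuple `x` of variables,
`s ∘ x` is the tuple of values `s(x)`. -/
def Sat {σ : Vocabulary} {n : ℕ} (A : FinStructure σ n) : Team n → Formula σ → Prop
  | X, .eq x y => ∀ s ∈ X, s x = s y
  | X, .neq x y => ∀ s ∈ X, s x ≠ s y
  | X, .rel R x => ∀ s ∈ X, ∃ a ∈ A.rel R, s ∘ x = some ∘ a
  | X, .nrel R x => ∀ s ∈ X, ¬ ∃ a ∈ A.rel R, s ∘ x = some ∘ a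
  | X, .dep x y => ∀ s ∈ X, ∀ t ∈ X, s ∘ x = t ∘ x → s ∘ y = t ∘ y
  | X, .incl x y => ∀ s ∈ X, ∃ t ∈ X, s ∘ x = t ∘ y
  | X, .indep x z y => ∀ s ∈ X, ∀ t ∈ X, s ∘ z = t ∘ z →
      ∃ u ∈ X, u ∘ x = s ∘ x ∧ u ∘ y = t ∘ y ∧ u ∘ z = s ∘ z
  | X, .and φ ψ => Sat A X φ ∧ Sat A X ψ
  | X, .or φ ψ => ∃ Y Z : Team n, Y ⊆ X ∧ Z ⊆ X ∧ Y ∪ Z = X ∧ Sat A Y φ ∧ Sat A Z ψ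
  | X, .ex x φ => ∃ F : Assignment n → Set (Fin n),
      (∀ s ∈ X, (F s).Nonempty) ∧ Sat A (Team.suppFun X F x) φ
  | X, .all x φ => Sat A (Team.suppAll X x) φ

/-! ### Binary encodings -/

/-- The characteristic word, of length `n ^ k`, of a set of `k`-tuples over `{0, …, n - 1}`.
Tuples are listed in the order of the numbers whose base-`n` digits they are. -/
noncomputable def tupleSetCode {k n : ℕ} (S : Set (Fin k → Fin n)) : List Bool :=
  open Classical in
  List.ofFn fun j : Fin (n ^ k) => decide (finFunctionFinEquiv.symm j ∈ S)

/-- The usual binary encoding of a finite structure: the size of the universe in unary, a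
separator, and the characteristic words of the relations. -/
noncomputable def FinStructure.code {σ : Vocabulary} {n : ℕ} (A : FinStructure σ n) : List Bool :=
  List.replicate n true ++ [false] ++ (List.ofFn fun R => tupleSetCode (A.rel R)).flatten

/-- The assignment with domain `D` that maps the `i`-th smallest variable of `D` to `a i`. -/
noncomputable def Assignment.ofTuple {n : ℕ} (D : Finset ℕ) (a : Fin D.card → Fin n) :
    Assignment n :=
  fun x => if h : x ∈ D then some (a ((D.orderIsoOfFin rfl).symm ⟨x, h⟩)) else none

/-- The binary encoding of a team with domain `D`: the characteristic word of the set of its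
value tuples. -/
noncomputable def Team.code {n : ℕ} (D : Finset ℕ) (X : Team n) : List Bool :=
  tupleSetCode {a : Fin D.card → Fin n | Assignment.ofTuple D a ∈ X}

end TeamLogic

namespace EnumComplexity

/-! ### The class NP -/

/-- The encoding of a pair of binary words by a word over `{0, 1, #}`. -/
def pairCode (xw : List Bool × List Bool) : List (Option Bool) :=
  xw.1.map some ++ [none] ++ xw.2.map some

/-- The class NP: languages with certificates of polynomial length that are verified by a
Turing machine in polynomial time. -/
def NP : Set (Language Bool) :=
  {L | ∃ (V : List Bool × List Bool → Bool) (q : Polynomial ℕ),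
    Nonempty (Turing.TM2ComputableInPolyTime pairCode Computability.encodeBool V) ∧
    ∀ x, x ∈ L ↔ ∃ w : List Bool, w.length ≤ q.eval x.length ∧ V (x, w) = true}

/-! ### Random access machines with an oracle -/

/-- Instructions of a random access machine. `R i` is the `i`-th work register, which holds a
natural number; `Q i` and `O i` are the query and the output registers, which hold one bit each. -/
inductive Instr : Type
  /-- `R i := c` -/
  | const (i c : ℕ) : Instr
  /-- `R i := R j + R k` -/
  | add (i j k : ℕ) : Instr
  /-- `R i := max (R j - R k) 0` -/
  | sub (i j k : ℕ) : Instr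
  /-- `R i := R (R j)` -/
  | load (i j : ℕ) : Instr
  /-- `R (R i) := R j` -/
  | store (i j : ℕ) : Instr
  /-- go to instruction `ℓ` -/
  | jump (ℓ : ℕ) : Instr
  /-- if `R i = 0`, go to instruction `ℓ` -/
  | jumpZero (i ℓ : ℕ) : Instr
  /-- `R i := ` the length of the input -/
  | inputLength (i : ℕ) : Instr
  /-- `R i := ` the bit of the input at position `R j` (`0` past the end) -/
  | readInput (i j : ℕ) : Instr
  /-- `Q (R i) := 1` if `R j ≠ 0`, and `Q (R i) := 0` otherwise -/
  | writeQuery (i j : ℕ) : Instr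
  /-- `R i := 1` if the word in `Q 0, …, Q (R j - 1)` is in the oracle, `R i := 0` otherwise -/
  | ask (i j : ℕ) : Instr
  /-- `O (R i) := 1` if `R j ≠ 0`, and `O (R i) := 0` otherwise -/
  | writeOutput (i j : ℕ) : Instr
  /-- output the word in `O 0, …, O (R j - 1)` -/
  | output (j : ℕ) : Instr

/-- A random access machine is a list of instructions. It halts when the instruction pointer
leaves the list. -/
abbrev RAM : Type := List Instr

/-- A configuration: instruction pointer and contents of the work, query and output registers. -/
structure Config where
  pc : ℕ
  reg : ℕ → ℕ
  query : ℕ → Bool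
  out : ℕ → Bool

/-- The initial configuration: all registers hold `0`. -/
def Config.init : Config := ⟨0, fun _ => 0, fun _ => false, fun _ => false⟩

/-- The word in the first `ℓ` registers of a bank of bit registers. -/
def readWord (b : ℕ → Bool) (ℓ : ℕ) : List Bool := (List.range ℓ).map b

/-- The effect of one instruction, given the oracle `L` and the input `x`. -/
noncomputable def Instr.exec (L : Language Bool) (x : List Bool) (c : Config) : Instr → Config
  | .const i v => { c with pc := c.pc + 1, reg := Function.update c.reg i v }
  | .add i j k =>
      { c with pc := c.pc + 1, reg := Function.update c.reg i (c.reg j + c.reg k) }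
  | .sub i j k =>
      { c with pc := c.pc + 1, reg := Function.update c.reg i (c.reg j - c.reg k) }
  | .load i j => { c with pc := c.pc + 1, reg := Function.update c.reg i (c.reg (c.reg j)) }
  | .store i j => { c with pc := c.pc + 1, reg := Function.update c.reg (c.reg i) (c.reg j) }
  | .jump ℓ => { c with pc := ℓ }
  | .jumpZero i ℓ => { c with pc := if c.reg i = 0 then ℓ else c.pc + 1 }
  | .inputLength i => { c with pc := c.pc + 1, reg := Function.update c.reg i x.length }
  | .readInput i j =>
      { c with pc := c.pc + 1, reg := Function.update c.reg i (x.getD (c.reg j) false).toNat }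
  | .writeQuery i j =>
      { c with pc := c.pc + 1, query := Function.update c.query (c.reg i) (c.reg j != 0) }
  | .ask i j =>
      open Classical in
      { c with
        pc := c.pc + 1
        reg := Function.update c.reg i (if readWord c.query (c.reg j) ∈ L then 1 else 0) }
  | .writeOutput i j =>
      { c with pc := c.pc + 1, out := Function.update c.out (c.reg i) (c.reg j != 0) }
  | .output _ => { c with pc := c.pc + 1 }

/-- One step of the machine; a halting configuration is kept. -/
noncomputable def RAM.step (M : RAM) (L : Language Bool) (x : List Bool) (c : Config) : Config :=
  match M[c.pc]? with
  | none => c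
  | some ins => ins.exec L x c

/-- The configuration after `t` steps on input `x` with oracle `L`. -/
noncomputable def RAM.configAt (M : RAM) (L : Language Bool) (x : List Bool) (t : ℕ) : Config :=
  (M.step L x)^[t] Config.init

/-- After `t` steps the machine has halted. -/
def RAM.HaltedAt (M : RAM) (L : Language Bool) (x : List Bool) (t : ℕ) : Prop :=
  M.length ≤ (M.configAt L x t).pc

/-- After `t` steps the next instruction outputs the word `y`. -/
def RAM.OutputsAt (M : RAM) (L : Language Bool) (x : List Bool) (t : ℕ) (y : List Bool) : Prop :=
  ∃ j, M[(M.configAt L x t).pc]? = some (.output j) ∧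
    y = readWord (M.configAt L x t).out ((M.configAt L x t).reg j)

/-- After `t` steps the next instruction asks the oracle whether it contains the word `q`. -/
def RAM.AsksAt (M : RAM) (L : Language Bool) (x : List Bool) (t : ℕ) (q : List Bool) : Prop :=
  ∃ i j, M[(M.configAt L x t).pc]? = some (.ask i j) ∧
    q = readWord (M.configAt L x t).query ((M.configAt L x t).reg j)

/-! ### Enumeration with polynomial delay -/

/-- An enumeration problem assigns to every input the set of its solutions. -/
abbrev EnumProblem : Type := List Bool → Set (List Bool)

/-- On input `x` and with oracle `L`, the machine `M` enumerates the set `S` without repetition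
and with delay at most `d`: it halts, and the time before the first output, between consecutive
outputs, and from the last output to the end is at most `d`. All oracle queries have length at
most `d` and all numbers in registers have at most `d` bits. -/
structure RAM.EnumeratesWithDelay (M : RAM) (L : Language Bool) (x : List Bool)
    (S : Set (List Bool)) (d : ℕ) : Prop where
  outputs : ∀ y, y ∈ S ↔ ∃ t, M.OutputsAt L x t y
  no_repetition : ∀ y t t', M.OutputsAt L x t y → M.OutputsAt L x t' y → t = t'
  halts : ∃ t, M.HaltedAt L x t
  /-- Counted from any moment `t`, the next output or the end comes after at most `d` steps. -/
  delay : ∀ t, ∃ t', t ≤ t' ∧ t' ≤ t + d ∧ (M.HaltedAt L x t' ∨ ∃ y, M.OutputsAt L x t' y)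
  queries : ∀ t q, M.AsksAt L x t q → q.length ≤ d
  registers : ∀ t i, (M.configAt L x t).reg i < 2 ^ d

/-- The class `Del C`: enumeration problems solved with polynomial delay by a random access
machine with an oracle in `C` and with polynomially bounded oracle queries. -/
def Del (C : Set (Language Bool)) : Set EnumProblem :=
  {E | ∃ (M : RAM) (L : Language Bool) (p : Polynomial ℕ), L ∈ C ∧
    ∀ x, M.EnumeratesWithDelay L x (E x) (p.eval x.length)}

end EnumComplexity

namespace TeamLogic

/-- The problem to enumerate, given a finite structure `A`, all nonempty teams `X` of `A` over the
free variables of `φ` that satisfy `φ`. A word that encodes no structure has no solutions. -/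
def ESatTeam {σ : Vocabulary} (φ : Formula σ) : EnumComplexity.EnumProblem := fun x =>
  {w | ∃ (n : ℕ) (A : FinStructure σ n) (X : Team n), A.code = x ∧
    Team.HasDomain X φ.free ∧ Sat A X φ ∧ X.Nonempty ∧ w = Team.code φ.free X}

end TeamLogic

/-! Let `K` bound all variables of `φ`, the quantified ones included. The partial assignments of
variables below `K` number `N = (n + 1) ^ K`, which is polynomial in the input because `φ` is fixed.
A team is therefore a bit string of length `N`, and the teams are linearly ordered by the
lexicographic order.

Satisfaction of `φ` by a team is an existential statement over boundedly many auxiliary teams: two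
for each disjunction, one for each quantifier. What remains to be checked about these teams always
has the same shape: for all `s`, `t` with a computable property, if `s` and `t` lie in given teams,
then some `u` in a computable relation to them lies in one of several given teams. Written out over
all numbers of assignments this is a family of polynomially many clauses. Soundness and completeness
of the translation are `sat_of_templates` and `templates_of_sat`. Being lexicographically larger
than a known team is also a conjunction of clauses (`lt_toLex_iff`), and so is agreement with a
known prefix. Hence it is a satisfiability query whether a satisfying team larger than the current
one exists, with or without a prescribed prefix (`teamGen_larger_mem`, `teamGen_larger_prefix_mem`).

The enumeration starts at the zero string, the empty team, which explains why exactly the nonempty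
teams appear. Each round asks whether a larger satisfying team exists, finds the least one bit by
bit with `N` further queries (`run_search`), outputs it and makes it the current team (`run_write`).
Strict increase excludes repetitions, and finiteness gives termination (`exists_iterates`).

Two models of computation have to be served. For NP, formulas in conjunctive normal form are encoded
as programs that move a head over the certificate, so that a Turing machine evaluates them in linear
time (`satLanguage_mem_NP`, `cnfWord_mem_satLanguage`). For the random access machine, the algorithm
is written in a language whose only control structure is the bounded loop. Polynomial bounds on
values, time and word lengths are then read off from the syntax, and a compiler respects them
(`Stmt.code_spec`). `mem_Del_of_iterates` turns such a program into an enumerator with polynomial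
delay. -/

/-! ## An NP language: satisfiability, checked by a head moving over the certificate -/

namespace EnumComplexity
namespace Verifier

/-- What the verifier has read of the current command. Commands are `11` (move right),
`10` (move left), `01c` (literal of sign `c`) and `00` (end of a clause). -/
inductive Mode
  | start | move | sel | lit
  deriving DecidableEq

instance : Fintype Mode :=
  ⟨{.start, .move, .sel, .lit}, fun x => by cases x <;> decide⟩

/-- The state of the verifier: the certificate left and right of the head, whether the current
clause is satisfied, whether all finished clauses are, and the current mode. -/
structure State where
  left : List Bool
  right : List Bool
  flag : Bool
  ok : Bool
  mode : Mode

/-- The effect of one bit of the program. -/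
def stepBit (b : Bool) (s : State) : State :=
  match s.mode with
  | .start => { s with mode := if b then .move else .sel }
  | .move =>
    if b then { s with left := s.right.headD false :: s.left, right := s.right.tail, mode := .start }
    else { s with left := s.left.tail, right := s.left.headD false :: s.right, mode := .start }
  | .sel =>
    if b then { s with mode := .lit }
    else { s with ok := s.ok && s.flag, flag := false, mode := .start }
  | .lit => { s with flag := s.flag || (s.right.headD false == b), mode := .start }

/-- The initial state on certificate `w`. -/
def init (w : List Bool) : State := ⟨[], w, false, true, .start⟩

/-- The program `x`, read from its end, accepts the certificate `w`. -/
def accepts (xw : List Bool × List Bool) : Bool := (xw.1.foldr stepBit (init xw.2)).ok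

/-! ### The Turing machine -/

/-- The contents of the verifying machine. -/
inductive Stack
  | inp | prog | left | res
  deriving DecidableEq

instance : Fintype Stack :=
  ⟨{.inp, .prog, .left, .res}, fun x => by cases x <;> decide⟩

/-- The stack alphabets. -/
abbrev Alphabet : Stack → Type
  | .inp => Option Bool
  | _ => Bool

/-- The labels of the verifying machine. -/
inductive Label
  | split | run | clean
  deriving DecidableEq

instance : Fintype Label :=
  ⟨{.split, .run, .clean}, fun x => by cases x <;> decide⟩

/-- Finite memory: mode, clause flag, verdict, and the last symbol read (`none` at the bottom of a
stack or at the separator). -/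
abbrev Memory : Type := Mode × Bool × Bool × Option Bool

open Turing.TM2.Stmt in
/-- The verifying machine's program. -/
def program : Label → Turing.TM2.Stmt Alphabet Label Memory
  | .split =>
    pop .inp (fun v s => (v.1, v.2.1, v.2.2.1, s.join)) <|
    branch (fun v => v.2.2.2.isSome)
      (push .prog (fun v => v.2.2.2.getD false) <| goto fun _ => .split)
      (goto fun _ => .run)
  | .run =>
    pop .prog (fun v s => (v.1, v.2.1, v.2.2.1, s)) <|
    branch (fun v => v.2.2.2.isNone) (goto fun _ => .clean) <|
    branch (fun v => v.1 = .move)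
      (branch (fun v => v.2.2.2 = some true)
        (pop .inp (fun v s => (.start, v.2.1, v.2.2.1, s.join)) <|
          push .left (fun v => v.2.2.2.getD false) <| goto fun _ => .run)
        (pop .left (fun v s => (.start, v.2.1, v.2.2.1, s)) <|
          push .inp (fun v => some (v.2.2.2.getD false)) <| goto fun _ => .run)) <|
    branch (fun v => v.1 = .lit)
      (peek .inp (fun v s => (.start, v.2.1 || (s.join.getD false == v.2.2.2.getD false),
        v.2.2.1, none)) <| goto fun _ => .run) <|
    branch (fun v => v.1 = .start)
      (load (fun v => (if v.2.2.2 = some true then .move else .sel, v.2.1, v.2.2.1, none)) <|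
        goto fun _ => .run) <|
    branch (fun v => v.2.2.2 = some true)
      (load (fun v => (.lit, v.2.1, v.2.2.1, none)) <| goto fun _ => .run)
      (load (fun v => (.start, false, v.2.2.1 && v.2.1, none)) <| goto fun _ => .run)
  | .clean =>
    pop .inp (fun v s => (v.1, v.2.1, v.2.2.1, s.join)) <|
    branch (fun v => v.2.2.2.isSome) (goto fun _ => .clean) <|
    pop .left (fun v s => (v.1, v.2.1, v.2.2.1, s)) <|
    branch (fun v => v.2.2.2.isSome) (goto fun _ => .clean) <|
    push .res (fun v => v.2.2.1) <|
    load (fun _ => (.start, false, true, none)) halt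

/-- The verifying machine. -/
def machine : Turing.FinTM2 where
  K := Stack
  k₀ := .inp
  k₁ := .res
  Γ := Alphabet
  Λ := Label
  main := .split
  σ := Memory
  initialState := (.start, false, true, none)
  Γk₀Fin := inferInstanceAs (Fintype (Option Bool))
  m := program

/-- The contents of the stacks. -/
def contents (inp : List (Option Bool)) (prog left res : List Bool) : ∀ k, List (Alphabet k)
  | .inp => inp
  | .prog => prog
  | .left => left
  | .res => res

/-! ### Runs of the verifying machine and their length -/

/-- Configurations of the verifying machine. -/
def mcfg (l : Option Label) (v : Memory) (inp : List (Option Bool)) (prog left res : List Bool) :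
    Turing.TM2.Cfg Alphabet Label Memory :=
  ⟨l, v, contents inp prog left res⟩

@[simp] theorem update_inp (i : List (Option Bool)) (p l r : List Bool) (z : List (Option Bool)) :
    Function.update (contents i p l r) .inp z = contents z p l r := by
  funext k; cases k <;> simp [contents, Function.update]
@[simp] theorem update_prog (i : List (Option Bool)) (p l r z : List Bool) :
    Function.update (contents i p l r) .prog z = contents i z l r := by
  funext k; cases k <;> simp [contents, Function.update]
@[simp] theorem update_left (i : List (Option Bool)) (p l r z : List Bool) :
    Function.update (contents i p l r) .left z = contents i p z r := by
  funext k; cases k <;> simp [contents, Function.update]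
@[simp] theorem update_res (i : List (Option Bool)) (p l r z : List Bool) :
    Function.update (contents i p l r) .res z = contents i p l z := by
  funext k; cases k <;> simp [contents, Function.update]

/-- `c'` is reached from `c` in exactly `n` steps. -/
def ReachesIn (n : ℕ) (c c' : Turing.TM2.Cfg Alphabet Label Memory) : Prop :=
  (flip bind (Turing.TM2.step program))^[n] (some c) = some c'

theorem ReachesIn.head {n : ℕ} {c c₁ c' : Turing.TM2.Cfg Alphabet Label Memory}
    (h : Turing.TM2.step program c = some c₁) (h' : ReachesIn n c₁ c') :
    ReachesIn (n + 1) c c' := by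
  unfold ReachesIn at *
  rw [Function.iterate_succ_apply]
  have : flip bind (Turing.TM2.step program) (some c) = some c₁ := h
  rw [this, h']

theorem ReachesIn.trans {m n : ℕ} {c c₁ c' : Turing.TM2.Cfg Alphabet Label Memory}
    (h : ReachesIn m c c₁) (h' : ReachesIn n c₁ c') : ReachesIn (n + m) c c' := by
  unfold ReachesIn at *
  rw [Function.iterate_add_apply, h, h']

/-- Moving the program from one stack to another reverses it, which is why programs are read from
their end. Once the separator has been popped, the input stack holds just the certificate and serves
as the right half of the tape. -/
theorem split_reaches (x : List Bool) (w : List (Option Bool)) : ∀ p : List Bool, ∀ v,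
    ReachesIn (x.length + 1) (mcfg (some .split) v (x.map some ++ none :: w) p [] [])
      (mcfg (some .run) (v.1, v.2.1, v.2.2.1, none) w (x.reverse ++ p) [] []) := by
  induction x with
  | nil =>
    intro p v
    refine .head ?_ rfl
    simp [mcfg, program, contents]
  | cons a x ih =>
    intro p v
    have h := ih (a :: p) (v.1, v.2.1, v.2.2.1, some a)
    refine .head (c₁ := mcfg (some .split) (v.1, v.2.1, v.2.2.1, some a)
      (x.map some ++ none :: w) (a :: p) [] []) ?_ (by simpa using h)
    simp [mcfg, program, contents]

/-- A step of the machine executes a statement up to its `goto`, so one program bit costs one step.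
The last symbol read is scratch and is therefore left unspecified. -/
theorem run_step (b : Bool) (p : List Bool) (s : State) (t : Option Bool) :
    ∃ t', Turing.TM2.step program
      (mcfg (some .run) (s.mode, s.flag, s.ok, t) (s.right.map some) (b :: p) s.left []) =
      some (mcfg (some .run) ((stepBit b s).mode, (stepBit b s).flag, (stepBit b s).ok, t')
        ((stepBit b s).right.map some) p (stepBit b s).left []) := by
  obtain ⟨l, r, f, o, m⟩ := s
  rcases m <;> rcases b <;> rcases l with _ | ⟨l₀, l⟩ <;> rcases r with _ | ⟨r₀, r⟩ <;>
    simp [mcfg, program, contents, stepBit]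

theorem run_reaches (p : List Bool) : ∀ (s : State) (t : Option Bool), ∃ t',
    ReachesIn (p.length + 1)
      (mcfg (some .run) (s.mode, s.flag, s.ok, t) (s.right.map some) p s.left [])
      (mcfg (some .clean) ((p.foldl (fun s b => stepBit b s) s).mode,
        (p.foldl (fun s b => stepBit b s) s).flag, (p.foldl (fun s b => stepBit b s) s).ok, t')
        ((p.foldl (fun s b => stepBit b s) s).right.map some) []
        (p.foldl (fun s b => stepBit b s) s).left []) := by
  induction p with
  | nil =>
    intro s t
    refine ⟨none, .head ?_ rfl⟩
    simp [mcfg, program, contents]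
  | cons b p ih =>
    intro s t
    obtain ⟨t₁, h₁⟩ := run_step b p s t
    obtain ⟨t₂, h₂⟩ := ih (stepBit b s) t₁
    exact ⟨t₂, .head h₁ h₂⟩

/-- Halting with a result requires every stack but the output to be empty and the memory to have its
initial value, so what is left of the tape has to be erased. -/
theorem clean_left (l : List Bool) : ∀ v : Memory,
    ReachesIn (l.length + 1) (mcfg (some .clean) v [] [] l [])
      (mcfg none (.start, false, true, none) [] [] [] [v.2.2.1]) := by
  induction l with
  | nil =>
    intro v
    refine .head ?_ rfl
    simp [mcfg, program, contents]
  | cons a l ih =>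
    intro v
    refine .head (c₁ := mcfg (some .clean) (v.1, v.2.1, v.2.2.1, some a) [] [] l []) ?_ (ih _)
    simp [mcfg, program, contents]

theorem clean_reaches (r l : List Bool) : ∀ v : Memory,
    ReachesIn (r.length + l.length + 1) (mcfg (some .clean) v (r.map some) [] l [])
      (mcfg none (.start, false, true, none) [] [] [] [v.2.2.1]) := by
  induction r with
  | nil => intro v; simpa using clean_left l v
  | cons a r ih =>
    intro v
    have h := ih (v.1, v.2.1, v.2.2.1, some a)
    have e : (a :: r).length + l.length + 1 = (r.length + l.length + 1) + 1 := by
      simp only [List.length_cons]; omega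
    rw [e]
    refine .head ?_ h
    simp [mcfg, program, contents]

/-- Only a move beyond an end of the stored tape creates a cell, and it creates one. This bounds the
time of the final erasure. -/
theorem length_stepBit (b : Bool) (s : State) :
    (stepBit b s).right.length + (stepBit b s).left.length ≤
      s.right.length + s.left.length + 1 := by
  obtain ⟨l, r, f, o, m⟩ := s
  rcases m <;> rcases b <;> simp [stepBit] <;> omega

theorem length_foldr_stepBit (x : List Bool) (s : State) :
    (x.foldr stepBit s).right.length + (x.foldr stepBit s).left.length ≤
      s.right.length + s.left.length + x.length := by
  induction x with
  | nil => simp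
  | cons b x ih =>
    have := length_stepBit b (x.foldr stepBit s)
    simp only [List.foldr_cons, List.length_cons]
    omega

/-- Splitting and running take `|x| + 1` steps each, and erasing at most `|x| + |w| + 1`, since the
tape has grown by at most `|x|` cells. -/
theorem accepts_reaches (x w : List Bool) : ∃ n ≤ 3 * (pairCode (x, w)).length + 3,
    ReachesIn n (mcfg (some .split) (.start, false, true, none) (pairCode (x, w)) [] [] [])
      (mcfg none (.start, false, true, none) [] [] [] [accepts (x, w)]) := by
  have h₁ := split_reaches x (w.map some) [] (.start, false, true, none)
  obtain ⟨t, h₂⟩ := run_reaches x.reverse (init w) none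
  rw [List.foldl_reverse] at h₂
  have h₃ := clean_reaches (x.foldr stepBit (init w)).right (x.foldr stepBit (init w)).left
    ((x.foldr stepBit (init w)).mode, (x.foldr stepBit (init w)).flag,
      (x.foldr stepBit (init w)).ok, t)
  have hl := length_foldr_stepBit x (init w)
  have e : pairCode (x, w) = x.map some ++ none :: w.map some := by simp [pairCode]
  rw [List.append_nil] at h₁
  refine ⟨_, ?_, e ▸ (h₁.trans h₂).trans h₃⟩
  simp only [init, List.length_nil] at hl
  simp only [e, List.length_append, List.length_map, List.length_cons, List.length_reverse]
  simp only [init]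
  omega

/-- The verifier runs in linear time on a Turing machine. -/
theorem nonempty_polyTime :
    Nonempty (Turing.TM2ComputableInPolyTime pairCode Computability.encodeBool accepts) := by
  refine ⟨⟨⟨machine, Equiv.refl _, Equiv.refl _⟩, 3 * Polynomial.X + 3, fun xw => ?_⟩⟩
  have h := accepts_reaches xw.1 xw.2
  refine ⟨⟨h.choose, ?_⟩, ?_⟩
  · have h' := h.choose_spec.2
    unfold ReachesIn at h'
    have ei : Turing.initList machine (List.map (Equiv.refl (Option Bool)).invFun (pairCode xw)) =
        mcfg (some .split) (.start, false, true, none) (pairCode (xw.1, xw.2)) [] [] [] := by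
      unfold Turing.initList mcfg
      congr 1
      funext k
      cases k
      · change List.map id (pairCode xw) = pairCode xw
        simp
      all_goals rfl
    have eh : Turing.haltList machine (List.map (Equiv.refl Bool).invFun
          (Computability.encodeBool (accepts xw))) =
        mcfg none (.start, false, true, none) [] [] [] [accepts (xw.1, xw.2)] := by
      unfold Turing.haltList mcfg
      congr 1
      funext k
      cases k <;> rfl
    refine Eq.trans ?_ (h'.trans ?_)
    · exact congrArg (fun c => (flip bind (Turing.TM2.step program))^[h.choose] (some c)) ei
    · exact congrArg some eh.symm
  · have := h.choose_spec.1
    simpa using this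

end Verifier

/-- The words that, as programs of the verifier, accept some certificate. -/
def satLanguage : Language Bool :=
  {x | ∃ w : List Bool, w.length ≤ x.length ∧ Verifier.accepts (x, w) = true}

theorem satLanguage_mem_NP : satLanguage ∈ NP :=
  ⟨Verifier.accepts, Polynomial.X, Verifier.nonempty_polyTime, fun x => by
    rw [Polynomial.eval_X]; exact Iff.rfl⟩

/-! ### Formulas in conjunctive normal form as programs of the verifier -/

namespace Verifier

/-- The program text for a literal (variable and sign); programs are read from the end. -/
def literalWord (l : ℕ × Bool) : List Bool :=
  (List.range l.1).flatMap (fun _ => [false, true]) ++ ([l.2, true, false] ++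
    (List.range l.1).flatMap (fun _ => [true, true]))

/-- The program text for a clause. -/
def clauseWord (cl : List (ℕ × Bool)) : List Bool := [false, false] ++ cl.flatMap literalWord

/-- The program text for a formula in conjunctive normal form. -/
def cnfWord (Φ : List (List (ℕ × Bool))) : List Bool := Φ.flatMap clauseWord

/-- The head stands on cell `v` of a tape with contents `α`. -/
def OnTape (α : ℕ → Bool) (v : ℕ) (f o : Bool) (s : State) : Prop :=
  s.left = ((List.range v).map α).reverse ∧ (∀ i, s.right.getD i false = α (v + i)) ∧
    s.flag = f ∧ s.ok = o ∧ s.mode = .start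

/-- The right half of the tape is described through `getD` with default `false` only, so it does not
matter whether the head is still inside the certificate or already on blank cells. -/
theorem OnTape.right {α : ℕ → Bool} {v : ℕ} {f o : Bool} {s : State} (h : OnTape α v f o s) :
    OnTape α (v + 1) f o ([true, true].foldr stepBit s) := by
  obtain ⟨l, r, f', o', m⟩ := s
  obtain ⟨rfl, hr, rfl, rfl, rfl⟩ := h
  simp only at hr
  refine ⟨?_, fun i => ?_, rfl, rfl, rfl⟩
  · have := hr 0
    cases r <;> simp_all [stepBit, List.range_succ]
  · have := hr (i + 1)
    rw [add_assoc, add_comm 1 i]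
    cases r <;> simp_all [stepBit]

theorem OnTape.left {α : ℕ → Bool} {v : ℕ} {f o : Bool} {s : State} (h : OnTape α (v + 1) f o s) :
    OnTape α v f o ([false, true].foldr stepBit s) := by
  obtain ⟨l, r, f', o', m⟩ := s
  obtain ⟨rfl, hr, rfl, rfl, rfl⟩ := h
  simp only at hr
  refine ⟨?_, fun i => ?_, rfl, rfl, rfl⟩
  · simp [stepBit, List.range_succ]
  · cases i with
    | zero => simp [stepBit, List.range_succ]
    | succ i =>
      have := hr i
      rw [add_assoc, add_comm 1 i] at this
      simpa [stepBit, List.range_succ] using this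

theorem OnTape.rights {α : ℕ → Bool} {f o : Bool} {s : State} (h : OnTape α 0 f o s) (v : ℕ) :
    OnTape α v f o (((List.range v).flatMap fun _ => [true, true]).foldr stepBit s) := by
  have aux : ∀ v u s, OnTape α u f o s →
      OnTape α (u + v) f o (((List.range v).flatMap fun _ => [true, true]).foldr stepBit s) := by
    intro v
    induction v with
    | zero => intro u s h; simpa using h
    | succ v ih =>
      intro u s h
      rw [List.range_succ, List.flatMap_append, List.foldr_append]
      have := ih (u + 1) _ h.right
      simpa [add_assoc, add_comm 1 v] using this
  simpa using aux v 0 s h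

theorem OnTape.lefts {α : ℕ → Bool} {f o : Bool} (v : ℕ) : ∀ {s : State}, OnTape α v f o s →
    OnTape α 0 f o (((List.range v).flatMap fun _ => [false, true]).foldr stepBit s) := by
  induction v with
  | zero => intro s h; simpa using h
  | succ v ih =>
    intro s h
    rw [List.range_succ, List.flatMap_append, List.foldr_append]
    simpa using ih h.left

/-- Read from the end, the word of a literal walks to the cell of the variable, compares it with the
sign and walks back. As the head returns to cell `0`, words of literals can be concatenated. -/
theorem OnTape.literal {α : ℕ → Bool} {f o : Bool} {s : State} (h : OnTape α 0 f o s)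
    (l : ℕ × Bool) :
    OnTape α 0 (f || (α l.1 == l.2)) o ((literalWord l).foldr stepBit s) := by
  unfold literalWord
  rw [List.foldr_append, List.foldr_append]
  refine OnTape.lefts _ ?_
  have h' := h.rights l.1
  generalize List.foldr stepBit s _ = s' at h'
  obtain ⟨l', r, f', o', m⟩ := s'
  obtain ⟨rfl, hr, rfl, rfl, rfl⟩ := h'
  simp only at hr
  have h0 := hr 0
  refine ⟨rfl, hr, ?_, rfl, rfl⟩
  cases r <;> simp_all [stepBit]

theorem OnTape.literals {α : ℕ → Bool} {f o : Bool} {s : State} (h : OnTape α 0 f o s)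
    (cl : List (ℕ × Bool)) :
    OnTape α 0 (f || cl.any fun l => α l.1 == l.2) o
      ((cl.flatMap literalWord).foldr stepBit s) := by
  induction cl with
  | nil => simpa using h
  | cons l cl ih =>
    rw [List.flatMap_cons, List.foldr_append]
    have := ih.literal l
    rwa [Bool.or_assoc, Bool.or_comm (cl.any _)] at this

/-- The mark `00` stands in front of the literals of its clause because it has to be read after
them; it adds the clause flag to the verdict and resets the flag. -/
theorem OnTape.cnf {α : ℕ → Bool} {s : State} (h : OnTape α 0 false true s)
    (Φ : List (List (ℕ × Bool))) :
    OnTape α 0 false (Φ.all fun cl => cl.any fun l => α l.1 == l.2)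
      ((cnfWord Φ).foldr stepBit s) := by
  induction Φ with
  | nil => simpa [cnfWord] using h
  | cons cl Φ ih =>
    have e : cnfWord (cl :: Φ) = [false, false] ++ (cl.flatMap literalWord ++ cnfWord Φ) := by
      simp [cnfWord, clauseWord]
    rw [e, List.foldr_append, List.foldr_append]
    have := ih.literals cl
    generalize List.foldr stepBit _ _ = s' at this
    obtain ⟨l', r, f', o', m⟩ := s'
    obtain ⟨rfl, hr, rfl, rfl, rfl⟩ := this
    refine ⟨rfl, hr, rfl, ?_, rfl⟩
    simp [stepBit, Bool.and_comm]

theorem accepts_cnfWord (Φ : List (List (ℕ × Bool))) (α : ℕ → Bool) (w : List Bool)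
    (h : ∀ i, w.getD i false = α i) :
    accepts (cnfWord Φ, w) = true ↔ ∀ cl ∈ Φ, ∃ l ∈ cl, α l.1 = l.2 := by
  have h0 : OnTape α 0 false true (init w) := ⟨by simp [init], by simpa [init] using h, rfl, rfl, rfl⟩
  have := (h0.cnf Φ).2.2.2.1
  simp [accepts, this]

/-- Addressing a variable takes at least as many program bits as its number. A certificate as long
as the program thus covers all variables that occur, which justifies the length bound in
`satLanguage`. -/
theorem lt_length_cnfWord {Φ : List (List (ℕ × Bool))} {cl : List (ℕ × Bool)} (hcl : cl ∈ Φ)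
    {l : ℕ × Bool} (hl : l ∈ cl) : l.1 < (cnfWord Φ).length := by
  have h₁ : l.1 < (literalWord l).length := by simp [literalWord]; omega
  have h₂ : (literalWord l).length ≤ (cl.flatMap literalWord).length :=
    (List.sublist_flatten_of_mem (List.mem_map_of_mem hl)).length_le
  have h₃ : (clauseWord cl).length ≤ (cnfWord Φ).length :=
    (List.sublist_flatten_of_mem (List.mem_map_of_mem hcl)).length_le
  simp only [clauseWord, List.length_append] at h₃
  omega

end Verifier

/-- Satisfiability of a formula in conjunctive normal form. -/
theorem cnfWord_mem_satLanguage (Φ : List (List (ℕ × Bool))) :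
    Verifier.cnfWord Φ ∈ satLanguage ↔
      ∃ α : ℕ → Bool, ∀ cl ∈ Φ, ∃ l ∈ cl, α l.1 = l.2 := by
  constructor
  · rintro ⟨w, -, hw⟩
    exact ⟨fun i => w.getD i false, (Verifier.accepts_cnfWord Φ _ w fun _ => rfl).1 hw⟩
  · rintro ⟨α, hα⟩
    refine ⟨(List.range (Verifier.cnfWord Φ).length).map α, by simp, ?_⟩
    rw [Verifier.accepts_cnfWord Φ _ _ fun _ => rfl]
    intro cl hcl
    obtain ⟨l, hl, h⟩ := hα cl hcl
    refine ⟨l, hl, ?_⟩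
    have := Verifier.lt_length_cnfWord hcl hl
    simpa [List.getD_eq_getElem?_getD, this] using h

end EnumComplexity

/-! ## A small loop language and its translation to random access machines -/

namespace EnumComplexity
namespace Loop

open Function Polynomial

/-- Numeric expressions in `k` variables over the input word and a memory of bits. -/
inductive Expr : ℕ → Type
  | var {k : ℕ} (i : Fin k) : Expr k
  | const {k : ℕ} (c : ℕ) : Expr k
  | add {k : ℕ} (a b : Expr k) : Expr k
  | sub {k : ℕ} (a b : Expr k) : Expr k
  | inputLength {k : ℕ} : Expr k
  | inputBit {k : ℕ} (a : Expr k) : Expr k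
  | mem {k : ℕ} (a : Expr k) : Expr k
  /-- the sum of `f` over all values of the new variable `0` below `b` -/
  | sum {k : ℕ} (b : Expr k) (f : Expr (k + 1)) : Expr k

/-- The value of an expression. -/
def Expr.eval (x : List Bool) (m : ℕ → Bool) : {k : ℕ} → Expr k → (Fin k → ℕ) → ℕ
  | _, .var i, env => env i
  | _, .const c, _ => c
  | _, .add a b, env => a.eval x m env + b.eval x m env
  | _, .sub a b, env => a.eval x m env - b.eval x m env
  | _, .inputLength, _ => x.length
  | _, .inputBit a, env => (x.getD (a.eval x m env) false).toNat
  | _, .mem a, env => (m (a.eval x m env)).toNat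
  | _, .sum b f, env => ∑ i ∈ Finset.range (b.eval x m env), f.eval x m (Matrix.vecCons i env)

/-- Programs that write a word. -/
inductive Gen : ℕ → Type
  | nil {k : ℕ} : Gen k
  | bit {k : ℕ} (b : Bool) : Gen k
  | seq {k : ℕ} (g h : Gen k) : Gen k
  /-- run `g` for all values of the new variable `0` below `b` -/
  | loop {k : ℕ} (b : Expr k) (g : Gen (k + 1)) : Gen k

/-- The word that is written. -/
def Gen.word (x : List Bool) (m : ℕ → Bool) : {k : ℕ} → Gen k → (Fin k → ℕ) → List Bool
  | _, .nil, _ => []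
  | _, .bit b, _ => [b]
  | _, .seq g h, env => g.word x m env ++ h.word x m env
  | _, .loop b g, env =>
    (List.range (b.eval x m env)).flatMap fun i => g.word x m (Matrix.vecCons i env)

/-- Programs that change the memory and the output registers. -/
inductive Stmt : ℕ → Type
  /-- set the memory bit at `a` to `1` if `e` is positive and to `0` otherwise -/
  | set {k : ℕ} (a e : Expr k) : Stmt k
  /-- set the memory bit at `a` to the oracle's answer to the word written by `g` -/
  | ask {k : ℕ} (a : Expr k) (g : Gen k) : Stmt k
  /-- set the output register `a` to `1` if `e` is positive and to `0` otherwise -/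
  | out {k : ℕ} (a e : Expr k) : Stmt k
  | seq {k : ℕ} (p q : Stmt k) : Stmt k
  /-- run `p` for all values of the new variable `0` below `b` -/
  | loop {k : ℕ} (b : Expr k) (p : Stmt (k + 1)) : Stmt k

/-- Memory and output registers. -/
structure Store where
  mem : ℕ → Bool
  out : ℕ → Bool

open Classical in
/-- The effect of a program. -/
noncomputable def Stmt.run (L : Language Bool) (x : List Bool) :
    {k : ℕ} → Stmt k → (Fin k → ℕ) → Store → Store
  | _, .set a e, env, s =>
    { s with mem := update s.mem (a.eval x s.mem env) (e.eval x s.mem env != 0) }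
  | _, .ask a g, env, s =>
    { s with mem := update s.mem (a.eval x s.mem env) (decide (g.word x s.mem env ∈ L)) }
  | _, .out a e, env, s =>
    { s with out := update s.out (a.eval x s.mem env) (e.eval x s.mem env != 0) }
  | _, .seq p q, env, s => q.run L x env (p.run L x env s)
  | _, .loop b p, env, s =>
    (List.range (b.eval x s.mem env)).foldl (fun s i => p.run L x (Matrix.vecCons i env) s) s

/-! ### Bounds -/

/-- A bound for the value of an expression, in terms of a bound for input length and variables. -/
noncomputable def Expr.size : {k : ℕ} → Expr k → ℕ[X]
  | _, .var _ => X
  | _, .const c => C c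
  | _, .add a b => a.size + b.size
  | _, .sub a _ => a.size
  | _, .inputLength => X
  | _, .inputBit _ => 1
  | _, .mem _ => 1
  | _, .sum b f => b.size * f.size.comp (X + b.size)

/-- A bound for the evaluation time of an expression and the numbers that occur. -/
noncomputable def Expr.cost : {k : ℕ} → Expr k → ℕ[X]
  | _, .var _ => 2
  | _, .const c => C c + 1
  | _, .add a b => a.cost + b.cost + a.size + b.size + 1
  | _, .sub a b => a.cost + b.cost + 1
  | _, .inputLength => X + 1
  | _, .inputBit a => a.cost + 1
  | _, .mem a => a.cost + 2 * a.size + 5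
  | _, .sum b f => b.cost + b.size * (f.cost.comp (X + b.size) + 6) +
      b.size * f.size.comp (X + b.size) + 5

/-- A bound for the length of the word that is written. -/
noncomputable def Gen.size : {k : ℕ} → Gen k → ℕ[X]
  | _, .nil => 0
  | _, .bit _ => 1
  | _, .seq g h => g.size + h.size
  | _, .loop b g => b.size * g.size.comp (X + b.size)

/-- A bound for the time to write the word. -/
noncomputable def Gen.cost : {k : ℕ} → Gen k → ℕ[X]
  | _, .nil => 0
  | _, .bit _ => 4
  | _, .seq g h => g.cost + h.cost
  | _, .loop b g => b.cost + b.size * (g.cost.comp (X + b.size) + 5) + 3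

/-- A bound for the running time of a program and the numbers that occur. -/
noncomputable def Stmt.cost : {k : ℕ} → Stmt k → ℕ[X]
  | _, .set a e => e.cost + a.cost + 2 * a.size + 8
  | _, .ask a g => g.cost + g.size + a.cost + 2 * a.size + 8
  | _, .out a e => a.cost + e.cost + 1
  | _, .seq p q => p.cost + q.cost
  | _, .loop b p => b.cost + b.size * (p.cost.comp (X + b.size) + 5) + 3

/-- The bound for the extended environment is the sum and not the maximum, because a sum of
polynomials is a polynomial; it matches the substitution of `X + b.size` in the bounds. -/
theorem vecCons_le {k : ℕ} {env : Fin k → ℕ} {b i n : ℕ} (henv : ∀ j, env j ≤ b) (hi : i ≤ n) :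
    ∀ j, Matrix.vecCons i env j ≤ b + n := by
  intro j
  refine Fin.cases ?_ (fun j => ?_) j
  · rw [Matrix.cons_val_zero]; omega
  · rw [Matrix.cons_val_succ]; have := henv j; omega

/-- The memory does not enter the bound, since a cell contributes at most `1`. -/
theorem Expr.eval_le_size {x : List Bool} {m : ℕ → Bool} {k : ℕ} (e : Expr k) :
    ∀ {env : Fin k → ℕ} {b : ℕ}, (∀ i, env i ≤ b) → x.length ≤ b →
      e.eval x m env ≤ e.size.eval b := by
  induction e with
  | var i => intro env b henv _; simpa [Expr.eval, Expr.size] using henv i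
  | const c => intro env b _ _; simp [Expr.eval, Expr.size]
  | add a c iha ihc =>
    intro env b henv hx
    have := iha henv hx; have := ihc henv hx
    simp only [Expr.eval, Expr.size, eval_add]; omega
  | sub a c iha ihc =>
    intro env b henv hx
    have := iha henv hx
    simp only [Expr.eval, Expr.size]; omega
  | inputLength => intro env b _ hx; simpa [Expr.eval, Expr.size] using hx
  | inputBit a => intro env b _ _; simpa [Expr.eval, Expr.size] using Bool.toNat_le _
  | mem a => intro env b _ _; simpa [Expr.eval, Expr.size] using Bool.toNat_le _
  | sum c f ihc ihf =>
    intro env b henv hx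
    have hc := ihc henv hx
    simp only [Expr.eval, Expr.size, eval_mul, eval_comp, eval_add, eval_X]
    calc _ ≤ ∑ i ∈ Finset.range (c.eval x m env), f.size.eval (b + c.size.eval b) := by
          refine Finset.sum_le_sum fun i hi => ihf ?_ (by omega)
          exact vecCons_le henv (by have := Finset.mem_range.1 hi; omega)
      _ ≤ _ := by simpa using Nat.mul_le_mul_right _ hc

theorem Gen.length_word_le {x : List Bool} {m : ℕ → Bool} {k : ℕ} (g : Gen k) :
    ∀ {env : Fin k → ℕ} {b : ℕ}, (∀ i, env i ≤ b) → x.length ≤ b →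
      (g.word x m env).length ≤ g.size.eval b := by
  induction g with
  | nil => intro env b _ _; simp [Gen.word]
  | bit c => intro env b _ _; simp [Gen.word, Gen.size]
  | seq g h ihg ihh =>
    intro env b henv hx
    have := ihg henv hx; have := ihh henv hx
    simp only [Gen.word, Gen.size, eval_add, List.length_append]; omega
  | loop c g ihg =>
    intro env b henv hx
    have hc := c.eval_le_size (m := m) henv hx
    simp only [Gen.word, Gen.size, eval_mul, eval_comp, eval_add, eval_X, List.length_flatMap]
    have h := List.sum_le_card_nsmul ((List.range (c.eval x m env)).map fun i =>
      (g.word x m (Matrix.vecCons i env)).length) (g.size.eval (b + c.size.eval b)) (by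
        simp only [List.mem_map, List.mem_range, forall_exists_index, and_imp]
        rintro _ i hi rfl
        exact ihg (vecCons_le henv (by omega)) (by omega))
    refine h.trans ?_
    simpa using Nat.mul_le_mul_right _ hc

/-! ### Runs of machine code -/

/-- Scalar registers, memory, query and output registers. -/
structure Data where
  reg : ℕ → ℕ
  mem : ℕ → Bool
  query : ℕ → Bool
  out : ℕ → Bool

/-- The machine configuration that holds scalars in even and memory in odd registers. -/
def cfg (pc : ℕ) (D : Data) : Config :=
  ⟨pc, fun r => if r % 2 = 0 then D.reg (r / 2) else (D.mem (r / 2)).toNat, D.query, D.out⟩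

@[simp] theorem cfg_reg_even (pc : ℕ) (D : Data) (i : ℕ) : (cfg pc D).reg (2 * i) = D.reg i := by
  simp [cfg]

@[simp] theorem cfg_reg_odd (pc : ℕ) (D : Data) (i : ℕ) :
    (cfg pc D).reg (2 * i + 1) = (D.mem i).toNat := by
  have : (2 * i + 1) / 2 = i := by omega
  simp [cfg, this]

theorem update_cfg_even (pc : ℕ) (D : Data) (i v : ℕ) :
    update (cfg pc D).reg (2 * i) v = (cfg pc { D with reg := update D.reg i v }).reg := by
  funext r
  obtain ⟨j, rfl | rfl⟩ := Nat.even_or_odd' r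
  · by_cases h : j = i
    · subst h; simp
    · rw [update_of_ne (by omega)]; simp [h]
  · rw [update_of_ne (by omega)]; simp

theorem update_cfg_odd (pc : ℕ) (D : Data) (i : ℕ) (v : Bool) :
    update (cfg pc D).reg (2 * i + 1) v.toNat =
      (cfg pc { D with mem := update D.mem i v }).reg := by
  funext r
  obtain ⟨j, rfl | rfl⟩ := Nat.even_or_odd' r
  · rw [update_of_ne (by omega)]; simp
  · by_cases h : j = i
    · subst h; simp
    · rw [update_of_ne (by omega)]; simp [h]

/-- In configuration `c`, registers are at most `B` and an instruction other than an output is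
executed. -/
def Safe (M : RAM) (B : ℕ) (c : Config) : Prop :=
  (∀ i, c.reg i ≤ B) ∧ ∃ ins, M[c.pc]? = some ins ∧ ∀ j, ins ≠ .output j

/-- `n` steps lead from one configuration to another, through safe configurations. -/
inductive Steps (M : RAM) (L : Language Bool) (x : List Bool) (B : ℕ) :
    ℕ → Config → Config → Prop
  | refl (c : Config) : Steps M L x B 0 c c
  | head {n : ℕ} {c c' : Config} : Safe M B c → Steps M L x B n (M.step L x c) c' →
      Steps M L x B (n + 1) c c'

section Runs

variable {M : RAM} {L : Language Bool} {x : List Bool} {B : ℕ}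

theorem Steps.trans {n n' : ℕ} {c c' c'' : Config} (h : Steps M L x B n c c')
    (h' : Steps M L x B n' c' c'') : Steps M L x B (n + n') c c'' := by
  induction h with
  | refl => simpa using h'
  | head hs _ ih => rw [Nat.add_right_comm]; exact .head hs (ih h')

/-- All scalars are at most `B`. -/
def Data.Bounded (B : ℕ) (D : Data) : Prop := ∀ i, D.reg i ≤ B

variable (M L x B) in
/-- At most `T` safe steps lead from address `o` and data `D` to address `o'` and data `D'`. -/
def Runs (T o : ℕ) (D : Data) (o' : ℕ) (D' : Data) : Prop :=
  D'.Bounded B ∧ ∃ t ≤ T, Steps M L x B t (cfg o D) (cfg o' D')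

theorem Runs.refl {T o : ℕ} {D : Data} (hD : D.Bounded B) : Runs M L x B T o D o D :=
  ⟨hD, 0, by omega, .refl _⟩

theorem Runs.trans {T T' o o' o'' : ℕ} {D D' D'' : Data} (h : Runs M L x B T o D o' D')
    (h' : Runs M L x B T' o' D' o'' D'') : Runs M L x B (T + T') o D o'' D'' := by
  obtain ⟨_, t, ht, hs⟩ := h
  obtain ⟨hb, t', ht', hs'⟩ := h'
  exact ⟨hb, t + t', by omega, hs.trans hs'⟩

theorem Runs.mono {T T' o o' : ℕ} {D D' : Data} (h : Runs M L x B T o D o' D') (hT : T ≤ T') :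
    Runs M L x B T' o D o' D' :=
  ⟨h.1, h.2.choose, h.2.choose_spec.1.trans hT, h.2.choose_spec.2⟩

theorem Data.Bounded.update {D : Data} (hD : D.Bounded B) (i : ℕ) {v : ℕ} (hv : v ≤ B) :
    Data.Bounded B { D with reg := update D.reg i v } := by
  intro j
  by_cases h : j = i
  · subst h; simpa using hv
  · simpa [h] using hD j

/-- The assumption `1 ≤ B` takes care of the odd registers, which hold bits. -/
theorem Runs.of_exec {o o' : ℕ} {D D' : Data} {ins : Instr} (h : M[o]? = some ins)
    (hins : ∀ j, ins ≠ .output j) (hB : 1 ≤ B) (hD : D.Bounded B) (hD' : D'.Bounded B)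
    (he : ins.exec L x (cfg o D) = cfg o' D') : Runs M L x B 1 o D o' D' := by
  refine ⟨hD', 1, le_rfl, .head ⟨fun r => ?_, ins, h, hins⟩ ?_⟩
  · simp only [cfg]
    split
    · exact hD _
    · exact (Bool.toNat_le _).trans hB
  · have : M.step L x (cfg o D) = cfg o' D' := by
      rw [← he, RAM.step]
      simp only [cfg] at h ⊢
      rw [h]
    rw [this]
    exact .refl _

theorem Runs.const {o i v : ℕ} {D : Data} (h : M[o]? = some (.const (2 * i) v)) (hB : 1 ≤ B)
    (hD : D.Bounded B) (hv : v ≤ B) :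
    Runs M L x B 1 o D (o + 1) { D with reg := update D.reg i v } := by
  refine .of_exec h (by simp) hB hD (hD.update i hv) ?_
  simp only [Instr.exec, update_cfg_even]
  rfl

theorem Runs.add {o i j k : ℕ} {D : Data} (h : M[o]? = some (.add (2 * i) (2 * j) (2 * k)))
    (hB : 1 ≤ B) (hD : D.Bounded B) (hv : D.reg j + D.reg k ≤ B) :
    Runs M L x B 1 o D (o + 1) { D with reg := update D.reg i (D.reg j + D.reg k) } := by
  refine .of_exec h (by simp) hB hD (hD.update i hv) ?_
  simp only [Instr.exec, update_cfg_even, cfg_reg_even]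
  rfl

theorem Runs.sub {o i j k : ℕ} {D : Data} (h : M[o]? = some (.sub (2 * i) (2 * j) (2 * k)))
    (hB : 1 ≤ B) (hD : D.Bounded B) :
    Runs M L x B 1 o D (o + 1) { D with reg := update D.reg i (D.reg j - D.reg k) } := by
  refine .of_exec h (by simp) hB hD
    (hD.update i ((Nat.sub_le _ _).trans (hD j))) ?_
  simp only [Instr.exec, update_cfg_even, cfg_reg_even]
  rfl

theorem Runs.loadMem {o i j a : ℕ} {D : Data} (h : M[o]? = some (.load (2 * i) (2 * j)))
    (hB : 1 ≤ B) (hD : D.Bounded B) (ha : D.reg j = 2 * a + 1) :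
    Runs M L x B 1 o D (o + 1) { D with reg := update D.reg i (D.mem a).toNat } := by
  refine .of_exec h (by simp) hB hD (hD.update i ((Bool.toNat_le _).trans hB)) ?_
  simp only [Instr.exec, cfg_reg_even, ha, cfg_reg_odd, update_cfg_even]
  rfl

theorem Runs.storeMem {o i j a : ℕ} {v : Bool} {D : Data}
    (h : M[o]? = some (.store (2 * i) (2 * j))) (hB : 1 ≤ B) (hD : D.Bounded B)
    (ha : D.reg i = 2 * a + 1) (hv : D.reg j = v.toNat) :
    Runs M L x B 1 o D (o + 1) { D with mem := update D.mem a v } := by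
  refine .of_exec h (by simp) hB hD hD ?_
  simp only [Instr.exec, cfg_reg_even, ha, hv, update_cfg_odd]
  rfl

theorem Runs.jump {o l : ℕ} {D : Data} (h : M[o]? = some (.jump l)) (hB : 1 ≤ B)
    (hD : D.Bounded B) : Runs M L x B 1 o D l D :=
  .of_exec h (by simp) hB hD hD rfl

theorem Runs.jumpZero {o i l : ℕ} {D : Data} (h : M[o]? = some (.jumpZero (2 * i) l)) (hB : 1 ≤ B)
    (hD : D.Bounded B) : Runs M L x B 1 o D (if D.reg i = 0 then l else o + 1) D := by
  refine .of_exec h (by simp) hB hD hD ?_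
  simp only [Instr.exec, cfg_reg_even]
  rfl

theorem Runs.inputLength {o i : ℕ} {D : Data} (h : M[o]? = some (.inputLength (2 * i)))
    (hB : 1 ≤ B) (hD : D.Bounded B) (hv : x.length ≤ B) :
    Runs M L x B 1 o D (o + 1) { D with reg := update D.reg i x.length } := by
  refine .of_exec h (by simp) hB hD (hD.update i hv) ?_
  simp only [Instr.exec, update_cfg_even]
  rfl

theorem Runs.readInput {o i j : ℕ} {D : Data} (h : M[o]? = some (.readInput (2 * i) (2 * j)))
    (hB : 1 ≤ B) (hD : D.Bounded B) :
    Runs M L x B 1 o D (o + 1)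
      { D with reg := update D.reg i (x.getD (D.reg j) false).toNat } := by
  refine .of_exec h (by simp) hB hD (hD.update i ((Bool.toNat_le _).trans hB)) ?_
  simp only [Instr.exec, cfg_reg_even, update_cfg_even]
  rfl

theorem Runs.writeQuery {o i j : ℕ} {D : Data} (h : M[o]? = some (.writeQuery (2 * i) (2 * j)))
    (hB : 1 ≤ B) (hD : D.Bounded B) :
    Runs M L x B 1 o D (o + 1) { D with query := update D.query (D.reg i) (D.reg j != 0) } := by
  refine .of_exec h (by simp) hB hD hD ?_
  simp only [Instr.exec, cfg_reg_even]
  rfl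

theorem Runs.writeOutput {o i j : ℕ} {D : Data} (h : M[o]? = some (.writeOutput (2 * i) (2 * j)))
    (hB : 1 ≤ B) (hD : D.Bounded B) :
    Runs M L x B 1 o D (o + 1) { D with out := update D.out (D.reg i) (D.reg j != 0) } := by
  refine .of_exec h (by simp) hB hD hD ?_
  simp only [Instr.exec, cfg_reg_even]
  rfl

open Classical in
theorem Runs.ask {o i j : ℕ} {D : Data} (h : M[o]? = some (.ask (2 * i) (2 * j)))
    (hB : 1 ≤ B) (hD : D.Bounded B) :
    Runs M L x B 1 o D (o + 1)
      { D with reg := update D.reg i (decide (readWord D.query (D.reg j) ∈ L)).toNat } := by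
  refine .of_exec h (by simp) hB hD (hD.update i ((Bool.toNat_le _).trans hB)) ?_
  simp only [Instr.exec, cfg_reg_even]
  have e : (if readWord (cfg o D).query (D.reg j) ∈ L then 1 else 0) =
      (decide (readWord D.query (D.reg j) ∈ L)).toNat := by
    by_cases hq : readWord D.query (D.reg j) ∈ L <;> simp [cfg, hq]
  rw [e, update_cfg_even]
  rfl

end Runs

/-! ### Code -/

/-- The code `l` stands in `M` at address `o`. -/
def Contains (M : RAM) (o : ℕ) (l : List Instr) : Prop :=
  ∀ i (h : i < l.length), M[o + i]? = some l[i]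

theorem contains_cons {M : RAM} {o : ℕ} {a : Instr} {l : List Instr} :
    Contains M o (a :: l) ↔ M[o]? = some a ∧ Contains M (o + 1) l := by
  constructor
  · intro h
    refine ⟨h 0 (by simp), fun i hi => ?_⟩
    have := h (i + 1) (by simpa using hi)
    rw [show o + 1 + i = o + (i + 1) by omega, this]
    simp
  · rintro ⟨h₀, h⟩ i hi
    cases i with
    | zero => simpa using h₀
    | succ i =>
      have := h i (by simpa using hi)
      rw [show o + (i + 1) = o + 1 + i by omega, this]
      simp

theorem contains_append {M : RAM} {o : ℕ} {l l' : List Instr} :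
    Contains M o (l ++ l') ↔ Contains M o l ∧ Contains M (o + l.length) l' := by
  induction l generalizing o with
  | nil => simp [Contains]
  | cons a l ih =>
    rw [List.cons_append, contains_cons, contains_cons, ih, List.length_cons, and_assoc,
      show o + 1 + l.length = o + (l.length + 1) by omega]

theorem contains_self (M : RAM) : Contains M 0 M := by
  intro i h
  simp [h]

/-- A loop at address `o`: the scalar `d` holds the bound, `d + 1` is the counter, and `d + 2` is
used for tests. -/
def loopCode (o d : ℕ) (body : ℕ → List Instr) : List Instr :=
  [.const (2 * (d + 1)) 0, .sub (2 * (d + 2)) (2 * d) (2 * (d + 1)),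
    .jumpZero (2 * (d + 2)) (o + (body (o + 3)).length + 6)] ++ (body (o + 3) ++
  [.const (2 * (d + 2)) 1, .add (2 * (d + 1)) (2 * (d + 1)) (2 * (d + 2)), .jump (o + 1)])

theorem length_loopCode (o d : ℕ) (body : ℕ → List Instr) :
    (loopCode o d body).length = (body (o + 3)).length + 6 := by
  simp [loopCode]

section

variable {M : RAM} {L : Language Bool} {x : List Bool} {B : ℕ}

/-- The stability assumption says that the invariant looks only at scalars below `d`, so the
bookkeeping in `d`, `d + 1` and `d + 2` cannot spoil it. The loop itself spends five instructions
per round, one at the start, and two for the last test. -/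
theorem loop_spec {o d n T : ℕ} {body : ℕ → List Instr} (Inv : ℕ → Data → Prop)
    (hM : Contains M o (loopCode o d body)) (hB : 1 ≤ B) (hnB : n ≤ B)
    (hstab : ∀ i D R, (∀ j < d, R j = D.reg j) → Inv i D → Inv i { D with reg := R })
    (hbody : Contains M (o + 3) (body (o + 3)) → ∀ i < n, ∀ D : Data, D.Bounded B →
      D.reg d = n → D.reg (d + 1) = i → Inv i D → ∃ D',
      Runs M L x B T (o + 3) D (o + 3 + (body (o + 3)).length) D' ∧ D'.reg d = n ∧
        D'.reg (d + 1) = i ∧ Inv (i + 1) D')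
    {D : Data} (hD : D.Bounded B) (hn : D.reg d = n) (h0 : Inv 0 D) :
    ∃ D', Runs M L x B (n * (T + 5) + 3) o D (o + (loopCode o d body).length) D' ∧ Inv n D' := by
  rw [length_loopCode]
  simp only [loopCode, List.cons_append, List.nil_append, contains_cons, contains_append] at hM
  obtain ⟨m1, m2, m3, mb, m4, m5, m6, -⟩ := hM
  specialize hbody mb
  -- Induction on the number `r` of remaining rounds; the counter `i` runs upwards.
  have main : ∀ r i, r + i = n → ∀ D : Data, D.Bounded B → D.reg d = n → D.reg (d + 1) = i →
      Inv i D → ∃ D', Runs M L x B (r * (T + 5) + 2) (o + 1) D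
        (o + (body (o + 3)).length + 6) D' ∧ Inv n D' := by
    intro r
    induction r with
    | zero =>
      intro i hi D hD hn hc hI
      have r1 := Runs.sub (L := L) (x := x) m2 hB hD
      have r2 := Runs.jumpZero (L := L) (x := x) m3 hB r1.1
      have hz : D.reg d - D.reg (d + 1) = 0 := by omega
      simp only [hz, update_self, if_true] at r2 r1
      refine ⟨_, ((r1.trans r2).mono (by omega)), ?_⟩
      rw [show n = i by omega]
      exact hstab _ _ _ (fun j hj => update_of_ne (by omega) _ _) hI
    | succ r ih =>
      intro i hi D hD hn hc hI
      have r1 := Runs.sub (L := L) (x := x) m2 hB hD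
      have r2 := Runs.jumpZero (L := L) (x := x) m3 hB r1.1
      have hz : D.reg d - D.reg (d + 1) ≠ 0 := by omega
      simp only [update_self, if_neg hz] at r2 r1
      obtain ⟨D', r3, hn', hc', hI'⟩ := hbody i (by omega) _ r1.1
        (by simpa using hn) (by simpa using hc)
        (hstab _ _ _ (fun j hj => update_of_ne (by omega) _ _) hI)
      have r4 := Runs.const (L := L) (x := x) m4 hB r3.1 hB
      have r5 := Runs.add (L := L) (x := x) m5 hB r4.1 (by simp [hc']; omega)
      have r6 := Runs.jump (L := L) (x := x) m6 hB r5.1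
      obtain ⟨D'', r7, hI''⟩ := ih (i + 1) (by omega) _ r5.1 (by simpa using hn')
        (by simp [hc']) (hstab _ _ _ (fun j hj => by simp [show j ≠ d + 1 by omega]) (hstab _ _ _
          (fun j hj => update_of_ne (by omega) _ _) hI'))
      refine ⟨D'', ?_, hI''⟩
      refine ((((((r1.trans r2).trans r3).trans r4).trans r5).trans r6).trans r7).mono ?_
      rw [Nat.succ_mul]; omega
  have r0 := Runs.const (L := L) (x := x) m1 hB hD (v := 0) (by omega)
  obtain ⟨D', r, hI⟩ := main n 0 (by omega) _ r0.1 (by simpa using hn) (by simp)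
    (hstab _ _ _ (fun j hj => update_of_ne (by omega) _ _) h0)
  exact ⟨D', (r0.trans r).mono (by omega), hI⟩

/-- The code that evaluates an expression into the scalar `d`, where the variables are in the
scalars `ρ`, and scalars below `d` are kept. The code is placed at address `o`. -/
def Expr.code : {k : ℕ} → Expr k → (Fin k → ℕ) → ℕ → ℕ → List Instr
  -- In the absence of a move instruction, a scalar is copied by adding zero.
  | _, .var i, ρ, d, _ => [.const (2 * (d + 1)) 0, .add (2 * d) (2 * ρ i) (2 * (d + 1))]
  | _, .const c, _, d, _ => [.const (2 * d) c]
  | _, .add a b, ρ, d, o =>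
    a.code ρ d o ++ (b.code ρ (d + 1) (o + (a.code ρ d o).length) ++
      [.add (2 * d) (2 * d) (2 * (d + 1))])
  | _, .sub a b, ρ, d, o =>
    a.code ρ d o ++ (b.code ρ (d + 1) (o + (a.code ρ d o).length) ++
      [.sub (2 * d) (2 * d) (2 * (d + 1))])
  | _, .inputLength, _, d, _ => [.inputLength (2 * d)]
  | _, .inputBit a, ρ, d, o => a.code ρ d o ++ [.readInput (2 * d) (2 * d)]
  | _, .mem a, ρ, d, o =>
    a.code ρ d o ++ [.add (2 * d) (2 * d) (2 * d), .const (2 * (d + 1)) 1,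
      .add (2 * d) (2 * d) (2 * (d + 1)), .load (2 * d) (2 * d)]
  -- Scalar `d` accumulates, `d + 1` holds the bound and `d + 2` the counter. Scalar `d + 3` serves
  -- first for the loop test and then for the value of `f`.
  | _, .sum b f, ρ, d, o =>
    b.code ρ (d + 1) o ++ (.const (2 * d) 0 ::
      loopCode (o + (b.code ρ (d + 1) o).length + 1) (d + 1) fun o' =>
        f.code (Matrix.vecCons (d + 2) ρ) (d + 3) o' ++ [.add (2 * d) (2 * d) (2 * (d + 3))])

theorem vecCons_lt {k : ℕ} {ρ : Fin k → ℕ} {d a e : ℕ} (hρ : ∀ j, ρ j < d) (h : d ≤ e)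
    (ha : a < e) : ∀ j, Matrix.vecCons a ρ j < e := by
  intro j
  refine Fin.cases ?_ (fun j => ?_) j
  · simpa using ha
  · rw [Matrix.cons_val_succ]; have := hρ j; omega

theorem reg_vecCons {k : ℕ} {ρ : Fin k → ℕ} {env : Fin k → ℕ} {R : ℕ → ℕ} {a i : ℕ}
    (hR : ∀ j, R (ρ j) = env j) (ha : R a = i) :
    ∀ j, R (Matrix.vecCons a ρ j) = Matrix.vecCons i env j := by
  intro j
  refine Fin.cases ?_ (fun j => ?_) j
  · simpa using ha
  · simpa using hR j

/-- Scalars are used like a stack: the value goes to `d`, everything below `d` survives, everything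
above is scratch. The number `b` bounds the environment and the input, while `B` bounds all
registers; since the cost also dominates the intermediate values, the single assumption that it is
at most `B` suffices. -/
theorem Expr.code_spec {k : ℕ} (e : Expr k) : ∀ {ρ : Fin k → ℕ} {d o b : ℕ} {env : Fin k → ℕ}
    {D : Data}, Contains M o (e.code ρ d o) → 1 ≤ B → (∀ i, ρ i < d) →
    (∀ i, D.reg (ρ i) = env i) → (∀ i, env i ≤ b) → x.length ≤ b → e.cost.eval b ≤ B →
    D.Bounded B → ∃ R, Runs M L x B (e.cost.eval b) o D (o + (e.code ρ d o).length)
      { D with reg := R } ∧ R d = e.eval x D.mem env ∧ ∀ i < d, R i = D.reg i := by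
  induction e with
  | var i =>
    intro ρ d o b env D hM hB hρ henv hb hx hc hD
    simp only [Expr.code, contains_cons] at hM
    obtain ⟨m1, m2, -⟩ := hM
    have r1 := Runs.const (L := L) (x := x) m1 hB hD (v := 0) (by omega)
    have hne : ρ i ≠ d + 1 := by have := hρ i; omega
    have r2 := Runs.add (L := L) (x := x) m2 hB r1.1 (by simpa [hne] using hD (ρ i))
    refine ⟨_, (r1.trans r2).mono (by simp [Expr.cost]), ?_, ?_⟩
    · simp [hne, henv, Expr.eval]
    · intro j hj
      simp [show j ≠ d by omega, show j ≠ d + 1 by omega]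
  | const c =>
    intro ρ d o b env D hM hB hρ henv hb hx hc hD
    simp only [Expr.code, contains_cons] at hM
    simp only [Expr.cost, eval_add, eval_C, eval_one] at hc
    have r1 := Runs.const (L := L) (x := x) hM.1 hB hD (v := c) (by omega)
    refine ⟨_, r1.mono (by simp [Expr.cost]), by simp [Expr.eval], fun j hj => ?_⟩
    simp [show j ≠ d by omega]
  | add a c iha ihc =>
    intro ρ d o b env D hM hB hρ henv hb hx hc hD
    simp only [Expr.code, contains_cons, contains_append] at hM
    obtain ⟨ma, mc, m1, -⟩ := hM
    simp only [Expr.cost, eval_add, eval_one] at hc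
    have hsa := a.eval_le_size (m := D.mem) hb hx
    have hsc := c.eval_le_size (m := D.mem) hb hx
    obtain ⟨R, ra, ha, hka⟩ := iha ma hB hρ henv hb hx (by omega) hD
    obtain ⟨R', rc, hc', hkc⟩ := ihc mc hB (fun i => by have := hρ i; omega)
      (fun i => by simpa [hka _ (hρ i)] using henv i) hb hx (by omega) ra.1
    have hR'd : R' d = a.eval x D.mem env := by rw [hkc d (by omega)]; exact ha
    have r1 := Runs.add (L := L) (x := x) m1 hB rc.1 (by simp only [hR'd, hc']; omega)
    simp only [Expr.code, List.length_append, List.length_cons, List.length_nil, ← Nat.add_assoc,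
      Nat.zero_add]
    refine ⟨_, (ra.trans (rc.trans r1)).mono
        (by simp only [Expr.cost, eval_add, eval_one]; omega), ?_, ?_⟩
    · simp only [update_self]
      simp only [hR'd, hc', Expr.eval]
    · intro j hj
      simp only [update_of_ne (show j ≠ d by omega)]
      rw [hkc j (by omega)]
      exact hka j hj
  | sub a c iha ihc =>
    intro ρ d o b env D hM hB hρ henv hb hx hc hD
    simp only [Expr.code, contains_cons, contains_append] at hM
    obtain ⟨ma, mc, m1, -⟩ := hM
    simp only [Expr.cost, eval_add, eval_one] at hc
    obtain ⟨R, ra, ha, hka⟩ := iha ma hB hρ henv hb hx (by omega) hD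
    obtain ⟨R', rc, hc', hkc⟩ := ihc mc hB (fun i => by have := hρ i; omega)
      (fun i => by simpa [hka _ (hρ i)] using henv i) hb hx (by omega) ra.1
    have hR'd : R' d = a.eval x D.mem env := by rw [hkc d (by omega)]; exact ha
    have r1 := Runs.sub (L := L) (x := x) m1 hB rc.1
    simp only [Expr.code, List.length_append, List.length_cons, List.length_nil, ← Nat.add_assoc,
      Nat.zero_add]
    refine ⟨_, (ra.trans (rc.trans r1)).mono
        (by simp only [Expr.cost, eval_add, eval_one]; omega), ?_, ?_⟩
    · simp only [update_self]
      simp only [hR'd, hc', Expr.eval]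
    · intro j hj
      simp only [update_of_ne (show j ≠ d by omega)]
      rw [hkc j (by omega)]
      exact hka j hj
  | inputLength =>
    intro ρ d o b env D hM hB hρ henv hb hx hc hD
    simp only [Expr.code, contains_cons] at hM
    simp only [Expr.cost, eval_add, eval_X, eval_one] at hc
    have r1 := Runs.inputLength (L := L) (x := x) hM.1 hB hD (by omega)
    refine ⟨_, r1.mono (by simp [Expr.cost]), by simp [Expr.eval], fun j hj => ?_⟩
    simp [show j ≠ d by omega]
  | inputBit a iha =>
    intro ρ d o b env D hM hB hρ henv hb hx hc hD
    simp only [Expr.code, contains_cons, contains_append] at hM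
    obtain ⟨ma, m1, -⟩ := hM
    simp only [Expr.cost, eval_add, eval_one] at hc
    obtain ⟨R, ra, ha, hka⟩ := iha ma hB hρ henv hb hx (by omega) hD
    have r1 := Runs.readInput (L := L) (x := x) m1 hB ra.1
    simp only [Expr.code, List.length_append, List.length_cons, List.length_nil, ← Nat.add_assoc,
      Nat.zero_add]
    refine ⟨_, (ra.trans r1).mono
        (by simp only [Expr.cost, eval_add, eval_one]; omega), ?_, ?_⟩
    · simp only [update_self, ha, Expr.eval]
    · intro j hj
      simp only [update_of_ne (show j ≠ d by omega)]
      exact hka j hj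
  | mem a iha =>
    intro ρ d o b env D hM hB hρ henv hb hx hc hD
    simp only [Expr.code, contains_cons, contains_append] at hM
    obtain ⟨ma, m1, m2, m3, m4, -⟩ := hM
    simp only [Expr.cost, eval_add, eval_mul, eval_ofNat] at hc
    have hsa := a.eval_le_size (m := D.mem) hb hx
    obtain ⟨R, ra, ha, hka⟩ := iha ma hB hρ henv hb hx (by omega) hD
    have r1 := Runs.add (L := L) (x := x) m1 hB ra.1 (by simp only [ha]; omega)
    have r2 := Runs.const (L := L) (x := x) m2 hB r1.1 hB
    have r3 := Runs.add (L := L) (x := x) m3 hB r2.1 (by simp [ha]; omega)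
    have r4 := Runs.loadMem (L := L) (x := x) (a := a.eval x D.mem env) m4 hB r3.1
      (by simp [ha]; omega)
    simp only [Expr.code, List.length_append, List.length_cons, List.length_nil, ← Nat.add_assoc,
      Nat.zero_add]
    refine ⟨_, (ra.trans (r1.trans (r2.trans (r3.trans r4)))).mono
        (by simp only [Expr.cost, eval_add, eval_mul, eval_ofNat]; omega), ?_, ?_⟩
    · simp only [update_self, Expr.eval]
    · intro j hj
      simpa [show j ≠ d by omega, show j ≠ d + 1 by omega] using hka j hj
  | sum c f ihc ihf =>
    intro ρ d o b env D hM hB hρ henv hb hx hc hD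
    simp only [Expr.code, contains_cons, contains_append] at hM
    obtain ⟨mc, m1, ml⟩ := hM
    simp only [Expr.cost, eval_add, eval_mul, eval_comp, eval_X, eval_ofNat] at hc
    have hsc := c.eval_le_size (m := D.mem) hb hx
    obtain ⟨R, rc, hcv, hkc⟩ := ihc mc hB (fun i => by have := hρ i; omega)
      henv hb hx (by omega) hD
    have r1 := Runs.const (L := L) (x := x) m1 hB rc.1 (v := 0) (by omega)
    set n := c.eval x D.mem env with hn
    set S := c.size.eval b with hS
    have hSB : n * (f.cost.eval (b + S)) ≤ B := by
      have := Nat.mul_le_mul_right (f.cost.eval (b + S) + 6) hsc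
      rw [Nat.mul_add n] at this
      omega
    obtain ⟨D', rl, hI⟩ := loop_spec (M := M) (L := L) (x := x) (B := B) (n := n)
      (T := f.cost.eval (b + S) + 1)
      (fun i E => E.mem = D.mem ∧ E.query = D.query ∧ E.out = D.out ∧ (∀ j < d, E.reg j = D.reg j) ∧
        E.reg d = ∑ i ∈ Finset.range i, f.eval x D.mem (Matrix.vecCons i env)) ml hB
      (by
        have := Nat.mul_le_mul_left S (show 1 ≤ f.cost.eval (b + S) + 6 by omega)
        omega)
      (by
        rintro i E R' hR' ⟨h1, h2, h3, h4, h5⟩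
        exact ⟨h1, h2, h3, fun j hj => (hR' j (by omega)).trans (h4 j hj),
          (hR' d (by omega)).trans h5⟩)
      (by
        rintro mb i hi E hE hE1 hE2 ⟨h1, h2, h3, h4, h5⟩
        rw [contains_append, contains_cons] at mb
        obtain ⟨mf, m2, -⟩ := mb
        -- The body runs only if `n` is positive, and then one copy of its cost is at most `n`
        -- copies.
        have hfc : f.cost.eval (b + S) ≤ B := by
          have := Nat.mul_le_mul_right (f.cost.eval (b + S)) (show 1 ≤ n by omega)
          omega
        have hb' := vecCons_le (i := i) (n := S) hb (by omega)
        obtain ⟨R', rf, hf, hkf⟩ := ihf mf hB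
          (vecCons_lt hρ (by omega) (by omega))
          (reg_vecCons (fun j => (h4 _ (hρ j)).trans (henv j)) hE2)
          hb' (by omega) hfc hE
        simp only [h1] at hf
        -- Partial sums stay below the full sum, whose size bound is part of the cost; this keeps
        -- the accumulator below `B`.
        have hsum : ∑ i ∈ Finset.range (i + 1), f.eval x D.mem (Matrix.vecCons i env) ≤ B := by
          have : ∑ i ∈ Finset.range (i + 1), f.eval x D.mem (Matrix.vecCons i env) ≤
              ∑ i ∈ Finset.range n, f.eval x D.mem (Matrix.vecCons i env) :=
            Finset.sum_le_sum_of_subset (Finset.range_subset_range.2 (by omega))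
          have h' := (Expr.sum c f).eval_le_size (m := D.mem) hb hx
          simp only [Expr.eval, Expr.size, eval_mul, eval_comp, eval_add, eval_X, ← hn, ← hS] at h'
          omega
        have hacc : R' d = E.reg d := hkf d (by omega)
        have r2 := Runs.add (L := L) (x := x) m2 hB rf.1 (by
          simp only [hacc, h5, hf]
          rwa [Finset.sum_range_succ] at hsum)
        simp only [List.length_append, List.length_cons, List.length_nil, Nat.zero_add,
          ← Nat.add_assoc]
        refine ⟨_, rf.trans r2, ?_, ?_, h1, h2, h3, ?_, ?_⟩
        · simpa [hkf (d + 1) (by omega)] using hE1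
        · exact (update_of_ne (by omega) _ _).trans ((hkf _ (by omega)).trans hE2)
        · intro j hj
          simpa [show j ≠ d by omega, hkf j (by omega)] using h4 j hj
        · simp only [update_self]
          rw [hacc, h5, hf, Finset.sum_range_succ])
      r1.1 (by simpa using hcv)
      ⟨rfl, rfl, rfl, fun j hj => by
        simpa [show j ≠ d by omega] using hkc j (by omega), by simp⟩
    obtain ⟨h1, h2, h3, h4, h5⟩ := hI
    refine ⟨D'.reg, ?_, h5, h4⟩
    have hD' : { D with reg := D'.reg } = D' := by
      obtain ⟨_, _, _, _⟩ := D'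
      simp only at h1 h2 h3
      subst h1 h2 h3
      rfl
    rw [hD']
    have := (rc.trans (r1.trans rl)).mono (T' := (Expr.sum c f).cost.eval b) (by
      simp only [Expr.cost, eval_add, eval_mul, eval_comp, eval_X, eval_ofNat, ← hS]
      have := Nat.mul_le_mul_right (f.cost.eval (b + S) + 6) hsc
      have e : f.cost.eval (b + S) + 1 + 5 = f.cost.eval (b + S) + 6 := by omega
      rw [e]
      omega)
    simp only [Expr.code, List.length_append, List.length_cons]
    rw [show ∀ p q, o + (p + (q + 1)) = o + p + 1 + q by intros; omega]
    exact this

end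

end Loop
end EnumComplexity

/-! ### Compilation of word writers and of statements -/

namespace EnumComplexity
namespace Loop

open Function Polynomial

section

variable {M : RAM} {L : Language Bool} {x : List Bool} {B : ℕ}

/-- The code that appends the word written by `g` to the query registers; scalar `0` holds the
length of the query. -/
def Gen.code : {k : ℕ} → Gen k → (Fin k → ℕ) → ℕ → ℕ → List Instr
  | _, .nil, _, _, _ => []
  | _, .bit c, _, d, _ =>
    [.const (2 * d) c.toNat, .writeQuery (2 * 0) (2 * d), .const (2 * d) 1,
      .add (2 * 0) (2 * 0) (2 * d)]
  | _, .seq g h, ρ, d, o => g.code ρ d o ++ h.code ρ d (o + (g.code ρ d o).length)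
  | _, .loop b g, ρ, d, o =>
    b.code ρ d o ++ loopCode (o + (b.code ρ d o).length) d fun o' =>
      g.code (Matrix.vecCons (d + 1) ρ) (d + 2) o'

/-- The word `w` is in the query registers and its length in scalar `0`. -/
def Data.Holds (D : Data) (w : List Bool) : Prop :=
  D.reg 0 = w.length ∧ readWord D.query w.length = w

theorem vecCons_pos {k : ℕ} {ρ : Fin k → ℕ} {a : ℕ} (hρ : ∀ j, 0 < ρ j) (ha : 0 < a) :
    ∀ j, 0 < Matrix.vecCons a ρ j := by
  intro j
  refine Fin.cases ?_ (fun j => ?_) j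
  · simpa using ha
  · simpa using hρ j

/-- The word `w` already present is carried along, so that writers compose by concatenation. Scalar
`0` counts the bits written and is exempt from the preservation clause; the bound on the final
length keeps it below `B`. -/
theorem Gen.code_spec {k : ℕ} (g : Gen k) : ∀ {ρ : Fin k → ℕ} {d o b : ℕ} {env : Fin k → ℕ}
    {D : Data} {w : List Bool}, Contains M o (g.code ρ d o) → 1 ≤ B → (∀ i, ρ i < d) →
    (∀ i, 0 < ρ i) → (∀ i, D.reg (ρ i) = env i) → (∀ i, env i ≤ b) → x.length ≤ b →
    g.cost.eval b ≤ B → 1 ≤ d → w.length + g.size.eval b ≤ B → D.Holds w → D.Bounded B →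
    ∃ D', Runs M L x B (g.cost.eval b) o D (o + (g.code ρ d o).length) D' ∧
      D'.Holds (w ++ g.word x D.mem env) ∧ D'.mem = D.mem ∧ D'.out = D.out ∧
      ∀ i, 0 < i → i < d → D'.reg i = D.reg i := by
  induction g with
  | nil =>
    intro ρ d o b env D w hM hB hρ hρ' henv hb hx hc hd hs hw hD
    exact ⟨D, .refl hD, by simpa [Gen.word] using hw, rfl, rfl, fun _ _ _ => rfl⟩
  | bit c =>
    intro ρ d o b env D w hM hB hρ hρ' henv hb hx hc hd hs hw hD
    simp only [Gen.code, contains_cons] at hM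
    obtain ⟨m1, m2, m3, m4, -⟩ := hM
    simp only [Gen.size, eval_one] at hs
    have r1 := Runs.const (L := L) (x := x) m1 hB hD (v := c.toNat) ((Bool.toNat_le _).trans hB)
    have r2 := Runs.writeQuery (L := L) (x := x) m2 hB r1.1
    have r3 := Runs.const (L := L) (x := x) m3 hB r2.1 hB
    have hd0 : (0 : ℕ) ≠ d := by omega
    have r4 := Runs.add (L := L) (x := x) m4 hB r3.1 (by simp [hd0, hw.1]; omega)
    refine ⟨_, ((r1.trans (r2.trans (r3.trans r4)))).mono (by simp [Gen.cost]), ⟨?_, ?_⟩, rfl, rfl,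
      ?_⟩
    · simp [hd0, hw.1, Gen.word]
    · have h2 := hw.2
      simp only [readWord, Gen.word, List.length_append, List.length_cons, List.length_nil,
        Nat.zero_add, List.range_succ, List.map_append, List.map_cons, List.map_nil, hw.1,
        update_of_ne hd0, update_self] at h2 ⊢
      congr 1
      · conv_rhs => rw [← h2]
        refine List.map_congr_left fun i hi => ?_
        rw [update_of_ne (by have := List.mem_range.1 hi; omega)]
      · cases c <;> rfl
    · intro i hi hi'
      simp [show i ≠ 0 by omega, show i ≠ d by omega]
  | seq g h ihg ihh =>
    intro ρ d o b env D w hM hB hρ hρ' henv hb hx hc hd hs hw hD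
    simp only [Gen.code, contains_append] at hM
    simp only [Gen.cost, eval_add] at hc
    simp only [Gen.size, eval_add] at hs
    have hl := g.length_word_le (m := D.mem) hb hx
    obtain ⟨D₁, r1, hw₁, hm₁, ho₁, hk₁⟩ := ihg hM.1 hB hρ hρ' henv hb hx (by omega) hd (by omega)
      hw hD
    obtain ⟨D₂, r2, hw₂, hm₂, ho₂, hk₂⟩ := ihh hM.2 hB hρ hρ'
      (fun i => (hk₁ _ (hρ' i) (hρ i)).trans (henv i)) hb hx (by omega) hd
      (by rw [List.length_append]; omega) hw₁ r1.1
    refine ⟨D₂, ?_, ?_, hm₂.trans hm₁, ho₂.trans ho₁,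
      fun i hi hi' => (hk₂ i hi hi').trans (hk₁ i hi hi')⟩
    · simp only [Gen.code, List.length_append, ← Nat.add_assoc]
      exact (r1.trans r2).mono (by simp [Gen.cost])
    · simpa [Gen.word, hm₁] using hw₂
  | loop c g ihg =>
    intro ρ d o b env D w hM hB hρ hρ' henv hb hx hc hd hs hw hD
    simp only [Gen.code, contains_append] at hM
    obtain ⟨mc, ml⟩ := hM
    simp only [Gen.cost, eval_add, eval_mul, eval_comp, eval_X, eval_ofNat] at hc
    simp only [Gen.size, eval_mul, eval_comp, eval_add, eval_X] at hs
    have hsc := c.eval_le_size (m := D.mem) hb hx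
    obtain ⟨R, rc, hcv, hkc⟩ := c.code_spec mc hB hρ henv hb hx (by omega) hD
    set n := c.eval x D.mem env with hn
    set S := c.size.eval b with hS
    have hmul := Nat.mul_le_mul_right (g.cost.eval (b + S) + 5) hsc
    have hmuls := Nat.mul_le_mul_right (g.size.eval (b + S)) hsc
    have hnB : n * (g.cost.eval (b + S) + 5) ≤ B := by omega
    obtain ⟨D', rl, hI⟩ := loop_spec (M := M) (L := L) (x := x) (B := B) (n := n)
      (T := g.cost.eval (b + S))
      (fun i E => E.mem = D.mem ∧ E.out = D.out ∧ (∀ j, 0 < j → j < d → E.reg j = D.reg j) ∧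
        E.Holds (w ++ (List.range i).flatMap fun i => g.word x D.mem (Matrix.vecCons i env)) ∧
        -- This part of the invariant provides the length assumption of the induction hypothesis for
        -- the next round.
        (w ++ (List.range i).flatMap fun i => g.word x D.mem (Matrix.vecCons i env)).length ≤
          w.length + i * g.size.eval (b + S)) ml hB
      (by
        have := Nat.mul_le_mul_left n (show 1 ≤ g.cost.eval (b + S) + 5 by omega)
        omega)
      (by
        rintro i E R' hR' ⟨h1, h2, h3, h4, h5⟩
        exact ⟨h1, h2, fun j hj hj' => (hR' j hj').trans (h3 j hj hj'),
          ⟨(hR' 0 (by omega)).trans h4.1, h4.2⟩, h5⟩)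
      (by
        rintro mg i hi E hE hE1 hE2 ⟨h1, h2, h3, h4, h5⟩
        have hgc : g.cost.eval (b + S) ≤ B := by
          have := Nat.mul_le_mul_right (g.cost.eval (b + S) + 5) (show 1 ≤ n by omega)
          omega
        have hgs : (i + 1) * g.size.eval (b + S) ≤ S * g.size.eval (b + S) :=
          Nat.mul_le_mul_right _ (by omega)
        rw [Nat.succ_mul] at hgs
        have hb' := vecCons_le (i := i) (n := S) hb (by omega)
        obtain ⟨D', r', hw', hm', ho', hk'⟩ := ihg mg hB
          (vecCons_lt hρ (by omega) (by omega)) (vecCons_pos hρ' (by omega))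
          (reg_vecCons (fun j => (h3 _ (hρ' j) (hρ j)).trans (henv j)) hE2)
          hb' (by omega) hgc (by omega) (by omega) h4 hE
        have hl := g.length_word_le (m := D.mem) hb' (show x.length ≤ b + S by omega)
        refine ⟨D', r', (hk' _ (by omega) (by omega)).trans hE1,
          (hk' _ (by omega) (by omega)).trans hE2, hm'.trans h1, ho'.trans h2,
          fun j hj hj' => (hk' j hj (by omega)).trans (h3 j hj hj'), ?_, ?_⟩
        · rw [h1] at hw'
          simpa [List.range_succ] using hw'
        · rw [Nat.succ_mul]
          simp only [List.length_append] at h5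
          simp only [List.range_succ, List.flatMap_append, List.length_append,
            List.flatMap_cons, List.flatMap_nil, List.append_nil]
          omega)
      rc.1 hcv
      ⟨rfl, rfl, fun j hj hj' => hkc j hj', by
        simpa using ⟨(hkc 0 (by omega)).trans hw.1, hw.2⟩, by simp⟩
    obtain ⟨h1, h2, h3, h4, h5⟩ := hI
    refine ⟨D', ?_, h4, h1, h2, h3⟩
    simp only [Gen.code, List.length_append, ← Nat.add_assoc]
    refine (rc.trans rl).mono ?_
    simp only [Gen.cost, eval_add, eval_mul, eval_comp, eval_X, eval_ofNat, ← hS]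
    omega

/-- Store the bit in scalar `d` into the memory cell whose number is in scalar `d + 1`. -/
def storeCode (d : ℕ) : List Instr :=
  [.add (2 * (d + 1)) (2 * (d + 1)) (2 * (d + 1)), .const (2 * (d + 2)) 1,
    .add (2 * (d + 1)) (2 * (d + 1)) (2 * (d + 2)), .store (2 * (d + 1)) (2 * d)]

theorem storeCode_spec {o d a : ℕ} {v : Bool} {D : Data} (hM : Contains M o (storeCode d))
    (hB : 1 ≤ B) (hv : D.reg d = v.toNat) (ha : D.reg (d + 1) = a) (haB : 2 * a + 1 ≤ B)
    (hD : D.Bounded B) : ∃ R, Runs M L x B 4 o D (o + (storeCode d).length)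
      { D with reg := R, mem := update D.mem a v } ∧ ∀ i < d, R i = D.reg i := by
  simp only [storeCode, contains_cons] at hM
  obtain ⟨m1, m2, m3, m4, -⟩ := hM
  have r1 := Runs.add (L := L) (x := x) m1 hB hD (by omega)
  have r2 := Runs.const (L := L) (x := x) m2 hB r1.1 hB
  have r3 := Runs.add (L := L) (x := x) m3 hB r2.1 (by simp [ha]; omega)
  have r4 := Runs.storeMem (L := L) (x := x) (a := a) (v := v) m4 hB r3.1
    (by simp [ha]; omega) (by simpa using hv)
  refine ⟨_, r1.trans (r2.trans (r3.trans r4)), fun i hi => ?_⟩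
  simp [show i ≠ d + 1 by omega, show i ≠ d + 2 by omega]

/-- The code that runs a program; scalar `0` is used for the length of queries. -/
def Stmt.code : {k : ℕ} → Stmt k → (Fin k → ℕ) → ℕ → ℕ → List Instr
  -- Computing `1 - (1 - e)` with truncated subtraction turns a number into a bit.
  | _, .set a e, ρ, d, o =>
    e.code ρ d o ++ ([.const (2 * (d + 1)) 1, .sub (2 * d) (2 * (d + 1)) (2 * d),
      .sub (2 * d) (2 * (d + 1)) (2 * d)] ++
      (a.code ρ (d + 1) (o + (e.code ρ d o).length + 3) ++ storeCode d))
  | _, .ask a g, ρ, d, o =>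
    .const (2 * 0) 0 :: (g.code ρ d (o + 1) ++ (.ask (2 * d) (2 * 0) ::
      (a.code ρ (d + 1) (o + 1 + (g.code ρ d (o + 1)).length + 1) ++ storeCode d)))
  | _, .out a e, ρ, d, o =>
    a.code ρ d o ++ (e.code ρ (d + 1) (o + (a.code ρ d o).length) ++
      [.writeOutput (2 * d) (2 * (d + 1))])
  | _, .seq p q, ρ, d, o => p.code ρ d o ++ q.code ρ d (o + (p.code ρ d o).length)
  | _, .loop b p, ρ, d, o =>
    b.code ρ d o ++ loopCode (o + (b.code ρ d o).length) d fun o' =>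
      p.code (Matrix.vecCons (d + 1) ρ) (d + 2) o'

/-- The memory and the output registers. -/
def Data.store (D : Data) : Store := ⟨D.mem, D.out⟩

/-- Only memory and output registers belong to the semantics of a statement. The query registers may
hold remains of earlier queries, as each query resets its length to `0` and overwrites what it uses.
-/
theorem Stmt.code_spec {k : ℕ} (p : Stmt k) : ∀ {ρ : Fin k → ℕ} {d o b : ℕ} {env : Fin k → ℕ}
    {D : Data}, Contains M o (p.code ρ d o) → 1 ≤ B → (∀ i, ρ i < d) →
    (∀ i, 0 < ρ i) → (∀ i, D.reg (ρ i) = env i) → (∀ i, env i ≤ b) → x.length ≤ b →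
    p.cost.eval b ≤ B → 1 ≤ d → D.Bounded B →
    ∃ D', Runs M L x B (p.cost.eval b) o D (o + (p.code ρ d o).length) D' ∧
      D'.store = p.run L x env D.store ∧ ∀ i, 0 < i → i < d → D'.reg i = D.reg i := by
  induction p with
  | set a e =>
    intro ρ d o b env D hM hB hρ hρ' henv hb hx hc hd hD
    simp only [Stmt.code, contains_append, contains_cons, List.length_cons, List.length_nil,
      Nat.zero_add] at hM
    obtain ⟨me, ⟨m1, m2, m3, -⟩, ma, ms⟩ := hM
    simp only [Stmt.cost, eval_add, eval_mul, eval_ofNat] at hc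
    have hsa := a.eval_le_size (m := D.mem) hb hx
    obtain ⟨R, re, he, hke⟩ := e.code_spec me hB hρ henv hb hx (by omega) hD
    have r1 := Runs.const (L := L) (x := x) m1 hB re.1 hB
    have r2 := Runs.sub (L := L) (x := x) m2 hB r1.1
    have r3 := Runs.sub (L := L) (x := x) m3 hB r2.1
    obtain ⟨R', ra, ha, hka⟩ := a.code_spec (L := L) (d := d + 1) ma hB
      (fun i => by have := hρ i; omega) (env := env) (b := b)
      (fun i => by
        have := hρ i
        simpa [show ρ i ≠ d by omega, show ρ i ≠ d + 1 by omega, hke _ this] using henv i)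
      hb hx (by omega) r3.1
    obtain ⟨R'', rs, hks⟩ := storeCode_spec (L := L) (x := x) (v := e.eval x D.mem env != 0)
      ms hB (by
        refine (hka d (by omega)).trans ?_
        simp only [update_self, update_of_ne (show d ≠ d + 1 by omega),
          update_of_ne (show d + 1 ≠ d by omega), he]
        generalize e.eval x D.mem env = v
        rcases v with _ | v <;> simp) (show R' (d + 1) = a.eval x D.mem env from ha)
      (by omega) ra.1
    simp only [Stmt.code, List.length_append, List.length_cons, List.length_nil, Nat.zero_add,
      ← Nat.add_assoc]
    refine ⟨_, (re.trans (r1.trans (r2.trans (r3.trans (ra.trans rs))))).mono ?_, rfl, ?_⟩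
    · simp only [Stmt.cost, eval_add, eval_mul, eval_ofNat]; omega
    · intro i hi hi'
      simp only [hks i hi', hka i (by omega)]
      simpa [show i ≠ d by omega, show i ≠ d + 1 by omega] using hke i hi'
  | ask a g =>
    intro ρ d o b env D hM hB hρ hρ' henv hb hx hc hd hD
    simp only [Stmt.code, contains_append, contains_cons] at hM
    obtain ⟨m1, mg, m2, ma, ms⟩ := hM
    simp only [Stmt.cost, eval_add, eval_mul, eval_ofNat] at hc
    have hsa := a.eval_le_size (m := D.mem) hb hx
    have r1 := Runs.const (L := L) (x := x) m1 hB hD (v := 0) (by omega)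
    obtain ⟨D', rg, hw, hm, ho, hk⟩ := g.code_spec (L := L) (env := env) (b := b) (w := []) mg hB hρ hρ'
      (fun i => by simpa [(hρ' i).ne'] using henv i) hb hx (by omega) hd (by simp; omega)
      ⟨by simp, rfl⟩ r1.1
    have r2 := Runs.ask (L := L) (x := x) m2 hB rg.1
    have hk' : ∀ i, 0 < i → i < d → D'.reg i = D.reg i := fun i hi hi' => by
      simpa [hi.ne'] using hk i hi hi'
    obtain ⟨R', ra, ha, hka⟩ := a.code_spec (L := L) (d := d + 1) ma hB
      (fun i => by have := hρ i; omega) (env := env) (b := b)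
      (fun i => by
        have := hρ i
        simpa [show ρ i ≠ d by omega, hk' _ (hρ' i) this] using henv i)
      hb hx (by omega) r2.1
    simp only [hm] at ha
    obtain ⟨R'', rs, hks⟩ := storeCode_spec (L := L) (x := x)
      ms hB (by
        refine (hka d (by omega)).trans ?_
        simp only [update_self]
        rfl) ha (by omega) ra.1
    simp only [Stmt.code, List.length_append, List.length_cons]
    rw [show ∀ p q r, o + (p + (q + r + 1) + 1) = o + 1 + p + 1 + q + r by intros; omega]
    refine ⟨_, (r1.trans (rg.trans (r2.trans (ra.trans rs)))).mono ?_, ?_, ?_⟩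
    · simp only [Stmt.cost, eval_add, eval_mul, eval_ofNat]; omega
    · simp only [Data.store, Stmt.run]
      have hq := hw.2
      simp only [List.nil_append] at hq
      have h0 : D'.reg 0 = (g.word x D.mem env).length := hw.1
      rw [h0, hq, hm, ho]
      rfl
    · intro i hi hi'
      simp only [hks i hi', hka i (by omega)]
      simpa [show i ≠ d by omega] using hk' i hi hi'
  | out a e =>
    intro ρ d o b env D hM hB hρ hρ' henv hb hx hc hd hD
    simp only [Stmt.code, contains_append, contains_cons] at hM
    obtain ⟨ma, me, m1, -⟩ := hM
    simp only [Stmt.cost, eval_add, eval_one] at hc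
    obtain ⟨R, ra, ha, hka⟩ := a.code_spec ma hB hρ henv hb hx (by omega) hD
    obtain ⟨R', re, he, hke⟩ := e.code_spec me hB (fun i => by have := hρ i; omega)
      (fun i => by simpa [hka _ (hρ i)] using henv i) hb hx (by omega) ra.1
    have r1 := Runs.writeOutput (L := L) (x := x) m1 hB re.1
    simp only [Stmt.code, List.length_append, List.length_cons, List.length_nil, Nat.zero_add,
      ← Nat.add_assoc]
    refine ⟨_, (ra.trans (re.trans r1)).mono ?_, ?_, ?_⟩
    · simp only [Stmt.cost, eval_add, eval_one]; omega
    · simp only [Data.store, Stmt.run, he, hke d (by omega), ha]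
    · intro i hi hi'
      simp only [hke i (by omega), hka i hi']
  | seq p q ihp ihq =>
    intro ρ d o b env D hM hB hρ hρ' henv hb hx hc hd hD
    simp only [Stmt.code, contains_append] at hM
    simp only [Stmt.cost, eval_add] at hc
    obtain ⟨D₁, r1, hs₁, hk₁⟩ := ihp hM.1 hB hρ hρ' henv hb hx (by omega) hd hD
    obtain ⟨D₂, r2, hs₂, hk₂⟩ := ihq hM.2 hB hρ hρ'
      (fun i => (hk₁ _ (hρ' i) (hρ i)).trans (henv i)) hb hx (by omega) hd r1.1
    refine ⟨D₂, ?_, ?_, fun i hi hi' => (hk₂ i hi hi').trans (hk₁ i hi hi')⟩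
    · simp only [Stmt.code, List.length_append, ← Nat.add_assoc]
      exact (r1.trans r2).mono (by simp [Stmt.cost])
    · rw [hs₂, hs₁]; rfl
  | loop c p ihp =>
    intro ρ d o b env D hM hB hρ hρ' henv hb hx hc hd hD
    simp only [Stmt.code, contains_append] at hM
    obtain ⟨mc, ml⟩ := hM
    simp only [Stmt.cost, eval_add, eval_mul, eval_comp, eval_X, eval_ofNat] at hc
    have hsc := c.eval_le_size (m := D.mem) hb hx
    obtain ⟨R, rc, hcv, hkc⟩ := c.code_spec mc hB hρ henv hb hx (by omega) hD
    set n := c.eval x D.mem env with hn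
    set S := c.size.eval b with hS
    have hmul := Nat.mul_le_mul_right (p.cost.eval (b + S) + 5) hsc
    have hnB : n * (p.cost.eval (b + S) + 5) ≤ B := by omega
    obtain ⟨D', rl, hI⟩ := loop_spec (M := M) (L := L) (x := x) (B := B) (n := n)
      (T := p.cost.eval (b + S))
      (fun i E => (∀ j, 0 < j → j < d → E.reg j = D.reg j) ∧ E.store =
        (List.range i).foldl (fun s i => p.run L x (Matrix.vecCons i env) s) D.store) ml hB
      (by
        have := Nat.mul_le_mul_left n (show 1 ≤ p.cost.eval (b + S) + 5 by omega)
        omega)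
      (by
        rintro i E R' hR' ⟨h1, h2⟩
        exact ⟨fun j hj hj' => (hR' j hj').trans (h1 j hj hj'), h2⟩)
      (by
        rintro mg i hi E hE hE1 hE2 ⟨h1, h2⟩
        have hgc : p.cost.eval (b + S) ≤ B := by
          have := Nat.mul_le_mul_right (p.cost.eval (b + S) + 5) (show 1 ≤ n by omega)
          omega
        have hb' := vecCons_le (i := i) (n := S) hb (by omega)
        obtain ⟨D', r', hs', hk'⟩ := ihp mg hB
          (vecCons_lt hρ (by omega) (by omega)) (vecCons_pos hρ' (by omega))
          (reg_vecCons (fun j => (h1 _ (hρ' j) (hρ j)).trans (henv j)) hE2)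
          hb' (by omega) hgc (by omega) hE
        refine ⟨D', r', (hk' _ (by omega) (by omega)).trans hE1,
          (hk' _ (by omega) (by omega)).trans hE2,
          fun j hj hj' => (hk' j hj (by omega)).trans (h1 j hj hj'), ?_⟩
        rw [hs', h2, List.range_succ, List.foldl_append]
        rfl)
      rc.1 hcv ⟨fun j hj hj' => hkc j hj', rfl⟩
    obtain ⟨h1, h2⟩ := hI
    refine ⟨D', ?_, h2, h1⟩
    simp only [Stmt.code, List.length_append, ← Nat.add_assoc]
    refine (rc.trans rl).mono ?_
    simp only [Stmt.cost, eval_add, eval_mul, eval_comp, eval_X, eval_ofNat, ← hS]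
    omega

end

end Loop
end EnumComplexity

/-! ## Enumeration by iterating a loop program -/

namespace EnumComplexity
namespace Loop

open Function Polynomial

section

variable {M : RAM} {L : Language Bool} {x : List Bool} {B : ℕ}

theorem Steps.iterate_eq {n : ℕ} {c c' : Config} (h : Steps M L x B n c c') :
    (M.step L x)^[n] c = c' ∧ ∀ i < n, Safe M B ((M.step L x)^[i] c) := by
  induction h with
  | refl => simp
  | @head n c c' hs _ ih =>
    refine ⟨ih.1, fun i hi => ?_⟩
    cases i with
    | zero => exact hs
    | succ i => exact ih.2 i (by omega)

variable (M) in
/-- The next instruction outputs `y`. -/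
def Outputs (c : Config) (y : List Bool) : Prop :=
  ∃ j, M[c.pc]? = some (.output j) ∧ y = readWord c.out (c.reg j)

theorem Safe.not_outputs {c : Config} (h : Safe M B c) (y : List Bool) : ¬ Outputs M c y := by
  rintro ⟨j, hj, -⟩
  obtain ⟨-, ins, hi, ho⟩ := h
  rw [hj] at hi
  exact ho j (Option.some.inj hi).symm

variable (M L x B) in
/-- From a configuration, the listed words are output, with delays of at most `T` steps, and
registers stay at most `B`. -/
inductive Lists (T : ℕ) : Config → List (List Bool) → Prop
  | halt {t : ℕ} {c c' : Config} : t ≤ T → Steps M L x B t c c' → (∀ i, c'.reg i ≤ B) →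
      M.length ≤ c'.pc → Lists T c []
  | output {t : ℕ} {c c' : Config} {y : List Bool} {ys : List (List Bool)} : t ≤ T →
      Steps M L x B t c c' → (∀ i, c'.reg i ≤ B) → Outputs M c' y →
      Lists T (M.step L x c') ys → Lists T c (y :: ys)

theorem iterate_of_halted {c : Config} (h : M.length ≤ c.pc) (t : ℕ) :
    (M.step L x)^[t] c = c := by
  apply iterate_fixed
  unfold RAM.step
  rw [List.getElem?_eq_none h]

theorem not_outputs_of_halted {c : Config} (h : M.length ≤ c.pc) (y : List Bool) :
    ¬ Outputs M c y := by
  rintro ⟨j, hj, -⟩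
  rw [List.getElem?_eq_none h] at hj
  cases hj

theorem Outputs.unique {c : Config} {y y' : List Bool} (h : Outputs M c y) (h' : Outputs M c y') :
    y = y' := by
  obtain ⟨j, hj, rfl⟩ := h
  obtain ⟨j', hj', rfl⟩ := h'
  rw [hj] at hj'
  cases hj'
  rfl

/-- Every moment lies before the first stop, at it, or after it. Before it all configurations are
safe and output nothing; at it the behaviour is known; after it the rest of the list takes over with
the time shifted by `n + 1`, or the machine has halted and stays put. -/
theorem Lists.spec {T : ℕ} {c : Config} {ys : List (List Bool)} (h : Lists M L x B T c ys) :
    (∀ y, y ∈ ys ↔ ∃ t, Outputs M ((M.step L x)^[t] c) y) ∧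
    (ys.Nodup → ∀ y t t', Outputs M ((M.step L x)^[t] c) y →
      Outputs M ((M.step L x)^[t'] c) y → t = t') ∧
    (∃ t, M.length ≤ ((M.step L x)^[t] c).pc) ∧
    (∀ t, ∃ t', t ≤ t' ∧ t' ≤ t + T ∧ (M.length ≤ ((M.step L x)^[t'] c).pc ∨
      ∃ y, Outputs M ((M.step L x)^[t'] c) y)) ∧
    ∀ t i, ((M.step L x)^[t] c).reg i ≤ B := by
  induction h with
  | @halt n c c' hn hs hB hh =>
    obtain ⟨he, hsafe⟩ := hs.iterate_eq
    have later : ∀ t, n ≤ t → (M.step L x)^[t] c = c' := fun t ht => by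
      rw [show t = (t - n) + n by omega, iterate_add_apply, he, iterate_of_halted hh]
    have hno : ∀ t y, ¬ Outputs M ((M.step L x)^[t] c) y := fun t y => by
      rcases lt_or_ge t n with ht | ht
      · exact (hsafe t ht).not_outputs y
      · rw [later t ht]; exact not_outputs_of_halted hh y
    refine ⟨fun y => ?_, fun _ y t _ h _ => (hno t y h).elim, ⟨n, by rwa [he]⟩, fun t => ?_,
      fun t i => ?_⟩
    · simpa using fun t => hno t y
    · refine ⟨max t n, le_max_left _ _, by omega, .inl ?_⟩
      rwa [later _ (le_max_right _ _)]
    · rcases lt_or_ge t n with ht | ht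
      · exact (hsafe t ht).1 i
      · rw [later t ht]; exact hB i
  | @output n c c' y ys hn hs hB ho _ ih =>
    obtain ⟨he, hsafe⟩ := hs.iterate_eq
    obtain ⟨h1, h2, ⟨u, h3⟩, h4, h5⟩ := ih
    have later : ∀ t, (M.step L x)^[t + (n + 1)] c = (M.step L x)^[t] (M.step L x c') := fun t => by
      rw [iterate_add_apply, iterate_succ_apply', he]
    have cases3 : ∀ t, t < n ∨ t = n ∨ ∃ s, t = s + (n + 1) := fun t => by
      rcases lt_trichotomy t n with h | h | h
      · exact .inl h
      · exact .inr (.inl h)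
      · exact .inr (.inr ⟨t - (n + 1), by omega⟩)
    refine ⟨fun z => ?_, fun hnd z t t' ht ht' => ?_, ⟨u + (n + 1), by rwa [later]⟩, fun t => ?_,
      fun t i => ?_⟩
    · rw [List.mem_cons, h1]
      constructor
      · rintro (rfl | ⟨t, ht⟩)
        · exact ⟨n, by rwa [he]⟩
        · exact ⟨t + (n + 1), by rwa [later]⟩
      · rintro ⟨t, ht⟩
        obtain h | rfl | ⟨s, rfl⟩ := cases3 t
        · exact ((hsafe t h).not_outputs z ht).elim
        · rw [he] at ht
          exact .inl (ht.unique ho)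
        · exact .inr ⟨s, by rwa [later] at ht⟩
    · rw [List.nodup_cons] at hnd
      have key : ∀ t, Outputs M ((M.step L x)^[t] c) z → t = n ∧ z = y ∨
          z ∈ ys ∧ ∃ s, t = s + (n + 1) ∧ Outputs M ((M.step L x)^[s] (M.step L x c')) z := by
        intro t ht
        obtain h | rfl | ⟨s, rfl⟩ := cases3 t
        · exact ((hsafe t h).not_outputs z ht).elim
        · rw [he] at ht
          exact .inl ⟨rfl, ht.unique ho⟩
        · rw [later] at ht
          exact .inr ⟨(h1 z).2 ⟨s, ht⟩, s, rfl, ht⟩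
      rcases key t ht with ⟨a, b⟩ | ⟨a, s, rfl, b⟩ <;>
        rcases key t' ht' with ⟨a', b'⟩ | ⟨a', s', rfl, b'⟩
      · omega
      · exact (hnd.1 (b ▸ a')).elim
      · exact (hnd.1 (b' ▸ a)).elim
      · rw [h2 hnd.2 z s s' b b']
    · obtain h | rfl | ⟨s, rfl⟩ := cases3 t
      · exact ⟨n, by omega, by omega, .inr ⟨y, by rwa [he]⟩⟩
      · exact ⟨t, by omega, by omega, .inr ⟨y, by rwa [he]⟩⟩
      · obtain ⟨t', ha, hb, hc⟩ := h4 s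
        exact ⟨t' + (n + 1), by omega, by omega, by rwa [later]⟩
    · obtain h | rfl | ⟨s, rfl⟩ := cases3 t
      · exact (hsafe t h).1 i
      · rw [he]; exact hB i
      · rw [later]; exact h5 s i

/-- A single number `d` serves as bound for time and registers. The length of a query is the content
of a register, hence at most `d`, and a number up to `d` is below `2 ^ d`. -/
theorem Lists.enumerates {d : ℕ} {ys : List (List Bool)} (h : Lists M L x d d Config.init ys)
    (hys : ys.Nodup) : M.EnumeratesWithDelay L x {y | y ∈ ys} d := by
  obtain ⟨h1, h2, h3, h4, h5⟩ := h.spec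
  refine ⟨h1, h2 hys, h3, h4, fun t q => ?_, fun t i => (h5 t i).trans_lt d.lt_two_pow_self⟩
  rintro ⟨i, j, -, rfl⟩
  have := h5 t j
  simpa [readWord, RAM.configAt] using this

end

/-- The machine that runs `p` until memory bit `0` is `0`, and outputs a word of length `l` after
each run but the last. -/
def machine (p : Stmt 0) (l : Expr 0) : RAM :=
  let c₁ := p.code ![] 1 0
  let c₂ := (Expr.mem (Expr.const 0 : Expr 0)).code ![] 1 c₁.length
  let c₃ := l.code ![] 1 (c₁.length + c₂.length + 1)
  -- The target of this jump is the length of the whole list, so taking it means halting.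
  c₁ ++ (c₂ ++ (.jumpZero (2 * 1) (c₁.length + c₂.length + 1 + c₃.length + 2) ::
    (c₃ ++ [.output (2 * 1), .jump 0])))

/-- The delay of `machine`. -/
noncomputable def machineDelay (p : Stmt 0) (l : Expr 0) : ℕ[X] :=
  p.cost + (Expr.mem (Expr.const 0 : Expr 0)).cost + l.cost + 3

/-- Iterating `p` outputs the listed words, until memory bit `0` is `0`. -/
inductive Iterates (L : Language Bool) (x : List Bool) (p : Stmt 0) (l : Expr 0) :
    Store → List (List Bool) → Prop
  | halt {s : Store} : (p.run L x ![] s).mem 0 = false → Iterates L x p l s []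
  | output {s : Store} {ys : List (List Bool)} : (p.run L x ![] s).mem 0 = true →
      Iterates L x p l (p.run L x ![] s) ys → Iterates L x p l s
        (readWord (p.run L x ![] s).out (l.eval x (p.run L x ![] s).mem ![]) :: ys)

/-- The first round starts at address `0`, every later one at the jump that follows the output
instruction; the alternative for `c` covers both. Scalars and query registers left over from earlier
rounds are arbitrary, which is why the claim is made for every `D` with the given store. -/
theorem machine_lists {L : Language Bool} {x : List Bool} {p : Stmt 0} {l : Expr 0} {s : Store}
    {ys : List (List Bool)} (h : Iterates L x p l s ys) : ∀ D : Data, D.store = s →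
    D.Bounded ((machineDelay p l).eval x.length) → ∀ c : Config,
    (c = cfg 0 D ∨ (machine p l).step L x c = cfg 0 D ∧
      Safe (machine p l) ((machineDelay p l).eval x.length) c) →
    Lists (machine p l) L x ((machineDelay p l).eval x.length)
      ((machineDelay p l).eval x.length) c ys := by
  have hM := contains_self (machine p l)
  set B := (machineDelay p l).eval x.length with hB
  generalize hMm : machine p l = M at hM ⊢
  have hM' : Contains M 0 (machine p l) := by rw [hMm]; exact hM
  have hlen : M.length = (machine p l).length := by rw [hMm]
  simp only [machine, contains_append, contains_cons, Nat.zero_add] at hM'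
  obtain ⟨mp, mf, mj, ml, mo, mb, -⟩ := hM'
  simp only [machineDelay, eval_add, eval_ofNat] at hB
  have hB1 : 1 ≤ B := by omega
  have start : ∀ D : Data, D.Bounded B → ∃ D' : Data, Runs M L x
      B (p.cost.eval x.length + (Expr.mem (Expr.const 0 : Expr 0)).cost.eval x.length) 0 D
      ((p.code ![] 1 0).length + ((Expr.mem (Expr.const 0 : Expr 0)).code ![] 1
        (p.code ![] 1 0).length).length) D' ∧ D'.store = p.run L x ![] D.store ∧
      D'.reg 1 = ((p.run L x ![] D.store).mem 0).toNat := by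
    intro D hD
    obtain ⟨D₁, r1, hs, -⟩ := p.code_spec (L := L) (x := x) (B := B) (env := ![]) (b := x.length) mp
      hB1 (by simp) (by simp) (by simp) (by simp) le_rfl (by omega) le_rfl hD
    obtain ⟨R, r2, hv, -⟩ := (Expr.mem (Expr.const 0 : Expr 0)).code_spec (L := L) (x := x) (B := B)
      (env := ![]) (b := x.length) mf hB1 (by simp) (by simp) (by simp) le_rfl (by omega) r1.1
    rw [Nat.zero_add] at r1
    refine ⟨_, r1.trans r2, hs, ?_⟩
    rw [← hs]
    exact hv
  have regs : ∀ o (D : Data), D.Bounded B → ∀ i, (cfg o D).reg i ≤ B := by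
    intro o D hD i
    simp only [cfg]
    split
    · exact hD _
    · exact (Bool.toNat_le _).trans hB1
  -- The jump back to the start, if there is one, is charged to the following round.
  have lead : ∀ {t : ℕ} {c c' : Config} {D : Data}, (c = cfg 0 D ∨ M.step L x c = cfg 0 D ∧
      Safe M B c) → Steps M L x B t (cfg 0 D) c' → ∃ t' ≤ t + 1, Steps M L x B t' c c' := by
    rintro t c c' D (rfl | ⟨h, hs⟩) h'
    · exact ⟨t, by omega, h'⟩
    · exact ⟨t + 1, le_rfl, .head hs (h ▸ h')⟩
  induction h with
  | @halt s hf =>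
    intro D hs hD c hc
    subst hs
    obtain ⟨D', r, hs', hv⟩ := start D hD
    rw [hf] at hv
    have r' := Runs.jumpZero (L := L) (x := x) mj hB1 r.1
    rw [if_pos (by simpa using hv)] at r'
    obtain ⟨hD', t, ht, hst⟩ := r.trans r'
    obtain ⟨t', ht', hst'⟩ := lead hc hst
    refine .halt (by omega) hst' (regs _ _ hD') ?_
    rw [hlen]
    simp [machine, cfg]
    omega
  | @output s ys hf _ ih =>
    intro D hs hD c hc
    subst hs
    obtain ⟨D', r, hs', hv⟩ := start D hD
    rw [hf] at hv
    have r' := Runs.jumpZero (L := L) (x := x) mj hB1 r.1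
    rw [if_neg (by simp [hv])] at r'
    obtain ⟨R, r'', hl, -⟩ := l.code_spec (L := L) (x := x) (B := B)
      (env := ![]) (b := x.length) ml hB1 (by simp) (by simp) (by simp) le_rfl (by omega) r'.1
    obtain ⟨hD', t, ht, hst⟩ := r.trans (r'.trans r'')
    obtain ⟨t', ht', hst'⟩ := lead hc hst
    have step : ∀ {o : ℕ} {ins : Instr}, M[o]? = some ins → ∀ E : Data,
        M.step L x (cfg o E) = ins.exec L x (cfg o E) := by
      intro o ins ho E
      have : M[(cfg o E).pc]? = some ins := ho
      rw [RAM.step, this]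
    refine .output (by omega) hst' (regs _ _ hD') ⟨2 * 1, mo, ?_⟩
      (ih { D' with reg := R } (by rw [← hs']; rfl) hD' _ (.inr ?_))
    · rw [cfg_reg_even]
      simp only [hl, ← hs']
      rfl
    · rw [step mo]
      exact ⟨step mb _, regs _ _ hD', _, mb, by simp⟩

theorem mem_Del_of_iterates {C : Set (Language Bool)} {L : Language Bool} (hL : L ∈ C)
    (p : Stmt 0) (l : Expr 0) (E : EnumProblem)
    (h : ∀ x, ∃ ys : List (List Bool), ys.Nodup ∧ E x = {y | y ∈ ys} ∧
      Iterates L x p l ⟨fun _ => false, fun _ => false⟩ ys) : E ∈ Del C := by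
  refine ⟨machine p l, L, machineDelay p l, hL, fun x => ?_⟩
  obtain ⟨ys, hnd, hE, hi⟩ := h x
  rw [hE]
  refine (machine_lists hi ⟨fun _ => 0, fun _ => false, fun _ => false, fun _ => false⟩ rfl
    (fun _ => Nat.zero_le _) _ (.inl ?_)).enumerates hnd
  simp [Config.init, cfg]

end Loop
end EnumComplexity

/-! ## Derived expressions and clause writers -/

namespace EnumComplexity
namespace Loop

open Function

namespace Expr

/-- Substitution of variables for variables. -/
def rename : {k l : ℕ} → Expr k → (Fin k → Fin l) → Expr l
  | _, _, .var i, ρ => .var (ρ i)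
  | _, _, .const c, _ => .const c
  | _, _, .add a b, ρ => .add (a.rename ρ) (b.rename ρ)
  | _, _, .sub a b, ρ => .sub (a.rename ρ) (b.rename ρ)
  | _, _, .inputLength, _ => .inputLength
  | _, _, .inputBit a, ρ => .inputBit (a.rename ρ)
  | _, _, .mem a, ρ => .mem (a.rename ρ)
  | _, _, .sum b f, ρ => .sum (b.rename ρ) (f.rename (Fin.cases 0 fun i => (ρ i).succ))

theorem eval_rename {x : List Bool} {m : ℕ → Bool} {k : ℕ} (e : Expr k) :
    ∀ {l : ℕ} (ρ : Fin k → Fin l) (env : Fin l → ℕ),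
      (e.rename ρ).eval x m env = e.eval x m fun i => env (ρ i) := by
  induction e with
  | var i => intros; rfl
  | const c => intros; rfl
  | add a b iha ihb => intros; simp only [rename, eval, iha, ihb]
  | sub a b iha ihb => intros; simp only [rename, eval, iha, ihb]
  | inputLength => intros; rfl
  | inputBit a iha => intros; simp only [rename, eval, iha]
  | mem a iha => intros; simp only [rename, eval, iha]
  | sum b f ihb ihf =>
    intro l ρ env
    simp only [rename, eval, ihb, ihf]
    refine Finset.sum_congr rfl fun i _ => ?_
    congr 1
    funext j
    refine Fin.cases ?_ (fun j => ?_) j <;> simp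

/-- Weakening by a new variable `0`. -/
def up {k : ℕ} (e : Expr k) : Expr (k + 1) := e.rename Fin.succ

/-- The product. -/
def mul {k : ℕ} (a b : Expr k) : Expr k := .sum a b.up

/-- The truth value of `a = 0`. -/
def not {k : ℕ} (a : Expr k) : Expr k := .sub (.const 1) a

/-- The truth value of `a ≤ b`. -/
def le {k : ℕ} (a b : Expr k) : Expr k := not (.sub a b)

/-- The truth value of `a = b`. -/
def eq {k : ℕ} (a b : Expr k) : Expr k := not (.add (.sub a b) (.sub b a))

/-- The quotient of natural numbers. -/
def div {k : ℕ} (a b : Expr k) : Expr k :=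
  .sum a (le (mul (.add (.var 0) (.const 1)) b.up) a.up)

/-- The remainder of natural numbers. -/
def mod {k : ℕ} (a b : Expr k) : Expr k := .sub a (mul b (div a b))

/-- A power with a fixed exponent. -/
def pow {k : ℕ} (a : Expr k) : ℕ → Expr k
  | 0 => .const 1
  | v + 1 => mul (pow a v) a

/-- The sum of a list. -/
def sumList {k : ℕ} : List (Expr k) → Expr k
  | [] => .const 0
  | a :: l => .add a (sumList l)

/-- The conjunction of a list. -/
def all {k : ℕ} : List (Expr k) → Expr k
  | [] => .const 1
  | a :: l => mul a (all l)

variable {x : List Bool} {m : ℕ → Bool} {k : ℕ}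

@[simp] theorem eval_var (i : Fin k) (env : Fin k → ℕ) : (var i).eval x m env = env i := rfl
@[simp] theorem eval_const (c : ℕ) (env : Fin k → ℕ) : (const c).eval x m env = c := rfl
@[simp] theorem eval_add (a b : Expr k) (env : Fin k → ℕ) :
    (add a b).eval x m env = a.eval x m env + b.eval x m env := rfl
@[simp] theorem eval_sub (a b : Expr k) (env : Fin k → ℕ) :
    (sub a b).eval x m env = a.eval x m env - b.eval x m env := rfl
@[simp] theorem eval_inputLength (env : Fin k → ℕ) :
    (inputLength : Expr k).eval x m env = x.length := rfl
@[simp] theorem eval_inputBit (a : Expr k) (env : Fin k → ℕ) :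
    (inputBit a).eval x m env = (x.getD (a.eval x m env) false).toNat := rfl
@[simp] theorem eval_mem (a : Expr k) (env : Fin k → ℕ) :
    (mem a).eval x m env = (m (a.eval x m env)).toNat := rfl
@[simp] theorem eval_sum (b : Expr k) (f : Expr (k + 1)) (env : Fin k → ℕ) :
    (sum b f).eval x m env =
      ∑ i ∈ Finset.range (b.eval x m env), f.eval x m (Matrix.vecCons i env) := rfl

@[simp] theorem eval_up (e : Expr k) (i : ℕ) (env : Fin k → ℕ) :
    e.up.eval x m (Matrix.vecCons i env) = e.eval x m env := by
  simp [up, eval_rename]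

@[simp] theorem eval_mul (a b : Expr k) (env : Fin k → ℕ) :
    (mul a b).eval x m env = a.eval x m env * b.eval x m env := by
  simp [mul]

@[simp] theorem eval_not (a : Expr k) (env : Fin k → ℕ) :
    (not a).eval x m env = if a.eval x m env = 0 then 1 else 0 := by
  simp only [not, eval_sub, eval_const]
  split <;> omega

@[simp] theorem eval_le (a b : Expr k) (env : Fin k → ℕ) :
    (le a b).eval x m env = if a.eval x m env ≤ b.eval x m env then 1 else 0 := by
  simp only [le, eval_not, eval_sub, Nat.sub_eq_zero_iff_le]

@[simp] theorem eval_eq (a b : Expr k) (env : Fin k → ℕ) :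
    (eq a b).eval x m env = if a.eval x m env = b.eval x m env then 1 else 0 := by
  simp only [eq, eval_not, eval_add, eval_sub]
  congr 1
  exact propext ⟨fun h => by omega, fun h => by omega⟩

/-- This makes bounded search available through sums: a number is recovered by counting the smaller
ones. The quotient and the size of the universe are computed in this way. -/
theorem sum_ite_lt {a c : ℕ} (h : c ≤ a) : ∑ i ∈ Finset.range a, (if i < c then 1 else 0) = c := by
  have e : {i ∈ Finset.range a | i < c} = Finset.range c := by ext i; simp; omega
  rw [Finset.sum_boole, e]
  simp

/-- The quotient is the number of `i` with `(i + 1) * b ≤ a`, and all of these are below `a` if `b`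
is positive. -/
theorem eval_div (a b : Expr k) (env : Fin k → ℕ) (hb : 0 < b.eval x m env) :
    (div a b).eval x m env = a.eval x m env / b.eval x m env := by
  simp only [div, eval_sum, eval_le, eval_mul, eval_add, eval_var, eval_const, eval_up,
    Matrix.cons_val_zero]
  rw [← sum_ite_lt (Nat.div_le_self (a.eval x m env) (b.eval x m env))]
  refine Finset.sum_congr rfl fun i _ => ?_
  congr 1
  exact propext ((Nat.le_div_iff_mul_le hb).symm.trans Nat.succ_le_iff)

theorem eval_mod (a b : Expr k) (env : Fin k → ℕ) (hb : 0 < b.eval x m env) :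
    (mod a b).eval x m env = a.eval x m env % b.eval x m env := by
  simp only [mod, eval_sub, eval_mul, eval_div a b env hb]
  have := Nat.div_add_mod (a.eval x m env) (b.eval x m env)
  omega

@[simp] theorem eval_pow (a : Expr k) (v : ℕ) (env : Fin k → ℕ) :
    (pow a v).eval x m env = a.eval x m env ^ v := by
  induction v with
  | zero => rfl
  | succ v ih => rw [pow, eval_mul, ih, pow_succ]

@[simp] theorem eval_sumList (l : List (Expr k)) (env : Fin k → ℕ) :
    (sumList l).eval x m env = (l.map fun e => e.eval x m env).sum := by
  induction l with
  | nil => rfl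
  | cons a l ih => simp [sumList, ih]

theorem eval_all_ne_zero (l : List (Expr k)) (env : Fin k → ℕ) :
    (all l).eval x m env ≠ 0 ↔ ∀ e ∈ l, e.eval x m env ≠ 0 := by
  induction l with
  | nil => simp [all]
  | cons a l ih => rw [all, eval_mul, mul_ne_zero_iff, ih, List.forall_mem_cons]

end Expr

/-! ### Writing clauses -/

namespace Gen

open Verifier

/-- Run `g` if `c` is positive. -/
def when {k : ℕ} (c : Expr k) (g : Gen (k + 1)) : Gen k := .loop (.not (.not c)) g

/-- Write a literal. -/
def lit {k : ℕ} (v : Expr k) (b : Bool) : Gen k :=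
  .seq (.loop v (.seq (.bit false) (.bit true)))
    (.seq (.seq (.bit b) (.seq (.bit true) (.bit false)))
      (.loop v (.seq (.bit true) (.bit true))))

/-- Write a clause, whose literals are written by `g`. -/
def clause {k : ℕ} (g : Gen k) : Gen k := .seq (.seq (.bit false) (.bit false)) g

/-- Run a list of programs. -/
def seqList {k : ℕ} : List (Gen k) → Gen k
  | [] => .nil
  | g :: l => .seq g (seqList l)

variable {x : List Bool} {m : ℕ → Bool} {k : ℕ}

/-- `g` writes literals of which one is true if and only if `P` holds for the valuation. -/
def Disj (x : List Bool) (m : ℕ → Bool) {k : ℕ} (g : Gen k) (env : Fin k → ℕ)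
    (P : (ℕ → Bool) → Prop) : Prop :=
  ∃ cl : List (ℕ × Bool), g.word x m env = cl.flatMap literalWord ∧
    ∀ α, (∃ l ∈ cl, α l.1 = l.2) ↔ P α

/-- `g` writes clauses that are true if and only if `P` holds for the valuation. -/
def Conj (x : List Bool) (m : ℕ → Bool) {k : ℕ} (g : Gen k) (env : Fin k → ℕ)
    (P : (ℕ → Bool) → Prop) : Prop :=
  ∃ Φ : List (List (ℕ × Bool)), g.word x m env = cnfWord Φ ∧
    ∀ α, (∀ cl ∈ Φ, ∃ l ∈ cl, α l.1 = l.2) ↔ P α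

/-- With this the words themselves can be forgotten: a query is described by a predicate on
valuations. -/
theorem Conj.mem_satLanguage {g : Gen k} {env : Fin k → ℕ} {P : (ℕ → Bool) → Prop}
    (h : Conj x m g env P) : g.word x m env ∈ satLanguage ↔ ∃ α, P α := by
  obtain ⟨Φ, hw, hP⟩ := h
  rw [hw, cnfWord_mem_satLanguage]
  simp only [hP]

theorem Conj.congr {g : Gen k} {env : Fin k → ℕ} {P Q : (ℕ → Bool) → Prop}
    (h : Conj x m g env P) (hPQ : ∀ α, P α ↔ Q α) : Conj x m g env Q := by
  rwa [show Q = P from funext fun α => propext (hPQ α).symm]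

theorem disj_nil {env : Fin k → ℕ} : Disj x m .nil env fun _ => False :=
  ⟨[], rfl, by simp⟩

theorem disj_lit (v : Expr k) (b : Bool) (env : Fin k → ℕ) :
    Disj x m (lit v b) env fun α => α (v.eval x m env) = b :=
  ⟨[(v.eval x m env, b)], by simp [lit, word, literalWord], by simp⟩

theorem Disj.seq {g h : Gen k} {env : Fin k → ℕ} {P Q : (ℕ → Bool) → Prop}
    (hg : Disj x m g env P) (hh : Disj x m h env Q) :
    Disj x m (.seq g h) env fun α => P α ∨ Q α := by
  obtain ⟨cl, hw, hP⟩ := hg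
  obtain ⟨cl', hw', hQ⟩ := hh
  refine ⟨cl ++ cl', by simp [word, hw, hw'], fun α => ?_⟩
  simp only [List.mem_append, or_and_right, exists_or, hP, hQ]

theorem disj_loop {b : Expr k} {g : Gen (k + 1)} {env : Fin k → ℕ} {P : ℕ → (ℕ → Bool) → Prop}
    (h : ∀ i, Disj x m g (Matrix.vecCons i env) (P i)) :
    Disj x m (.loop b g) env fun α => ∃ i < b.eval x m env, P i α := by
  choose cl hw hP using h
  refine ⟨(List.range (b.eval x m env)).flatMap cl, ?_, fun α => ?_⟩
  · simp only [word, hw, List.flatMap_assoc]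
  · simp only [List.mem_flatMap, List.mem_range, ← hP]
    constructor
    · rintro ⟨l, ⟨i, hi, hl⟩, h⟩; exact ⟨i, hi, l, hl, h⟩
    · rintro ⟨i, hi, l, hl, h⟩; exact ⟨l, ⟨i, hi, hl⟩, h⟩

/-- A conditional is a loop with at most one round. Its body sees a dummy loop variable, over whose
values the hypothesis therefore quantifies. -/
theorem disj_when {c : Expr k} {g : Gen (k + 1)} {env : Fin k → ℕ} {P : (ℕ → Bool) → Prop}
    (h : ∀ i, Disj x m g (Matrix.vecCons i env) P) :
    Disj x m (when c g) env fun α => c.eval x m env ≠ 0 ∧ P α := by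
  obtain ⟨cl, hw, hP⟩ := disj_loop (b := .not (.not c)) h
  refine ⟨cl, hw, fun α => (hP α).trans ?_⟩
  by_cases hc : c.eval x m env = 0 <;> simp [hc]

theorem disj_seqList {ι : Type*} {l : List ι} {g : ι → Gen k} {env : Fin k → ℕ}
    {P : ι → (ℕ → Bool) → Prop} (h : ∀ i ∈ l, Disj x m (g i) env (P i)) :
    Disj x m (seqList (l.map g)) env fun α => ∃ i ∈ l, P i α := by
  induction l with
  | nil => simpa [seqList] using disj_nil
  | cons a l ih =>
    have := (h a (by simp)).seq (ih fun i hi => h i (by simp [hi]))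
    simpa [seqList] using this

theorem Disj.clause {g : Gen k} {env : Fin k → ℕ} {P : (ℕ → Bool) → Prop}
    (h : Disj x m g env P) : Conj x m (.clause g) env P := by
  obtain ⟨cl, hw, hP⟩ := h
  exact ⟨[cl], by simp [Gen.clause, word, hw, cnfWord, clauseWord], by simpa using hP⟩

theorem conj_nil {env : Fin k → ℕ} : Conj x m .nil env fun _ => True :=
  ⟨[], rfl, by simp⟩

theorem Conj.seq {g h : Gen k} {env : Fin k → ℕ} {P Q : (ℕ → Bool) → Prop}
    (hg : Conj x m g env P) (hh : Conj x m h env Q) :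
    Conj x m (.seq g h) env fun α => P α ∧ Q α := by
  obtain ⟨cl, hw, hP⟩ := hg
  obtain ⟨cl', hw', hQ⟩ := hh
  refine ⟨cl ++ cl', by simp [word, hw, hw', cnfWord], fun α => ?_⟩
  simp only [List.mem_append, or_imp, forall_and, hP, hQ]

theorem conj_loop {b : Expr k} {g : Gen (k + 1)} {env : Fin k → ℕ} {P : ℕ → (ℕ → Bool) → Prop}
    (h : ∀ i, Conj x m g (Matrix.vecCons i env) (P i)) :
    Conj x m (.loop b g) env fun α => ∀ i < b.eval x m env, P i α := by
  choose cl hw hP using h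
  refine ⟨(List.range (b.eval x m env)).flatMap cl, ?_, fun α => ?_⟩
  · simp only [word, hw, cnfWord, List.flatMap_assoc]
  · simp only [List.mem_flatMap, List.mem_range, ← hP]
    constructor
    · intro h i hi l hl; exact h l ⟨i, hi, hl⟩
    · rintro h l ⟨i, hi, hl⟩; exact h i hi l hl

theorem conj_when {c : Expr k} {g : Gen (k + 1)} {env : Fin k → ℕ} {P : (ℕ → Bool) → Prop}
    (h : ∀ i, Conj x m g (Matrix.vecCons i env) P) :
    Conj x m (when c g) env fun α => c.eval x m env ≠ 0 → P α := by
  refine (conj_loop (b := .not (.not c)) h).congr fun α => ?_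
  by_cases hc : c.eval x m env = 0 <;> simp [hc]

theorem conj_seqList {ι : Type*} {l : List ι} {g : ι → Gen k} {env : Fin k → ℕ}
    {P : ι → (ℕ → Bool) → Prop} (h : ∀ i ∈ l, Conj x m (g i) env (P i)) :
    Conj x m (seqList (l.map g)) env fun α => ∀ i ∈ l, P i α := by
  induction l with
  | nil => simpa [seqList] using conj_nil
  | cons a l ih =>
    have := (h a (by simp)).seq (ih fun i hi => h i (by simp [hi]))
    simpa [seqList] using this

end Gen

end Loop
end EnumComplexity

/-! ## Encodings of structures and assignments -/

namespace TeamLogic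

open EnumComplexity.Loop

theorem getElem?_flatten_take {α : Type*} (l : List (List α)) : ∀ (r : ℕ) (hr : r < l.length)
    (j : ℕ), j < l[r].length →
      l.flatten[((l.take r).map List.length).sum + j]? = l[r][j]? := by
  induction l with
  | nil => intro r hr; simp at hr
  | cons a l ih =>
    intro r hr j hj
    cases r with
    | zero =>
      simp only [List.getElem_cons_zero] at hj
      simp [List.getElem?_append_left hj]
    | succ r =>
      simp only [List.getElem_cons_succ] at hj
      have := ih r (by simpa using hr) j hj
      simp only [List.take_succ_cons, List.map_cons, List.sum_cons, List.flatten_cons,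
        List.getElem_cons_succ]
      rw [← this, add_assoc, List.getElem?_append_right (by omega)]
      congr 1
      omega

/-- Cutting at the prescribed lengths; it shows that any tail of the right length consists of
characteristic words. -/
theorem exists_eq_flatten_ofFn {α : Type*} {m : ℕ} (c : Fin m → ℕ) : ∀ l : List α,
    l.length = (List.ofFn c).sum →
      ∃ f : (i : Fin m) → Fin (c i) → α, l = (List.ofFn fun i => List.ofFn (f i)).flatten := by
  induction m with
  | zero => intro l hl; exact ⟨fun i => i.elim0, by simpa using hl⟩
  | succ m ih =>
    intro l hl
    rw [List.ofFn_succ, List.sum_cons] at hl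
    obtain ⟨f, hf⟩ := ih (fun i => c i.succ) (l.drop (c 0)) (by simp; omega)
    have h0 : (l.take (c 0)).length = c 0 := by simp; omega
    refine ⟨Fin.cons (fun j => (l.take (c 0))[j]) f, ?_⟩
    rw [List.ofFn_succ, List.flatten_cons]
    simp only [Fin.cons_zero, Fin.cons_succ]
    rw [← hf]
    conv_lhs => rw [← List.take_append_drop (c 0) l]
    congr 1
    apply List.ext_getElem
    · simp; omega
    · intro i h₁ h₂; simp

/-- The number of leading ones of a word; in codes of structures, the size of the universe. -/
def leadingOnes (x : List Bool) : ℕ := (x.takeWhile id).length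

/-- A description by single bits, which an expression can test by summing over an initial segment of
the input. -/
theorem lt_leadingOnes {x : List Bool} : ∀ {i : ℕ},
    i < leadingOnes x ↔ ∀ j ≤ i, x.getD j false = true := by
  induction x with
  | nil => intro i; simpa [leadingOnes] using ⟨0, Nat.zero_le i⟩
  | cons a x ih =>
    intro i
    cases a with
    | false =>
      simp only [leadingOnes, List.takeWhile_cons, id]
      simpa using ⟨0, Nat.zero_le _, rfl⟩
    | true =>
      have e : leadingOnes (true :: x) = leadingOnes x + 1 := by simp [leadingOnes]
      rw [e]
      cases i with
      | zero => simp
      | succ i =>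
        rw [Nat.add_lt_add_iff_right, ih]
        constructor
        · intro h j hj
          cases j with
          | zero => rfl
          | succ j => simpa using h j (by omega)
        · intro h j hj
          simpa using h (j + 1) (by omega)

theorem leadingOnes_le (x : List Bool) : leadingOnes x ≤ x.length :=
  (List.takeWhile_prefix id).length_le

theorem leadingOnes_replicate (n : ℕ) (y : List Bool) :
    leadingOnes (List.replicate n true ++ [false] ++ y) = n := by
  simp [leadingOnes]

theorem eq_replicate_of_leadingOnes_lt (x : List Bool) (h : leadingOnes x < x.length) :
    x = List.replicate (leadingOnes x) true ++ [false] ++ x.drop (leadingOnes x + 1) := by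
  induction x with
  | nil => simp at h
  | cons a x ih =>
    cases a with
    | false => simp [leadingOnes]
    | true =>
      have e : leadingOnes (true :: x) = leadingOnes x + 1 := by simp [leadingOnes]
      rw [e] at h ⊢
      have := ih (by simpa using h)
      rw [List.replicate_succ, List.drop_succ_cons]
      simp only [List.cons_append]
      rw [← this]

variable {σ : Vocabulary} {n : ℕ}

theorem FinStructure.leadingOnes_code (A : FinStructure σ n) : leadingOnes A.code = n :=
  leadingOnes_replicate _ _

theorem length_tupleSetCode {k : ℕ} (S : Set (Fin k → Fin n)) :
    (tupleSetCode S).length = n ^ k := by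
  simp [tupleSetCode]

theorem FinStructure.length_code (A : FinStructure σ n) :
    A.code.length = n + 1 + (List.ofFn fun R => n ^ σ.arity R).sum := by
  simp [FinStructure.code, List.length_flatten, length_tupleSetCode, Function.comp_def]
  omega

-- The characteristic word of `R` starts after the unary size, the separator and the words of the
-- preceding relations.
open Classical in
theorem FinStructure.getD_code (A : FinStructure σ n) (R : Fin σ.numRel)
    (f : Fin (σ.arity R) → Fin n) :
    A.code.getD (n + 1 + (((List.ofFn fun R => n ^ σ.arity R).take R).sum +
      (finFunctionFinEquiv f : ℕ))) false = decide (f ∈ A.rel R) := by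
  obtain ⟨j, rfl⟩ := finFunctionFinEquiv.symm.surjective f
  rw [Equiv.apply_symm_apply]
  have key := getElem?_flatten_take (List.ofFn fun R => tupleSetCode (A.rel R)) R (by simp)
    j (by simp [length_tupleSetCode])
  have e : ((List.ofFn fun R => tupleSetCode (A.rel R)).take R).map List.length =
      (List.ofFn fun R => n ^ σ.arity R).take R := by
    rw [List.map_take, List.map_ofFn]
    congr 2
    funext i
    simp [length_tupleSetCode]
  rw [e] at key
  rw [List.getD_eq_getElem?_getD, FinStructure.code, List.getElem?_append_right (by simp)]
  simp only [List.length_append, List.length_replicate, List.length_cons, List.length_nil,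
    Nat.zero_add, Nat.add_sub_cancel_left]
  rw [key]
  simp [tupleSetCode]

/-- Being a code is a matter of length alone: if the word is longer than its block of leading ones,
the separator is there, and any further bits are characteristic words of some relations. -/
theorem exists_code_eq {x : List Bool}
    (h : x.length = leadingOnes x + 1 + (List.ofFn fun R => leadingOnes x ^ σ.arity R).sum) :
    ∃ A : FinStructure σ (leadingOnes x), A.code = x := by
  obtain ⟨f, hf⟩ := exists_eq_flatten_ofFn (fun R => leadingOnes x ^ σ.arity R)
    (x.drop (leadingOnes x + 1)) (by simp; omega)
  refine ⟨⟨fun R => {a | f R (finFunctionFinEquiv a) = true}⟩, ?_⟩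
  conv_rhs => rw [eq_replicate_of_leadingOnes_lt x (by omega), hf]
  simp [FinStructure.code, tupleSetCode]

/-! ### Assignments as numbers -/

/-- The digit of `s` at position `v` in base `n + 1`. -/
def dig (n s v : ℕ) : ℕ := s / (n + 1) ^ v % (n + 1)

theorem dig_lt (n s v : ℕ) : dig n s v < n + 1 := Nat.mod_lt _ (by omega)

/-- The value with number `d`, where `0` stands for undefined. -/
def digitValue (n d : ℕ) : Option (Fin n) :=
  if h : 0 < d ∧ d < n + 1 then some ⟨d - 1, by omega⟩ else none

theorem digitValue_inj {d e : ℕ} (hd : d < n + 1) (he : e < n + 1) :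
    digitValue n d = digitValue n e ↔ d = e := by
  unfold digitValue
  split <;> split <;> simp <;> omega

theorem digitValue_eq_none {d : ℕ} (hd : d < n + 1) : digitValue n d = none ↔ d = 0 := by
  unfold digitValue
  split <;> simp <;> omega

theorem digitValue_eq_some {d : ℕ} {a : Fin n} (hd : d < n + 1) :
    digitValue n d = some a ↔ d = a + 1 := by
  unfold digitValue
  split <;> simp [Fin.ext_iff] <;> omega

/-- The assignment to variables below `K` whose values are the base-`n + 1` digits of `s`. -/
def decode (n K s : ℕ) : Assignment n := fun v => if v < K then digitValue n (dig n s v) else none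

variable {K : ℕ}

/-- The assignment is undefined from variable `K` on. -/
def Supported (K : ℕ) (a : Assignment n) : Prop := ∀ v, K ≤ v → a v = none

theorem supported_decode (s : ℕ) : Supported K (decode n K s) := fun v hv => by
  simp [decode, hv]

theorem decode_apply (s : ℕ) {v : ℕ} (hv : v < K) :
    decode n K s v = digitValue n (dig n s v) := by
  simp [decode, hv]

theorem decode_eq_decode {s t v w : ℕ} (hv : v < K) (hw : w < K) :
    decode n K s v = decode n K t w ↔ dig n s v = dig n t w := by
  rw [decode_apply s hv, decode_apply t hw, digitValue_inj (dig_lt _ _ _) (dig_lt _ _ _)]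

/-- Digit `0` means undefined and digit `c + 1` means the value `c`, so base `n + 1` numbers all
partial assignments to the variables below `K`, whatever their domain. -/
theorem exists_decode {a : Assignment n} (ha : Supported K a) :
    ∃ s < (n + 1) ^ K, decode n K s = a := by
  let f : Fin K → Fin (n + 1) := fun v =>
    match a v with
    | none => 0
    | some c => c.succ
  refine ⟨finFunctionFinEquiv f, (finFunctionFinEquiv f).2, ?_⟩
  funext v
  by_cases hv : v < K
  · rw [decode_apply _ hv]
    have h : dig n (finFunctionFinEquiv f) v = f ⟨v, hv⟩ := by
      have := congrArg Fin.val (congrFun (finFunctionFinEquiv.symm_apply_apply f) ⟨v, hv⟩)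
      rw [← this]
      rfl
    rw [h]
    simp only [f]
    cases hav : a v with
    | none => simp [digitValue]
    | some c => rw [digitValue_eq_some (Fin.is_lt _)]; simp
  · rw [ha v (by omega)]
    simp [decode, hv]

theorem decode_injOn {s t : ℕ} (hs : s < (n + 1) ^ K) (ht : t < (n + 1) ^ K)
    (h : decode n K s = decode n K t) : s = t := by
  have : finFunctionFinEquiv.symm (⟨s, hs⟩ : Fin ((n + 1) ^ K)) =
      finFunctionFinEquiv.symm ⟨t, ht⟩ := by
    funext v
    ext
    exact (decode_eq_decode v.2 v.2).1 (congrFun h v)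
  simpa using finFunctionFinEquiv.symm.injective this

/-! ### Expressions for the encoding -/

namespace Code

open Expr

/-- The size of the universe. -/
def univ {k : ℕ} : Expr k :=
  .sum .inputLength (.not (.sum (.add (.var 0) (.const 1)) (.not (.inputBit (.var 0)))))

/-- The number of assignments to `K` variables. -/
def total {k : ℕ} (K : ℕ) : Expr k := .pow (.add univ (.const 1)) K

/-- The digit of `e` for the variable `v`. -/
def digit {k : ℕ} (e : Expr k) (v : ℕ) : Expr k :=
  .mod (.div e (.pow (.add univ (.const 1)) v)) (.add univ (.const 1))

/-- The tuples of values at `y` and `z` are equal. -/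
def eqTuple {k l : ℕ} (a : Expr k) (y : Fin l → ℕ) (b : Expr k) (z : Fin l → ℕ) : Expr k :=
  .all (List.ofFn fun i => .eq (digit a (y i)) (digit b (z i)))

/-- All variables in the tuple `y` have a value. -/
def defined {k l : ℕ} (a : Expr k) (y : Fin l → ℕ) : Expr k :=
  .all (List.ofFn fun i => digit a (y i))

/-- The number of the tuple of values at `y`. -/
def index {k l : ℕ} (a : Expr k) (y : Fin l → ℕ) : Expr k :=
  .sumList (List.ofFn fun i => .mul (.sub (digit a (y i)) (.const 1)) (.pow univ i))

/-- The relation `R` holds for the values at `y`. -/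
def relHolds {k : ℕ} (R : Fin σ.numRel) (a : Expr k) (y : Fin (σ.arity R) → ℕ) : Expr k :=
  .mul (defined a y) (.inputBit (.add (.add univ (.const 1))
    (.add (.sumList ((List.ofFn fun R => .pow univ (σ.arity R)).take R)) (index a y))))

variable (σ) in
/-- The input encodes a structure. -/
def isCode {k : ℕ} : Expr k :=
  .eq .inputLength (.add (.add univ (.const 1))
    (.sumList (List.ofFn fun R => .pow univ (σ.arity R))))

/-- The assignment `b` arises from `a` by a new value for `y`. -/
def isSupp {k : ℕ} (K : ℕ) (a b : Expr k) (y : ℕ) : Expr k :=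
  .all ((List.range K).map fun v => if v = y then digit b v else .eq (digit a v) (digit b v))

/-- The assignment `a` has domain `D`. -/
def hasDomain {k : ℕ} (K : ℕ) (a : Expr k) (D : Finset ℕ) : Expr k :=
  .all ((List.range K).map fun v => if v ∈ D then digit a v else .not (digit a v))

variable {x : List Bool} {m : ℕ → Bool} {k l : ℕ} {env : Fin k → ℕ}

-- Position `i` is counted if the input has no zero among the positions up to `i`.
@[simp] theorem eval_univ : (univ : Expr k).eval x m env = leadingOnes x := by
  simp only [univ, eval_sum, eval_inputLength, eval_not, eval_add, eval_var, eval_const,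
    eval_inputBit, Matrix.cons_val_zero]
  rw [← sum_ite_lt (leadingOnes_le x)]
  refine Finset.sum_congr rfl fun i _ => ?_
  congr 1
  rw [Finset.sum_eq_zero_iff, lt_leadingOnes]
  simp

@[simp] theorem eval_total : (total K : Expr k).eval x m env = (leadingOnes x + 1) ^ K := by
  simp [total]

@[simp] theorem eval_digit (e : Expr k) (v : ℕ) :
    (digit e v).eval x m env = dig (leadingOnes x) (e.eval x m env) v := by
  have h : 0 < (Expr.pow (.add univ (.const 1)) v : Expr k).eval x m env := by simp
  rw [digit, eval_mod _ _ _ (by simp), eval_div _ _ _ h]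
  simp [dig]

theorem eqTuple_iff {a b : Expr k} {y z : Fin l → ℕ} (hy : ∀ i, y i < K) (hz : ∀ i, z i < K) :
    (eqTuple a y b z).eval x m env ≠ 0 ↔ decode (leadingOnes x) K (a.eval x m env) ∘ y =
      decode (leadingOnes x) K (b.eval x m env) ∘ z := by
  simp [eqTuple, eval_all_ne_zero, funext_iff, decode_eq_decode (hy _) (hz _)]

theorem defined_iff {a : Expr k} {y : Fin l → ℕ} (hy : ∀ i, y i < K) :
    (defined a y).eval x m env ≠ 0 ↔ ∃ f : Fin l → Fin (leadingOnes x),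
      decode (leadingOnes x) K (a.eval x m env) ∘ y = some ∘ f := by
  simp only [defined, eval_all_ne_zero, List.forall_mem_ofFn_iff, eval_digit, funext_iff,
    Function.comp, decode_apply _ (hy _)]
  rw [← Classical.skolem (p := fun i c => digitValue _ (dig _ _ (y i)) = some c)]
  refine forall_congr' fun i => ?_
  rw [ne_eq, ← digitValue_eq_none (dig_lt _ _ _), ← ne_eq, Option.ne_none_iff_exists']

theorem eval_index {a : Expr k} {y : Fin l → ℕ} (hy : ∀ i, y i < K)
    {f : Fin l → Fin (leadingOnes x)}
    (h : decode (leadingOnes x) K (a.eval x m env) ∘ y = some ∘ f) :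
    (index a y).eval x m env = finFunctionFinEquiv f := by
  rw [finFunctionFinEquiv_apply, index, eval_sumList, List.map_ofFn, List.sum_ofFn]
  refine Finset.sum_congr rfl fun i _ => ?_
  have hi := congrFun h i
  simp only [Function.comp, decode_apply _ (hy i), digitValue_eq_some (dig_lt _ _ _)] at hi
  simp [hi]

/-- The factor `defined` is needed because on undefined variables truncated subtraction would
produce the index of an unrelated tuple. -/
theorem relHolds_iff {A : FinStructure σ (leadingOnes x)} (hA : A.code = x) {R : Fin σ.numRel}
    {a : Expr k} {y : Fin (σ.arity R) → ℕ} (hy : ∀ i, y i < K) :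
    (relHolds R a y).eval x m env ≠ 0 ↔
      ∃ f ∈ A.rel R, decode (leadingOnes x) K (a.eval x m env) ∘ y = some ∘ f := by
  have off : ((List.ofFn fun R => (Expr.pow univ (σ.arity R) : Expr k)).take R).map
      (fun e => e.eval x m env) = (List.ofFn fun R => leadingOnes x ^ σ.arity R).take R := by
    rw [List.map_take, List.map_ofFn]
    congr 2
    funext i
    simp
  have bit : ∀ f, decode (leadingOnes x) K (a.eval x m env) ∘ y = some ∘ f →
      ((Expr.inputBit (.add (.add univ (.const 1)) (.add (.sumList
        ((List.ofFn fun R => .pow univ (σ.arity R)).take R)) (index a y)))).eval x m env ≠ 0 ↔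
          f ∈ A.rel R) := by
    intro f hf
    have := A.getD_code R f
    rw [hA] at this
    rw [eval_inputBit, Expr.eval_add, Expr.eval_add, Expr.eval_add, eval_sumList, off,
      eval_index hy hf, eval_univ, eval_const, this]
    simp
  rw [relHolds, eval_mul, mul_ne_zero_iff, defined_iff hy]
  constructor
  · rintro ⟨⟨f, hf⟩, h⟩
    exact ⟨f, (bit f hf).1 h, hf⟩
  · rintro ⟨f, hR, hf⟩
    exact ⟨⟨f, hf⟩, (bit f hf).2 hR⟩

theorem isCode_iff : (isCode σ : Expr k).eval x m env ≠ 0 ↔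
    x.length = leadingOnes x + 1 + (List.ofFn fun R => leadingOnes x ^ σ.arity R).sum := by
  have e : (fun e : Expr k => e.eval x m env) ∘ (fun R => .pow univ (σ.arity R)) =
      fun R => leadingOnes x ^ σ.arity R := by
    funext R; simp
  simp [isCode, List.map_ofFn, e]

theorem isSupp_iff {a b : Expr k} {y : ℕ} (hy : y < K) :
    (isSupp K a b y).eval x m env ≠ 0 ↔ ∃ c, decode (leadingOnes x) K (b.eval x m env) =
      Assignment.supp (decode (leadingOnes x) K (a.eval x m env)) c y := by
  simp only [isSupp, eval_all_ne_zero, List.forall_mem_map, List.mem_range]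
  constructor
  · intro h
    have hd := h y hy
    rw [if_pos rfl, eval_digit, ne_eq, ← digitValue_eq_none (dig_lt _ _ _), ← ne_eq,
      Option.ne_none_iff_exists'] at hd
    obtain ⟨c, hc⟩ := hd
    refine ⟨c, funext fun v => ?_⟩
    by_cases hv : v = y
    · subst hv
      simpa [Assignment.supp, decode_apply _ hy] using hc
    · simp only [Assignment.supp, Function.update_of_ne hv]
      by_cases hK : v < K
      · rw [decode_eq_decode hK hK]
        have := h v hK
        rw [if_neg hv] at this
        simp at this
        exact this.symm
      · simp [decode, hK]
  · rintro ⟨c, hc⟩ v hv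
    have hcv := congrFun hc v
    by_cases h : v = y
    · subst h
      rw [if_pos rfl, eval_digit, ne_eq, ← digitValue_eq_none (dig_lt _ _ _),
        ← decode_apply _ hv, hcv]
      simp [Assignment.supp]
    · rw [Assignment.supp, Function.update_of_ne h, decode_eq_decode hv hv] at hcv
      rw [if_neg h]
      simp [hcv]

theorem hasDomain_iff {a : Expr k} {D : Finset ℕ} (hD : ∀ v ∈ D, v < K) :
    (hasDomain K a D).eval x m env ≠ 0 ↔
      Assignment.HasDomain (decode (leadingOnes x) K (a.eval x m env)) D := by
  simp only [hasDomain, eval_all_ne_zero, List.forall_mem_map, List.mem_range,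
    Assignment.HasDomain]
  have key : ∀ v < K, (decode (leadingOnes x) K (a.eval x m env) v).isSome ↔
      dig (leadingOnes x) (a.eval x m env) v ≠ 0 := fun v hv => by
    rw [decode_apply _ hv, Option.isSome_iff_ne_none, ne_eq, digitValue_eq_none (dig_lt _ _ _)]
  constructor
  · intro h v
    by_cases hv : v < K
    · have := h v hv
      rw [key v hv]
      by_cases hvD : v ∈ D <;> simp_all
    · have : v ∉ D := fun h => hv (hD v h)
      simp [decode, hv, this]
  · intro h v hv
    have := h v
    rw [key v hv] at this
    by_cases hvD : v ∈ D <;> simp_all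

end Code

end TeamLogic

/-! ## Team semantics by clauses -/

namespace TeamLogic

open EnumComplexity.Loop

variable {σ : Vocabulary} {n K : ℕ}

/-- A family of clauses about finitely many teams: for all assignments `s` (variable `1` of the
guard) and `t` (variable `0`) that fulfil the guard, if `s` is in team `b₁` and `t` in team `b₂`,
then one of the teams in `pos` contains an assignment `u` that fulfils the corresponding relation
(variables `0`, `1`, `2` are `u`, `t`, `s`). -/
structure Template where
  b₁ : ℕ
  b₂ : Option ℕ
  guard : Expr 2
  pos : List (ℕ × Expr 3)

/-- The clauses hold for teams given by the numbers of their assignments. -/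
def Template.Holds (x : List Bool) (m : ℕ → Bool) (K : ℕ) (T : ℕ → ℕ → Bool) (τ : Template) :
    Prop :=
  ∀ s < (leadingOnes x + 1) ^ K, ∀ t < (leadingOnes x + 1) ^ K, T τ.b₁ s = true →
    (∀ b ∈ τ.b₂, T b t = true) → τ.guard.eval x m ![t, s] ≠ 0 →
      ∃ p ∈ τ.pos, ∃ u < (leadingOnes x + 1) ^ K,
        p.2.eval x m ![u, t, s] ≠ 0 ∧ T p.1 u = true

/-- The team with number `b`. -/
def team (n K : ℕ) (T : ℕ → ℕ → Bool) (b : ℕ) : Team n :=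
  {a | ∃ s < (n + 1) ^ K, decode n K s = a ∧ T b s = true}

theorem decode_mem_team {T : ℕ → ℕ → Bool} {b s : ℕ} (hs : s < (n + 1) ^ K) :
    decode n K s ∈ team n K T b ↔ T b s = true := by
  constructor
  · rintro ⟨t, ht, h, hT⟩
    rwa [← decode_injOn ht hs h]
  · exact fun h => ⟨s, hs, rfl, h⟩

theorem supported_of_mem_team {T : ℕ → ℕ → Bool} {b : ℕ} {a : Assignment n}
    (h : a ∈ team n K T b) : Supported K a := by
  obtain ⟨s, -, rfl, -⟩ := h
  exact supported_decode s

/-- Numbers below `(n + 1) ^ K` correspond to supported assignments, so quantifiers over numbers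
become quantifiers over assignments. Without a second team the variable `b` is restricted only by
its support; the clauses for the universal quantifier use this freedom. -/
theorem Template.holds_iff {x : List Bool} {m : ℕ → Bool} {T : ℕ → ℕ → Bool} {τ : Template}
    (g : Assignment (leadingOnes x) → Assignment (leadingOnes x) → Prop)
    (r : Assignment (leadingOnes x) → Assignment (leadingOnes x) →
      Assignment (leadingOnes x) → Prop)
    (hg : ∀ s t, τ.guard.eval x m ![t, s] ≠ 0 ↔
      g (decode (leadingOnes x) K s) (decode (leadingOnes x) K t))
    (hr : ∀ p ∈ τ.pos, ∀ s t u, p.2.eval x m ![u, t, s] ≠ 0 ↔ r (decode (leadingOnes x) K s)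
      (decode (leadingOnes x) K t) (decode (leadingOnes x) K u)) :
    τ.Holds x m K T ↔ ∀ a ∈ team (leadingOnes x) K T τ.b₁, ∀ b, Supported K b →
      (∀ β ∈ τ.b₂, b ∈ team (leadingOnes x) K T β) → g a b →
        ∃ p ∈ τ.pos, ∃ c ∈ team (leadingOnes x) K T p.1, r a b c := by
  constructor
  · rintro h a ⟨s, hs, rfl, hsT⟩ b hb hbT hgab
    obtain ⟨t, ht, rfl⟩ := exists_decode hb
    obtain ⟨p, hp, u, hu, hru, huT⟩ := h s hs t ht hsT
      (fun β hβ => (decode_mem_team ht).1 (hbT β hβ)) ((hg s t).2 hgab)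
    exact ⟨p, hp, _, (decode_mem_team hu).2 huT, (hr p hp s t u).1 hru⟩
  · intro h s hs t ht hsT htT hgst
    obtain ⟨p, hp, c, ⟨u, hu, rfl, huT⟩, hrc⟩ := h _ ((decode_mem_team hs).2 hsT) _
      (supported_decode t) (fun β hβ => (decode_mem_team ht).2 (htT β hβ)) ((hg s t).1 hgst)
    exact ⟨p, hp, u, hu, (hr p hp s t u).2 hrc, huT⟩

/-- All variables of the formula are below `K`. -/
def Formula.Below (K : ℕ) : Formula σ → Prop
  | .eq y z => y < K ∧ z < K
  | .neq y z => y < K ∧ z < K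
  | .rel _ y => ∀ i, y i < K
  | .nrel _ y => ∀ i, y i < K
  | .dep y z => (∀ i, y i < K) ∧ ∀ i, z i < K
  | .incl y z => (∀ i, y i < K) ∧ ∀ i, z i < K
  | .indep y w z => (∀ i, y i < K) ∧ (∀ i, w i < K) ∧ ∀ i, z i < K
  | .and φ ψ => φ.Below K ∧ ψ.Below K
  | .or φ ψ => φ.Below K ∧ ψ.Below K
  | .ex y φ => y < K ∧ φ.Below K
  | .all y φ => y < K ∧ φ.Below K

theorem Formula.Below.mono {φ : Formula σ} {K L : ℕ} (h : φ.Below K) (hKL : K ≤ L) :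
    φ.Below L := by
  induction φ with
  | eq | neq => exact ⟨h.1.trans_le hKL, h.2.trans_le hKL⟩
  | rel | nrel => exact fun i => (h i).trans_le hKL
  | dep | incl => exact ⟨fun i => (h.1 i).trans_le hKL, fun i => (h.2 i).trans_le hKL⟩
  | indep => exact ⟨fun i => (h.1 i).trans_le hKL, fun i => (h.2.1 i).trans_le hKL,
      fun i => (h.2.2 i).trans_le hKL⟩
  | and _ _ ih₁ ih₂ | or _ _ ih₁ ih₂ => exact ⟨ih₁ h.1, ih₂ h.2⟩
  | ex _ _ ih | all _ _ ih => exact ⟨h.1.trans_le hKL, ih h.2⟩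

theorem exists_tuple_lt {k : ℕ} (y : Fin k → ℕ) : ∃ K, ∀ i, y i < K :=
  ⟨Finset.univ.sup y + 1, fun i => Nat.lt_succ_of_le (Finset.le_sup (Finset.mem_univ i))⟩

theorem Formula.exists_below (φ : Formula σ) : ∃ K, φ.Below K := by
  have two : ∀ {k l : ℕ} (y : Fin k → ℕ) (z : Fin l → ℕ),
      ∃ K, (∀ i, y i < K) ∧ ∀ i, z i < K := fun y z => by
    obtain ⟨K, hK⟩ := exists_tuple_lt y
    obtain ⟨L, hL⟩ := exists_tuple_lt z
    exact ⟨max K L, fun i => lt_max_of_lt_left (hK i), fun i => lt_max_of_lt_right (hL i)⟩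
  induction φ with
  | eq y z | neq y z =>
    exact ⟨max y z + 1, Nat.lt_succ_of_le (le_max_left _ _), Nat.lt_succ_of_le (le_max_right _ _)⟩
  | rel _ y | nrel _ y => exact exists_tuple_lt y
  | dep y z | incl y z => exact two y z
  | indep y w z =>
    obtain ⟨K, hK, hK'⟩ := two y w
    obtain ⟨L, hL⟩ := exists_tuple_lt z
    exact ⟨max K L, fun i => lt_max_of_lt_left (hK i), fun i => lt_max_of_lt_left (hK' i),
      fun i => lt_max_of_lt_right (hL i)⟩
  | and _ _ ih₁ ih₂ | or _ _ ih₁ ih₂ =>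
    obtain ⟨K, hK⟩ := ih₁
    obtain ⟨L, hL⟩ := ih₂
    exact ⟨max K L, hK.mono (le_max_left _ _), hL.mono (le_max_right _ _)⟩
  | ex y _ ih | all y _ ih =>
    obtain ⟨K, hK⟩ := ih
    exact ⟨max (y + 1) K, lt_max_of_lt_left (Nat.lt_succ_self _), hK.mono (le_max_right _ _)⟩

theorem Formula.Below.free_lt {φ : Formula σ} (h : φ.Below K) : ∀ v ∈ φ.free, v < K := by
  have tv : ∀ {k : ℕ} {y : Fin k → ℕ}, (∀ i, y i < K) → ∀ v ∈ tupleVars y, v < K := by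
    intro k y hy v hv
    obtain ⟨i, -, rfl⟩ := Finset.mem_image.1 hv
    exact hy i
  induction φ with
  | eq | neq =>
    intro v hv
    simp only [Formula.free, Finset.mem_insert, Finset.mem_singleton] at hv
    rcases hv with rfl | rfl
    exacts [h.1, h.2]
  | rel | nrel => exact tv h
  | dep | incl =>
    intro v hv
    rcases Finset.mem_union.1 hv with hv | hv
    exacts [tv h.1 v hv, tv h.2 v hv]
  | indep =>
    intro v hv
    rcases Finset.mem_union.1 hv with hv | hv
    · rcases Finset.mem_union.1 hv with hv | hv
      exacts [tv h.1 v hv, tv h.2.1 v hv]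
    · exact tv h.2.2 v hv
  | and _ _ ih₁ ih₂ | or _ _ ih₁ ih₂ =>
    intro v hv
    rcases Finset.mem_union.1 hv with hv | hv
    exacts [ih₁ h.1 v hv, ih₂ h.2 v hv]
  | ex _ _ ih | all _ _ ih => exact fun v hv => ih h.2 v (Finset.mem_of_mem_erase hv)

/-! ### Translation of formulas into clauses -/

/-- The number of auxiliary teams. -/
def Formula.aux : Formula σ → ℕ
  | .and φ ψ => φ.aux + ψ.aux
  | .or φ ψ => 2 + φ.aux + ψ.aux
  | .ex _ φ => 1 + φ.aux
  | .all _ φ => 1 + φ.aux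
  | _ => 0

/-- The team `b` satisfies the formula; auxiliary teams have numbers from `ν` on. -/
def Formula.templates (K : ℕ) : Formula σ → ℕ → ℕ → List Template
  | .eq y z, b, _ => [⟨b, none, .not (Code.eqTuple (.var 1) ![y] (.var 1) ![z]), []⟩]
  | .neq y z, b, _ => [⟨b, none, Code.eqTuple (.var 1) ![y] (.var 1) ![z], []⟩]
  | .rel R y, b, _ => [⟨b, none, .not (Code.relHolds R (.var 1) y), []⟩]
  | .nrel R y, b, _ => [⟨b, none, Code.relHolds R (.var 1) y, []⟩]
  | .dep y z, b, _ => [⟨b, some b, .mul (Code.eqTuple (.var 1) y (.var 0) y)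
      (.not (Code.eqTuple (.var 1) z (.var 0) z)), []⟩]
  | .incl y z, b, _ => [⟨b, none, .const 1, [(b, Code.eqTuple (.var 2) y (.var 0) z)]⟩]
  | .indep y w z, b, _ => [⟨b, some b, Code.eqTuple (.var 1) w (.var 0) w,
      [(b, .mul (Code.eqTuple (.var 0) y (.var 2) y) (.mul (Code.eqTuple (.var 0) z (.var 1) z)
        (Code.eqTuple (.var 0) w (.var 2) w)))]⟩]
  | .and φ ψ, b, ν => φ.templates K b ν ++ ψ.templates K b (ν + φ.aux)
  -- Teams `ν` and `ν + 1` are the two parts: both are contained in team `b`, and together they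
  -- cover it.
  | .or φ ψ, b, ν =>
    let same : Expr 3 := Code.eqTuple (.var 0) (fun i : Fin K => i) (.var 2) fun i : Fin K => i
    [⟨ν, none, .const 1, [(b, same)]⟩, ⟨ν + 1, none, .const 1, [(b, same)]⟩,
      ⟨b, none, .const 1, [(ν, same), (ν + 1, same)]⟩] ++
    (φ.templates K ν (ν + 2) ++ ψ.templates K (ν + 1) (ν + 2 + φ.aux))
  | .ex y φ, b, ν =>
    [⟨b, none, .const 1, [(ν, Code.isSupp K (.var 2) (.var 0) y)]⟩,
      ⟨ν, none, .const 1, [(b, Code.isSupp K (.var 0) (.var 2) y)]⟩] ++ φ.templates K ν (ν + 1)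
  | .all y φ, b, ν =>
    [⟨b, none, Code.isSupp K (.var 1) (.var 0) y,
        [(ν, Code.eqTuple (.var 0) (fun i : Fin K => i) (.var 1) fun i : Fin K => i)]⟩,
      ⟨ν, none, .const 1, [(b, Code.isSupp K (.var 0) (.var 2) y)]⟩] ++ φ.templates K ν (ν + 1)

/-- All teams in the template have numbers below `N`. -/
def Template.Below (N : ℕ) (τ : Template) : Prop :=
  τ.b₁ < N ∧ (∀ b ∈ τ.b₂, b < N) ∧ ∀ p ∈ τ.pos, p.1 < N

theorem Template.Below.mono {N N' : ℕ} {τ : Template} (h : τ.Below N) (hN : N ≤ N') :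
    τ.Below N' :=
  ⟨h.1.trans_le hN, fun b hb => (h.2.1 b hb).trans_le hN, fun p hp => (h.2.2 p hp).trans_le hN⟩

theorem Template.Holds.congr {x : List Bool} {m : ℕ → Bool} {T T' : ℕ → ℕ → Bool} {N : ℕ}
    {τ : Template} (h : τ.Holds x m K T) (hτ : τ.Below N) (hT : ∀ b < N, T' b = T b) :
    τ.Holds x m K T' := by
  intro s hs t ht h₁ h₂ hg
  rw [hT _ hτ.1] at h₁
  obtain ⟨p, hp, u, hu, hr, hpu⟩ := h s hs t ht h₁
    (fun b hb => by rw [← hT b (hτ.2.1 b hb)]; exact h₂ b hb) hg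
  exact ⟨p, hp, u, hu, hr, by rwa [hT _ (hτ.2.2 p hp)]⟩

/-- Auxiliary teams of different subformulas occupy disjoint intervals of numbers. Witnesses found
for one subformula are thus not affected by a later choice for another one. -/
theorem Formula.templates_below (φ : Formula σ) : ∀ {b ν : ℕ}, b < ν →
    ∀ τ ∈ φ.templates K b ν, τ.Below (ν + φ.aux) := by
  induction φ with
  | and φ ψ ih₁ ih₂ =>
    intro b ν hb τ hτ
    rcases List.mem_append.1 hτ with h | h
    · exact (ih₁ hb τ h).mono (by simp only [aux]; omega)
    · exact (ih₂ (by omega) τ h).mono (by simp only [aux]; omega)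
  | or φ ψ ih₁ ih₂ =>
    intro b ν hb τ hτ
    rcases List.mem_append.1 hτ with h | h
    · simp only [List.mem_cons, List.not_mem_nil, or_false] at h
      rcases h with rfl | rfl | rfl <;> simp [Template.Below, aux] <;> omega
    · rcases List.mem_append.1 h with h | h
      · exact (ih₁ (by omega) τ h).mono (by simp only [aux]; omega)
      · exact (ih₂ (by omega) τ h).mono (by simp only [aux]; omega)
  | ex y φ ih | all y φ ih =>
    intro b ν hb τ hτ
    rcases List.mem_append.1 hτ with h | h
    · simp only [List.mem_cons, List.not_mem_nil, or_false] at h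
      rcases h with rfl | rfl <;> simp [Template.Below, aux] <;> omega
    · exact (ih (by omega) τ h).mono (by simp only [aux]; omega)
  | _ =>
    intro b ν hb τ hτ
    simp only [templates, List.mem_cons, List.not_mem_nil, or_false] at hτ
    subst hτ
    simp [Template.Below]
    try omega

/-! ### Meaning of the clauses for atoms, disjunction and quantifiers -/

section Semantics

variable {x : List Bool} {m : ℕ → Bool} {T : ℕ → ℕ → Bool}

theorem eqTuple_id_iff {k : ℕ} {a b : Expr k} {env : Fin k → ℕ} :
    (Code.eqTuple a (fun i : Fin K => (i : ℕ)) b fun i : Fin K => (i : ℕ)).eval x m env ≠ 0 ↔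
      decode (leadingOnes x) K (a.eval x m env) = decode (leadingOnes x) K (b.eval x m env) := by
  rw [Code.eqTuple_iff (fun i => i.2) (fun i => i.2)]
  constructor
  · intro h
    funext v
    by_cases hv : v < K
    · exact congrFun h ⟨v, hv⟩
    · simp [decode, hv]
  · intro h
    rw [h]

theorem singleton_comp_eq {s t : Assignment n} {y z : ℕ} : s ∘ ![y] = t ∘ ![z] ↔ s y = t z := by
  simp [funext_iff]

/-- With no positive literals, a clause forbids its guard on the members of the team; atoms about
single assignments are expressed by forbidding their negation. -/
theorem holds_none_nil {b : ℕ} {e : Expr 2} (g : Assignment (leadingOnes x) → Prop)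
    (hg : ∀ s t, e.eval x m ![t, s] ≠ 0 ↔ g (decode (leadingOnes x) K s)) :
    (⟨b, none, e, []⟩ : Template).Holds x m K T ↔ ∀ a ∈ team (leadingOnes x) K T b, ¬ g a := by
  rw [Template.holds_iff (fun a _ => g a) (fun _ _ _ => True) hg (by simp)]
  constructor
  · intro h a ha hga
    simpa using h a ha a (supported_of_mem_team ha) (by simp) hga
  · intro h a ha _ _ _ hga
    exact (h a ha hga).elim

theorem holds_one {b : ℕ} {l : List ℕ} {e : Expr 3}
    (r : Assignment (leadingOnes x) → Assignment (leadingOnes x) → Prop)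
    (hr : ∀ s t u, e.eval x m ![u, t, s] ≠ 0 ↔
      r (decode (leadingOnes x) K s) (decode (leadingOnes x) K u)) :
    (⟨b, none, .const 1, l.map fun β => (β, e)⟩ : Template).Holds x m K T ↔
      ∀ a ∈ team (leadingOnes x) K T b, ∃ β ∈ l, ∃ c ∈ team (leadingOnes x) K T β, r a c := by
  rw [Template.holds_iff (fun _ _ => True) (fun a _ c => r a c) (by simp)
    (by simpa using fun _ _ => hr)]
  simp only [List.mem_map, exists_exists_and_eq_and]
  constructor
  · intro h a ha
    exact h a ha a (supported_of_mem_team ha) (by simp) trivial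
  · intro h a ha _ _ _ _
    exact h a ha

theorem atom_eq_iff (A : FinStructure σ (leadingOnes x)) {b ν y z : ℕ} (hy : y < K) (hz : z < K) :
    (∀ τ ∈ (Formula.eq y z : Formula σ).templates K b ν, τ.Holds x m K T) ↔
      Sat A (team (leadingOnes x) K T b) (.eq y z) := by
  simp only [Formula.templates, List.mem_singleton, forall_eq, Sat]
  rw [holds_none_nil (fun a => a y ≠ a z) fun s t => ?_]
  · simp
  · have := Code.eqTuple_iff (x := x) (m := m) (K := K) (a := (.var 1 : Expr 2)) (b := .var 1)
      (env := ![t, s]) (y := ![y]) (z := ![z]) (by simpa using hy) (by simpa using hz)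
    rw [singleton_comp_eq] at this
    simpa using not_congr this

theorem atom_neq_iff (A : FinStructure σ (leadingOnes x)) {b ν y z : ℕ} (hy : y < K) (hz : z < K) :
    (∀ τ ∈ (Formula.neq y z : Formula σ).templates K b ν, τ.Holds x m K T) ↔
      Sat A (team (leadingOnes x) K T b) (.neq y z) := by
  simp only [Formula.templates, List.mem_singleton, forall_eq, Sat]
  rw [holds_none_nil (fun a => a y = a z) fun s t => ?_]
  have := Code.eqTuple_iff (x := x) (m := m) (K := K) (a := (.var 1 : Expr 2)) (b := .var 1)
    (env := ![t, s]) (y := ![y]) (z := ![z]) (by simpa using hy) (by simpa using hz)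
  rwa [singleton_comp_eq] at this

theorem atom_rel_iff {A : FinStructure σ (leadingOnes x)} (hA : A.code = x) {b ν : ℕ}
    {R : Fin σ.numRel} {y : Fin (σ.arity R) → ℕ} (hy : ∀ i, y i < K) :
    (∀ τ ∈ (Formula.rel R y).templates K b ν, τ.Holds x m K T) ↔
      Sat A (team (leadingOnes x) K T b) (.rel R y) := by
  simp only [Formula.templates, List.mem_singleton, forall_eq, Sat]
  rw [holds_none_nil (fun a => ¬ ∃ f ∈ A.rel R, a ∘ y = some ∘ f) fun s t => ?_]
  · simp only [not_not]
  · have := Code.relHolds_iff (m := m) (k := 2) (env := ![t, s]) (a := .var 1) hA hy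
    simpa using not_congr this

theorem atom_nrel_iff {A : FinStructure σ (leadingOnes x)} (hA : A.code = x) {b ν : ℕ}
    {R : Fin σ.numRel} {y : Fin (σ.arity R) → ℕ} (hy : ∀ i, y i < K) :
    (∀ τ ∈ (Formula.nrel R y).templates K b ν, τ.Holds x m K T) ↔
      Sat A (team (leadingOnes x) K T b) (.nrel R y) := by
  simp only [Formula.templates, List.mem_singleton, forall_eq, Sat]
  rw [holds_none_nil (fun a => ∃ f ∈ A.rel R, a ∘ y = some ∘ f) fun s t => ?_]
  exact Code.relHolds_iff (m := m) (k := 2) (env := ![t, s]) (a := .var 1) hA hy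

theorem atom_dep_iff (A : FinStructure σ (leadingOnes x)) {b ν k l : ℕ} {y : Fin k → ℕ}
    {z : Fin l → ℕ} (hy : ∀ i, y i < K) (hz : ∀ i, z i < K) :
    (∀ τ ∈ (Formula.dep y z : Formula σ).templates K b ν, τ.Holds x m K T) ↔
      Sat A (team (leadingOnes x) K T b) (.dep y z) := by
  simp only [Formula.templates, List.mem_singleton, forall_eq, Sat]
  rw [Template.holds_iff (fun s t => s ∘ y = t ∘ y ∧ ¬ s ∘ z = t ∘ z) (fun _ _ _ => True)
    (fun s t => ?_) (by simp)]
  · constructor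
    · intro h s hs t ht he
      by_contra hne
      simpa using h s hs t (supported_of_mem_team ht) (by simpa using ht) ⟨he, hne⟩
    · intro h s hs t _ ht hst
      exact (hst.2 (h s hs t (by simpa using ht) hst.1)).elim
  · rw [Expr.eval_mul, mul_ne_zero_iff, Code.eqTuple_iff hy hy]
    have := Code.eqTuple_iff (x := x) (m := m) (K := K) (a := (.var 1 : Expr 2)) (b := .var 0)
      (env := ![t, s]) hz hz
    refine and_congr Iff.rfl ?_
    simpa using not_congr this

theorem atom_incl_iff (A : FinStructure σ (leadingOnes x)) {b ν k : ℕ} {y z : Fin k → ℕ}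
    (hy : ∀ i, y i < K) (hz : ∀ i, z i < K) :
    (∀ τ ∈ (Formula.incl y z : Formula σ).templates K b ν, τ.Holds x m K T) ↔
      Sat A (team (leadingOnes x) K T b) (.incl y z) := by
  simp only [Formula.templates, List.mem_singleton, forall_eq, Sat]
  refine (holds_one (l := [b]) (fun s t => s ∘ y = t ∘ z) fun s t u =>
    Code.eqTuple_iff hy hz).trans ?_
  simp

theorem atom_indep_iff (A : FinStructure σ (leadingOnes x)) {b ν k l r : ℕ} {y : Fin k → ℕ}
    {w : Fin r → ℕ} {z : Fin l → ℕ} (hy : ∀ i, y i < K) (hw : ∀ i, w i < K) (hz : ∀ i, z i < K) :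
    (∀ τ ∈ (Formula.indep y w z : Formula σ).templates K b ν, τ.Holds x m K T) ↔
      Sat A (team (leadingOnes x) K T b) (.indep y w z) := by
  simp only [Formula.templates, List.mem_singleton, forall_eq, Sat]
  rw [Template.holds_iff (fun s t => s ∘ w = t ∘ w)
    (fun s t u => u ∘ y = s ∘ y ∧ u ∘ z = t ∘ z ∧ u ∘ w = s ∘ w)
    (fun s t => Code.eqTuple_iff hw hw) fun p hp s t u => ?_]
  · constructor
    · intro h s hs t ht he
      simpa using h s hs t (supported_of_mem_team ht) (by simpa using ht) he
    · intro h s hs t _ ht hst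
      simpa using h s hs t (by simpa using ht) hst
  · rw [List.mem_singleton] at hp
    subst hp
    rw [Expr.eval_mul, mul_ne_zero_iff, Expr.eval_mul, mul_ne_zero_iff, Code.eqTuple_iff hy hy,
      Code.eqTuple_iff hz hz, Code.eqTuple_iff hw hw]
    rfl

theorem or_templates_iff {b c d : ℕ} :
    (∀ τ ∈ ([⟨c, none, .const 1, [(b, Code.eqTuple (.var 0) (fun i : Fin K => i) (.var 2)
          fun i : Fin K => i)]⟩,
        ⟨d, none, .const 1, [(b, Code.eqTuple (.var 0) (fun i : Fin K => i) (.var 2)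
          fun i : Fin K => i)]⟩,
        ⟨b, none, .const 1, [(c, Code.eqTuple (.var 0) (fun i : Fin K => i) (.var 2)
          fun i : Fin K => i), (d, Code.eqTuple (.var 0) (fun i : Fin K => i) (.var 2)
          fun i : Fin K => i)]⟩] : List Template), τ.Holds x m K T) ↔
      team (leadingOnes x) K T c ⊆ team (leadingOnes x) K T b ∧
      team (leadingOnes x) K T d ⊆ team (leadingOnes x) K T b ∧
      team (leadingOnes x) K T b ⊆ team (leadingOnes x) K T c ∪ team (leadingOnes x) K T d := by
  have h := fun (c : ℕ) (l : List ℕ) => holds_one (x := x) (m := m) (T := T) (K := K) (b := c)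
    (l := l) (e := Code.eqTuple (.var 0) (fun i : Fin K => i) (.var 2) fun i : Fin K => i)
    (fun s t => t = s) fun s t u => eqTuple_id_iff
  have h₁ := h c [b]
  have h₂ := h d [b]
  have h₃ := h b [c, d]
  simp only [List.map_cons, List.map_nil] at h₁ h₂ h₃
  simp only [List.forall_mem_cons, List.not_mem_nil, false_imp_iff, implies_true, and_true,
    h₁, h₂, h₃]
  simp [Set.subset_def]

/-- The right-hand side says that team `c` arises from team `b` by some choice of nonempty value
sets for `y`: every member of `b` has an extension in `c`, and `c` contains nothing but such
extensions. -/
theorem ex_templates_iff {b c y : ℕ} (hy : y < K) :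
    (∀ τ ∈ ([⟨b, none, .const 1, [(c, Code.isSupp K (.var 2) (.var 0) y)]⟩,
      ⟨c, none, .const 1, [(b, Code.isSupp K (.var 0) (.var 2) y)]⟩] : List Template),
        τ.Holds x m K T) ↔
      (∀ s ∈ team (leadingOnes x) K T b, ∃ a, Assignment.supp s a y ∈ team (leadingOnes x) K T c) ∧
      ∀ t ∈ team (leadingOnes x) K T c, ∃ s ∈ team (leadingOnes x) K T b, ∃ a,
        t = Assignment.supp s a y := by
  have h₁ := holds_one (x := x) (m := m) (T := T) (K := K) (b := b) (l := [c])
    (e := Code.isSupp K (.var 2) (.var 0) y) (fun s t => ∃ a, t = Assignment.supp s a y)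
    fun s t u => Code.isSupp_iff hy
  have h₂ := holds_one (x := x) (m := m) (T := T) (K := K) (b := c) (l := [b])
    (e := Code.isSupp K (.var 0) (.var 2) y) (fun t s => ∃ a, t = Assignment.supp s a y)
    fun s t u => Code.isSupp_iff hy
  simp only [List.map_cons, List.map_nil] at h₁ h₂
  simp only [List.forall_mem_cons, List.not_mem_nil, false_imp_iff, implies_true, and_true, h₁, h₂]
  refine and_congr (forall₂_congr fun s _ => ?_) (by simp)
  simp only [List.mem_singleton, exists_eq_left]
  constructor
  · rintro ⟨_, ht, a, rfl⟩; exact ⟨a, ht⟩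
  · rintro ⟨a, ht⟩; exact ⟨_, ht, a, rfl⟩

theorem Supported.supp {s : Assignment n} (h : Supported K s) {y : ℕ} (hy : y < K) (a : Fin n) :
    Supported K (Assignment.supp s a y) := fun v hv => by
  rw [Assignment.supp, Function.update_of_ne (by omega), h v hv]

/-- One inclusion needs a clause for every possible extension of a member of team `b`. The
unrestricted variable `t` runs through the candidates, the guard selects the extensions, and
equality with `t` forces them into team `c`. -/
theorem all_templates_iff {b c y : ℕ} (hy : y < K) :
    (∀ τ ∈ ([⟨b, none, Code.isSupp K (.var 1) (.var 0) y,
        [(c, Code.eqTuple (.var 0) (fun i : Fin K => i) (.var 1) fun i : Fin K => i)]⟩,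
      ⟨c, none, .const 1, [(b, Code.isSupp K (.var 0) (.var 2) y)]⟩] : List Template),
        τ.Holds x m K T) ↔
      team (leadingOnes x) K T c = (team (leadingOnes x) K T b).suppAll y := by
  have h₁ := Template.holds_iff (x := x) (m := m) (T := T) (K := K)
    (τ := ⟨b, none, Code.isSupp K (.var 1) (.var 0) y,
        [(c, Code.eqTuple (.var 0) (fun i : Fin K => i) (.var 1) fun i : Fin K => i)]⟩)
    (fun s t => ∃ a, t = Assignment.supp s a y) (fun _ t u => u = t)
    (fun s t => Code.isSupp_iff hy) (fun p hp s t u => by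
      rw [List.mem_singleton] at hp
      subst hp
      exact eqTuple_id_iff)
  have h₂ := holds_one (x := x) (m := m) (T := T) (K := K) (b := c) (l := [b])
    (e := Code.isSupp K (.var 0) (.var 2) y) (fun t s => ∃ a, t = Assignment.supp s a y)
    fun s t u => Code.isSupp_iff hy
  simp only [List.map_cons, List.map_nil] at h₂
  simp only [List.forall_mem_cons, List.not_mem_nil, false_imp_iff, implies_true, and_true, h₁, h₂]
  rw [Set.Subset.antisymm_iff, and_comm]
  refine and_congr (by simp [Set.subset_def, Team.suppAll]) ?_
  constructor
  · rintro h _ ⟨s, hs, a, rfl⟩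
    simpa using h s hs _ ((supported_of_mem_team hs).supp hy a) (by simp) ⟨a, rfl⟩
  · rintro h s hs _ _ _ ⟨a, rfl⟩
    simpa using h ⟨s, hs, a, rfl⟩

end Semantics

/-! ### Soundness and completeness of the clauses -/

open Classical in
/-- Replace team `b` by `Y`. -/
noncomputable def setTeam (n K : ℕ) (T : ℕ → ℕ → Bool) (b : ℕ) (Y : Team n) : ℕ → ℕ → Bool :=
  Function.update T b fun s => decide (decode n K s ∈ Y)

theorem team_setTeam_self {T : ℕ → ℕ → Bool} {b : ℕ} {Y : Team n}
    (hY : ∀ a ∈ Y, Supported K a) : team n K (setTeam n K T b Y) b = Y := by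
  ext a
  constructor
  · rintro ⟨s, -, rfl, h⟩
    simpa [setTeam] using h
  · intro h
    obtain ⟨s, hs, rfl⟩ := exists_decode (hY a h)
    exact ⟨s, hs, rfl, by simpa [setTeam] using h⟩

theorem setTeam_of_ne {T : ℕ → ℕ → Bool} {b c : ℕ} {Y : Team n} (h : c ≠ b) :
    setTeam n K T b Y c = T c :=
  Function.update_of_ne h _ _

theorem team_congr {T T' : ℕ → ℕ → Bool} {b : ℕ} (h : T' b = T b) :
    team n K T' b = team n K T b := by
  simp only [team, h]

/-- The auxiliary teams are themselves the witnesses demanded by the semantics. -/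
theorem sat_of_templates {x : List Bool} {m : ℕ → Bool} {A : FinStructure σ (leadingOnes x)}
    (hA : A.code = x) (φ : Formula σ) : ∀ {b ν : ℕ} {T : ℕ → ℕ → Bool}, φ.Below K →
    (∀ τ ∈ φ.templates K b ν, τ.Holds x m K T) → Sat A (team (leadingOnes x) K T b) φ := by
  induction φ with
  | eq y z => intro b ν T hK h; exact (atom_eq_iff A hK.1 hK.2).1 h
  | neq y z => intro b ν T hK h; exact (atom_neq_iff A hK.1 hK.2).1 h
  | rel R y => intro b ν T hK h; exact (atom_rel_iff hA hK).1 h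
  | nrel R y => intro b ν T hK h; exact (atom_nrel_iff hA hK).1 h
  | dep y z => intro b ν T hK h; exact (atom_dep_iff A hK.1 hK.2).1 h
  | incl y z => intro b ν T hK h; exact (atom_incl_iff A hK.1 hK.2).1 h
  | indep y w z => intro b ν T hK h; exact (atom_indep_iff A hK.1 hK.2.1 hK.2.2).1 h
  | and φ ψ ih₁ ih₂ =>
    intro b ν T hK h
    rw [Formula.templates, List.forall_mem_append] at h
    exact ⟨ih₁ hK.1 h.1, ih₂ hK.2 h.2⟩
  | or φ ψ ih₁ ih₂ =>
    intro b ν T hK h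
    rw [Formula.templates, List.forall_mem_append, List.forall_mem_append, or_templates_iff] at h
    obtain ⟨⟨h₁, h₂, h₃⟩, h₄, h₅⟩ := h
    exact ⟨_, _, h₁, h₂, (Set.union_subset h₁ h₂).antisymm h₃, ih₁ hK.1 h₄, ih₂ hK.2 h₅⟩
  | ex y φ ih =>
    intro b ν T hK h
    rw [Formula.templates, List.forall_mem_append, ex_templates_iff hK.1] at h
    obtain ⟨⟨h₁, h₂⟩, h₃⟩ := h
    -- The largest possible choice function. Lax semantics permits several values, so none of the
    -- extensions present in team `ν` has to be discarded.
    refine ⟨fun s => {a | Assignment.supp s a y ∈ team (leadingOnes x) K T ν}, h₁, ?_⟩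
    convert ih hK.2 h₃ using 1
    ext t
    constructor
    · rintro ⟨s, -, a, ha, rfl⟩; exact ha
    · intro ht
      obtain ⟨s, hs, a, rfl⟩ := h₂ t ht
      exact ⟨s, hs, a, ht, rfl⟩
  | all y φ ih =>
    intro b ν T hK h
    rw [Formula.templates, List.forall_mem_append, all_templates_iff hK.1] at h
    rw [Sat, ← h.1]
    exact ih hK.2 h.2

/-- The witnesses of the semantics are installed as auxiliary teams with fresh numbers. Agreement of
`T'` with `T` below `ν` makes the induction work, since it protects team `b` and all teams chosen
earlier. -/
theorem templates_of_sat {x : List Bool} {m : ℕ → Bool} {A : FinStructure σ (leadingOnes x)}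
    (hA : A.code = x) (φ : Formula σ) : ∀ {b ν : ℕ} {T : ℕ → ℕ → Bool}, φ.Below K → b < ν →
    Sat A (team (leadingOnes x) K T b) φ → ∃ T' : ℕ → ℕ → Bool, (∀ c < ν, T' c = T c) ∧
      ∀ τ ∈ φ.templates K b ν, τ.Holds x m K T' := by
  induction φ with
  | eq y z => intro b ν T hK _ h; exact ⟨T, fun _ _ => rfl, (atom_eq_iff A hK.1 hK.2).2 h⟩
  | neq y z => intro b ν T hK _ h; exact ⟨T, fun _ _ => rfl, (atom_neq_iff A hK.1 hK.2).2 h⟩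
  | rel R y => intro b ν T hK _ h; exact ⟨T, fun _ _ => rfl, (atom_rel_iff hA hK).2 h⟩
  | nrel R y => intro b ν T hK _ h; exact ⟨T, fun _ _ => rfl, (atom_nrel_iff hA hK).2 h⟩
  | dep y z => intro b ν T hK _ h; exact ⟨T, fun _ _ => rfl, (atom_dep_iff A hK.1 hK.2).2 h⟩
  | incl y z => intro b ν T hK _ h; exact ⟨T, fun _ _ => rfl, (atom_incl_iff A hK.1 hK.2).2 h⟩
  | indep y w z =>
    intro b ν T hK _ h
    exact ⟨T, fun _ _ => rfl, (atom_indep_iff A hK.1 hK.2.1 hK.2.2).2 h⟩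
  | and φ ψ ih₁ ih₂ =>
    intro b ν T hK hb h
    obtain ⟨T₁, e₁, h₁⟩ := ih₁ hK.1 hb h.1
    obtain ⟨T₂, e₂, h₂⟩ := ih₂ (b := b) (ν := ν + φ.aux) (T := T₁) hK.2 (by omega)
      (by rw [team_congr (e₁ b hb)]; exact h.2)
    refine ⟨T₂, fun c hc => (e₂ c (by omega)).trans (e₁ c hc), ?_⟩
    rw [Formula.templates, List.forall_mem_append]
    -- The clauses for `φ` mention only teams below `ν + φ.aux`, where `T₂` and `T₁` agree.
    exact ⟨fun τ hτ => (h₁ τ hτ).congr (φ.templates_below hb τ hτ) e₂, h₂⟩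
  | or φ ψ ih₁ ih₂ =>
    intro b ν T hK hb h
    obtain ⟨Y, Z, hY, hZ, hYZ, hφ, hψ⟩ := h
    set T₀ := setTeam (leadingOnes x) K (setTeam (leadingOnes x) K T ν Y) (ν + 1) Z with hT₀
    have tY : team (leadingOnes x) K T₀ ν = Y := by
      rw [team_congr (setTeam_of_ne (by omega)),
        team_setTeam_self fun a ha => supported_of_mem_team (hY ha)]
    have tZ : team (leadingOnes x) K T₀ (ν + 1) = Z :=
      team_setTeam_self fun a ha => supported_of_mem_team (hZ ha)
    have e₀ : ∀ c < ν, T₀ c = T c := fun c hc => by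
      rw [hT₀, setTeam_of_ne (by omega), setTeam_of_ne (by omega)]
    obtain ⟨T₁, e₁, h₁⟩ := ih₁ (b := ν) (ν := ν + 2) (T := T₀) hK.1 (by omega) (by rwa [tY])
    obtain ⟨T₂, e₂, h₂⟩ := ih₂ (b := ν + 1) (ν := ν + 2 + φ.aux) (T := T₁) hK.2 (by omega)
      (by rwa [team_congr (e₁ _ (by omega)), tZ])
    have e : ∀ c < ν + 2, T₂ c = T₀ c := fun c hc => (e₂ c (by omega)).trans (e₁ c hc)
    refine ⟨T₂, fun c hc => (e c (by omega)).trans (e₀ c hc), ?_⟩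
    rw [Formula.templates, List.forall_mem_append, List.forall_mem_append, or_templates_iff]
    refine ⟨?_, fun τ hτ => (h₁ τ hτ).congr (φ.templates_below (by omega) τ hτ) e₂, h₂⟩
    rw [team_congr (e ν (by omega)), team_congr (e (ν + 1) (by omega)), tY, tZ,
      team_congr ((e b (by omega)).trans (e₀ b hb))]
    exact ⟨hY, hZ, hYZ.ge⟩
  | ex y φ ih =>
    intro b ν T hK hb h
    obtain ⟨F, hF, hφ⟩ := h
    set Y := (team (leadingOnes x) K T b).suppFun F y with hYd
    have tY : team (leadingOnes x) K (setTeam (leadingOnes x) K T ν Y) ν = Y := by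
      refine team_setTeam_self ?_
      rintro _ ⟨s, hs, a, -, rfl⟩
      exact (supported_of_mem_team hs).supp hK.1 a
    obtain ⟨T₁, e₁, h₁⟩ := ih (b := ν) (ν := ν + 1) (T := setTeam (leadingOnes x) K T ν Y) hK.2
      (by omega) (by rwa [tY])
    have e : ∀ c < ν, T₁ c = T c := fun c hc => by
      rw [e₁ c (by omega), setTeam_of_ne (by omega)]
    refine ⟨T₁, e, ?_⟩
    rw [Formula.templates, List.forall_mem_append, ex_templates_iff hK.1]
    refine ⟨?_, h₁⟩
    rw [team_congr (e₁ ν (by omega)), tY, team_congr (e b hb)]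
    constructor
    · intro s hs
      obtain ⟨a, ha⟩ := hF s hs
      exact ⟨a, s, hs, a, ha, rfl⟩
    · rintro _ ⟨s, hs, a, -, rfl⟩
      exact ⟨s, hs, a, rfl⟩
  | all y φ ih =>
    intro b ν T hK hb h
    rw [Sat] at h
    set Y := (team (leadingOnes x) K T b).suppAll y with hYd
    have tY : team (leadingOnes x) K (setTeam (leadingOnes x) K T ν Y) ν = Y := by
      refine team_setTeam_self ?_
      rintro _ ⟨s, hs, a, rfl⟩
      exact (supported_of_mem_team hs).supp hK.1 a
    obtain ⟨T₁, e₁, h₁⟩ := ih (b := ν) (ν := ν + 1) (T := setTeam (leadingOnes x) K T ν Y) hK.2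
      (by omega) (by rwa [tY])
    have e : ∀ c < ν, T₁ c = T c := fun c hc => by
      rw [e₁ c (by omega), setTeam_of_ne (by omega)]
    refine ⟨T₁, e, ?_⟩
    rw [Formula.templates, List.forall_mem_append, all_templates_iff hK.1]
    refine ⟨?_, h₁⟩
    rw [team_congr (e₁ ν (by omega)), tY, team_congr (e b hb)]

end TeamLogic

/-! ## Queries about the next team -/

namespace TeamLogic

open EnumComplexity EnumComplexity.Loop

variable {σ : Vocabulary} {K : ℕ}

/-- The teams given by a valuation: number `s` of team `b` is the Boolean variable `b * N + s`. -/
def valuationTeams (N : ℕ) (α : ℕ → Bool) (b s : ℕ) : Bool := α (b * N + s)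

/-- The clauses of a template. -/
def Template.gen (K : ℕ) (τ : Template) : Gen 1 :=
  .loop (Code.total K) (.loop (Code.total K) (.when (τ.guard.rename ![0, 1])
    (.clause (.seq (.lit (.add (.mul (.const τ.b₁) (Code.total K)) (.var 2)) false)
      (.seq (.seqList (τ.b₂.toList.map fun b =>
          .lit (.add (.mul (.const b) (Code.total K)) (.var 1)) false))
        (.seqList (τ.pos.map fun p => .loop (Code.total K) (.when (p.2.rename ![0, 2, 3])
          (.lit (.add (.mul (.const p.1) (Code.total K)) (.var 1)) true)))))))))

/-- Inside the two loops and the guard the environment is `![g, t, s, i]`, where `g` is the dummy of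
the conditional and `i` the parameter of the whole query. The renamings pick out of such
environments the variables that the template speaks about. -/
theorem Template.conj_gen (x : List Bool) (m : ℕ → Bool) (τ : Template) (i : ℕ) :
    Gen.Conj x m (τ.gen K) ![i] fun α =>
      τ.Holds x m K (valuationTeams ((leadingOnes x + 1) ^ K) α) := by
  have e₂ : ∀ s t : ℕ, (fun j => ![t, s, i] ((![0, 1] : Fin 2 → Fin 3) j)) = ![t, s] :=
    fun s t => by ext j; fin_cases j <;> rfl
  have e₃ : ∀ g s t u : ℕ, (fun j => ![u, g, t, s, i] ((![0, 2, 3] : Fin 3 → Fin 5) j)) =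
    ![u, t, s] := fun g s t u => by ext j; fin_cases j <;> rfl
  set N := (leadingOnes x + 1) ^ K with hN
  have h : ∀ s t g : ℕ, Gen.Disj x m (.seq (.lit (.add (.mul (.const τ.b₁) (Code.total K))
      (.var 2)) false) (.seq (.seqList (τ.b₂.toList.map fun b =>
          .lit (.add (.mul (.const b) (Code.total K)) (.var 1)) false))
        (.seqList (τ.pos.map fun p => .loop (Code.total K) (.when (p.2.rename ![0, 2, 3])
          (.lit (.add (.mul (.const p.1) (Code.total K)) (.var 1)) true))))))
      ![g, t, s, i] fun α => α (τ.b₁ * N + s) = false ∨ (∃ b ∈ τ.b₂.toList, α (b * N + t) = false) ∨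
        ∃ p ∈ τ.pos, ∃ u < N, p.2.eval x m ![u, t, s] ≠ 0 ∧ α (p.1 * N + u) = true := by
    intro s t g
    refine Gen.Disj.seq ?_ (Gen.Disj.seq (Gen.disj_seqList fun b _ => ?_)
      (Gen.disj_seqList fun p _ => ?_))
    · simpa using Gen.disj_lit (x := x) (m := m) (.add (.mul (.const τ.b₁) (Code.total K)) (.var 2))
        false ![g, t, s, i]
    · simpa using Gen.disj_lit (x := x) (m := m) (.add (.mul (.const b) (Code.total K)) (.var 1))
        false ![g, t, s, i]
    · have hl : ∀ u h, Gen.Disj x m (.lit (.add (.mul (.const p.1) (Code.total K)) (.var 1)) true)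
          ![h, u, g, t, s, i] fun α => α (p.1 * N + u) = true := fun u h => by
        simpa using Gen.disj_lit (x := x) (m := m)
          (.add (.mul (.const p.1) (Code.total K)) (.var 1)) true ![h, u, g, t, s, i]
      have := Gen.disj_loop (b := Code.total K) (env := ![g, t, s, i]) fun u =>
        Gen.disj_when (c := p.2.rename ![0, 2, 3]) (hl u)
      simpa [Expr.eval_rename, e₃] using this
  refine (Gen.conj_loop fun s => Gen.conj_loop fun t => Gen.conj_when
    fun g => (h s t g).clause).congr fun α => ?_
  simp only [Expr.eval_rename, Code.eval_total, e₂, Template.Holds, valuationTeams, ← hN]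
  refine forall₄_congr fun s _ t _ => ?_
  simp only [Option.mem_toList]
  constructor
  · intro h h₁ h₂ hg
    obtain h | ⟨b, hb, h⟩ | h := h hg
    · simp [h] at h₁
    · simp [h₂ b hb] at h
    · exact h
  · intro h hg
    by_cases h₁ : α (τ.b₁ * N + s) = true
    · by_cases h₂ : ∀ b ∈ τ.b₂, α (b * N + t) = true
      · exact .inr (.inr (h h₁ h₂ hg))
      · simp only [not_forall, Bool.not_eq_true, exists_prop] at h₂
        exact .inr (.inl h₂)
    · exact .inl (by simpa using h₁)

/-- Needed because Boolean variable `b * N + s` stands for number `s` of team `b` only as long as `s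
< N`. -/
theorem Template.Holds.congr_lt {x : List Bool} {m : ℕ → Bool} {T T' : ℕ → ℕ → Bool}
    {τ : Template} (h : τ.Holds x m K T)
    (hT : ∀ b, ∀ s < (leadingOnes x + 1) ^ K, T' b s = T b s) : τ.Holds x m K T' := by
  intro s hs t ht h₁ h₂ hg
  rw [hT _ s hs] at h₁
  obtain ⟨p, hp, u, hu, hr, hpu⟩ := h s hs t ht h₁
    (fun b hb => by rw [← hT b t ht]; exact h₂ b hb) hg
  exact ⟨p, hp, u, hu, hr, by rwa [hT _ u hu]⟩

/-- Teams as characteristic functions on numbers of assignments, ordered lexicographically. -/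
abbrev BitTeam (x : List Bool) (K : ℕ) : Type := Lex (Fin ((leadingOnes x + 1) ^ K) → Bool)

/-- The team with characteristic function `y`. -/
def BitTeam.toTeam {x : List Bool} {K : ℕ} (y : BitTeam x K) : Team (leadingOnes x) :=
  {a | ∃ s : Fin ((leadingOnes x + 1) ^ K), decode (leadingOnes x) K s = a ∧ ofLex y s = true}

/-- The teams that satisfy `φ`, including the empty one. -/
def satTeams (φ : Formula σ) (x : List Bool) (K : ℕ) : Set (BitTeam x K) :=
  {y | ∃ A : FinStructure σ (leadingOnes x), A.code = x ∧ Team.HasDomain y.toTeam φ.free ∧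
    Sat A y.toTeam φ}

/-- The restriction of a bit sequence. -/
def restrict (x : List Bool) (K : ℕ) (α : ℕ → Bool) : BitTeam x K := toLex fun s => α s

theorem team_eq_toTeam {x : List Bool} {T : ℕ → ℕ → Bool} {b : ℕ} :
    team (leadingOnes x) K T b = (restrict x K (T b)).toTeam := by
  ext a
  constructor
  · rintro ⟨s, hs, h⟩; exact ⟨⟨s, hs⟩, h⟩
  · rintro ⟨s, h⟩; exact ⟨s, s.2, h⟩

/-- The team consists of assignments with domain `D`. -/
def domainTemplate (K : ℕ) (D : Finset ℕ) : Template :=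
  ⟨0, none, .not (Code.hasDomain K (.var 1) D), []⟩

theorem holds_domainTemplate {x : List Bool} {m : ℕ → Bool} {T : ℕ → ℕ → Bool} {D : Finset ℕ}
    (hD : ∀ v ∈ D, v < K) :
    (domainTemplate K D).Holds x m K T ↔ Team.HasDomain (team (leadingOnes x) K T 0) D := by
  rw [domainTemplate, holds_none_nil (fun a => ¬ Assignment.HasDomain a D) fun s t => ?_]
  · simp only [not_not]; rfl
  · have := Code.hasDomain_iff (x := x) (m := m) (a := (.var 1 : Expr 2)) (env := ![t, s]) hD
    simpa using not_congr this

/-- The input is a structure and the valuation describes a team that satisfies the formula,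
together with witnesses. -/
def teamGen (φ : Formula σ) (K : ℕ) : Gen 1 :=
  .seq (.when (.not (Code.isCode σ)) (.clause .nil))
    (.seqList ((domainTemplate K φ.free :: φ.templates K 0 1).map (Template.gen K)))

/-- On a word that encodes no structure an empty clause is written, which makes the query
unsatisfiable. -/
theorem conj_teamGen (φ : Formula σ) (x : List Bool) (m : ℕ → Bool) (i : ℕ) :
    Gen.Conj x m (teamGen φ K) ![i] fun α => (∃ A : FinStructure σ (leadingOnes x), A.code = x) ∧
      ∀ τ ∈ domainTemplate K φ.free :: φ.templates K 0 1,
        τ.Holds x m K (valuationTeams ((leadingOnes x + 1) ^ K) α) := by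
  refine ((Gen.conj_when fun i => Gen.disj_nil.clause).seq
    (Gen.conj_seqList fun τ _ => τ.conj_gen x m i)).congr fun α => and_congr ?_ Iff.rfl
  have h := Code.isCode_iff (σ := σ) (x := x) (m := m) (env := ![i])
  simp only [imp_false, ne_eq, not_not, Expr.eval_not]
  constructor
  · intro h'
    exact exists_code_eq (h.1 fun h0 => by simp [h0] at h')
  · rintro ⟨A, hA⟩
    have := h.2 (by simpa [hA] using A.length_code)
    simp [this]

/-- The first `N` Boolean variables describe team `0`, the candidate; the others describe auxiliary
teams and are projected away. -/
theorem exists_valuation_iff {φ : Formula σ} (hK : φ.Below K) {x : List Bool} {m : ℕ → Bool}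
    {y : BitTeam x K} :
    (∃ α, ((∃ A : FinStructure σ (leadingOnes x), A.code = x) ∧
      ∀ τ ∈ domainTemplate K φ.free :: φ.templates K 0 1,
        τ.Holds x m K (valuationTeams ((leadingOnes x + 1) ^ K) α)) ∧ restrict x K α = y) ↔
      y ∈ satTeams φ x K := by
  set N := (leadingOnes x + 1) ^ K with hN
  have hr : ∀ α, restrict x K (valuationTeams N α 0) = restrict x K α := fun α => by
    simp [restrict, valuationTeams]
  constructor
  · rintro ⟨α, ⟨⟨A, hA⟩, hτ⟩, rfl⟩
    rw [List.forall_mem_cons, holds_domainTemplate hK.free_lt] at hτ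
    have := sat_of_templates hA φ hK hτ.2
    rw [team_eq_toTeam, hr] at hτ this
    exact ⟨A, hA, hτ.1, this⟩
  · rintro ⟨A, hA, hD, hS⟩
    let T : ℕ → ℕ → Bool := fun _ s => if h : s < N then ofLex y ⟨s, h⟩ else false
    have hT : restrict x K (T 0) = y := by
      refine ofLex.injective (funext fun s => ?_)
      simp [restrict, T, hN]
    obtain ⟨T', h0, hT'⟩ := templates_of_sat (m := m) (T := T) (b := 0) (ν := 1) hA φ hK one_pos
      (by rwa [team_eq_toTeam, hT])
    have hN0 : 0 < N := by positivity
    -- Division with remainder by `N` recovers the team and the assignment from the number of a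
    -- Boolean variable.
    have hα : ∀ b, ∀ s < N, valuationTeams N (fun v => T' (v / N) (v % N)) b s = T' b s := by
      intro b s hs
      rw [valuationTeams, mul_comm, Nat.mul_add_div hN0, Nat.mul_add_mod, Nat.div_eq_of_lt hs,
        Nat.mod_eq_of_lt hs, add_zero]
    have hα0 : restrict x K (fun v => T' (v / N) (v % N)) = y := by
      rw [← hr, ← hT]
      refine ofLex.injective (funext fun s => ?_)
      exact (hα 0 s s.2).trans (by rw [h0 0 one_pos]; rfl)
    refine ⟨fun v => T' (v / N) (v % N), ⟨⟨A, hA⟩, ?_⟩, hα0⟩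
    rw [List.forall_mem_cons, holds_domainTemplate hK.free_lt, team_eq_toTeam, hr, hα0]
    exact ⟨hD, fun τ hτ => (hT' τ hτ).congr_lt hα⟩

/-- The bit of the current team with number `e`. -/
def currentBit {k : ℕ} (e : Expr k) : Expr k := .add (.add e e) (.const 1)

/-- The bit of the next team with number `e`. -/
def nextBit {k : ℕ} (e : Expr k) : Expr k := .add (.add e e) (.const 2)

/-- The current team. -/
def current (m : ℕ → Bool) (j : ℕ) : Bool := m (j + j + 1)

/-- The next team. -/
def next (m : ℕ → Bool) (j : ℕ) : Bool := m (j + j + 2)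

/-- The team is larger than the current one. -/
def largerGen (K : ℕ) : Gen 1 :=
  .seq (.loop (Code.total K) (.when (.mem (currentBit (.var 0))) (.clause (.seq (.lit (.var 1) true)
      (.loop (.var 1) (.when (.not (.mem (currentBit (.var 0)))) (.lit (.var 1) true)))))))
    (.clause (.loop (Code.total K) (.when (.not (.mem (currentBit (.var 0)))) (.lit (.var 1) true))))

/-- The team agrees with the next team below `i` and does not contain `i`. -/
def prefixGen : Gen 1 :=
  .seq (.loop (.var 0) (.seq (.when (.mem (nextBit (.var 0))) (.clause (.lit (.var 1) true)))
    (.when (.not (.mem (nextBit (.var 0)))) (.clause (.lit (.var 1) false)))))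
    (.clause (.lit (.var 0) false))

theorem conj_prefixGen (x : List Bool) (m : ℕ → Bool) (i : ℕ) :
    Gen.Conj x m prefixGen ![i] fun α => (∀ l < i, α l = next m l) ∧ α i = false := by
  have h : ∀ b g l, Gen.Disj x m (.lit (.var 1) b) ![g, l, i] fun α => α l = b := fun b g l =>
    Gen.disj_lit _ _ _
  refine ((Gen.conj_loop fun l => (Gen.conj_when fun g => (h true g l).clause).seq
    (Gen.conj_when fun g => (h false g l).clause)).seq
    (Gen.disj_lit _ _ _).clause).congr fun α => ?_
  refine and_congr (forall₂_congr fun l _ => ?_) Iff.rfl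
  simp only [nextBit, Expr.eval_not, Expr.eval_mem, Expr.eval_add, Expr.eval_var, Expr.eval_const,
    Matrix.cons_val_zero, next]
  obtain hm | hm := Bool.eq_false_or_eq_true (m (l + l + 2)) <;> simp [hm]

/-- For fixed `w` the right-hand side is a conjunction of clauses in `y`. To see that it suffices,
consider the first position where the strings differ. If `w` had a one there, the clause for this
position would yield an earlier difference. -/
theorem lt_toLex_iff {N : ℕ} {w y : ℕ → Bool} :
    (toLex (fun s : Fin N => w s) < toLex fun s : Fin N => y s) ↔
      (∀ j < N, w j = true → y j = true ∨ ∃ l < j, w l = false ∧ y l = true) ∧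
        ∃ j < N, w j = false ∧ y j = true := by
  constructor
  · rintro ⟨d, hd, hlt⟩
    obtain ⟨hw, hy⟩ : w d = false ∧ y d = true := by simpa using Bool.lt_iff.1 hlt
    refine ⟨fun j hj hwj => ?_, d, d.2, hw, hy⟩
    obtain h | h | h := lt_trichotomy j d
    · exact .inl ((hd ⟨j, hj⟩ h).symm.trans hwj)
    · simp [← h, hwj] at hw
    · exact .inr ⟨d, h, hw, hy⟩
  · rintro ⟨h, j, hj, hwj, hyj⟩
    have hex : ∃ d, d < N ∧ w d ≠ y d := ⟨j, hj, by simp [hwj, hyj]⟩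
    classical
    obtain ⟨hdN, hd⟩ := Nat.find_spec hex
    have hmin : ∀ l < Nat.find hex, w l = y l := fun l hl => by
      by_contra hne
      exact Nat.find_min hex hl ⟨hl.trans hdN, hne⟩
    refine ⟨⟨Nat.find hex, hdN⟩, fun l hl => hmin l hl, Bool.lt_iff.2 ?_⟩
    change w (Nat.find hex) = false ∧ y (Nat.find hex) = true
    cases hwd : w (Nat.find hex)
    · simpa [hwd] using hd
    · obtain h' | ⟨l, hl, h₁, h₂⟩ := h _ hdN hwd
      · simp [hwd, h'] at hd
      · simp [hmin l hl, h₂] at h₁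

/-- The bits of the current team are in memory and are evaluated while the query is written; only
the bits of the candidate become Boolean variables. -/
theorem conj_largerGen (x : List Bool) (m : ℕ → Bool) (i : ℕ) :
    Gen.Conj x m (largerGen K) ![i] fun α => restrict x K (current m) < restrict x K α := by
  have h₁ : ∀ h l g j, Gen.Disj x m (.lit (.var 1) true) ![h, l, g, j, i] fun α => α l = true :=
    fun h l g j => Gen.disj_lit _ _ _
  have h₂ : ∀ g j, Gen.Disj x m (.lit (.var 1) true) ![g, j, i] fun α => α j = true :=
    fun g j => Gen.disj_lit _ _ _
  have h₃ : ∀ g j, Gen.Disj x m (.loop (.var 1) (.when (.not (.mem (currentBit (.var 0))))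
      (.lit (.var 1) true))) ![g, j, i] fun α => ∃ l < j, current m l = false ∧ α l = true := by
    intro g j
    have := Gen.disj_loop (b := .var 1) (env := ![g, j, i]) fun l =>
      Gen.disj_when (c := .not (.mem (currentBit (.var 0)))) fun h => h₁ h l g j
    simpa [currentBit, current] using this
  refine ((Gen.conj_loop fun j => Gen.conj_when fun g => ((h₂ g j).seq (h₃ g j)).clause).seq
    (Gen.disj_loop fun j => Gen.disj_when fun g => h₂ g j).clause).congr fun α => ?_
  rw [restrict, restrict, lt_toLex_iff]
  simp [currentBit, current]

theorem teamGen_larger_mem {φ : Formula σ} (hK : φ.Below K) {x : List Bool} {m : ℕ → Bool}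
    {i : ℕ} : (Gen.seq (teamGen φ K) (largerGen K)).word x m ![i] ∈ satLanguage ↔
      ∃ y ∈ satTeams φ x K, restrict x K (current m) < y := by
  rw [((conj_teamGen φ x m i).seq (conj_largerGen x m i)).mem_satLanguage]
  constructor
  · rintro ⟨α, h, hlt⟩
    exact ⟨_, (exists_valuation_iff hK).1 ⟨α, h, rfl⟩, hlt⟩
  · rintro ⟨y, hy, hlt⟩
    obtain ⟨α, h, rfl⟩ := (exists_valuation_iff hK (m := m)).2 hy
    exact ⟨α, h, hlt⟩

theorem teamGen_larger_prefix_mem {φ : Formula σ} (hK : φ.Below K) {x : List Bool}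
    {m : ℕ → Bool} (i : Fin ((leadingOnes x + 1) ^ K)) :
    (Gen.seq (teamGen φ K) (.seq (largerGen K) prefixGen)).word x m ![i] ∈ satLanguage ↔
      ∃ y ∈ satTeams φ x K, restrict x K (current m) < y ∧
        (∀ l < i, ofLex y l = next m l) ∧ ofLex y i = false := by
  rw [((conj_teamGen φ x m i).seq ((conj_largerGen x m i).seq
    (conj_prefixGen x m i))).mem_satLanguage]
  constructor
  · rintro ⟨α, h, hlt, hp, hi⟩
    exact ⟨_, (exists_valuation_iff hK).1 ⟨α, h, rfl⟩, hlt, fun l hl => hp l hl, hi⟩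
  · rintro ⟨y, hy, hlt, hp, hi⟩
    obtain ⟨α, h, rfl⟩ := (exists_valuation_iff hK (m := m)).2 hy
    exact ⟨α, h, hlt, fun l hl => hp ⟨l, hl.trans i.2⟩ hl, hi⟩

end TeamLogic

/-! ## Enumeration of teams -/

namespace TeamLogic

open EnumComplexity EnumComplexity.Loop

variable {σ : Vocabulary} {K : ℕ}

theorem foldl_range_induction {α : Type*} (f : α → ℕ → α) (a : α) (I : ℕ → α → Prop) (n : ℕ)
    (h0 : I 0 a) (h : ∀ i < n, ∀ b, I i b → I (i + 1) (f b i)) :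
    I n ((List.range n).foldl f a) := by
  induction n with
  | zero => exact h0
  | succ n ih =>
    rw [List.range_succ, List.foldl_append]
    exact h n (by omega) _ (ih fun i hi => h i (by omega))

/-- Set the bits of the next team. -/
def searchStmt (φ : Formula σ) (K : ℕ) : Stmt 0 :=
  .loop (Code.total K) (.seq
    (.ask (nextBit (.var 0)) (.seq (teamGen φ K) (.seq (largerGen K) prefixGen)))
    (.set (nextBit (.var 0)) (.not (.mem (nextBit (.var 0))))))

/-- The place of the assignment with number `e` in the code of teams with domain `D`. -/
def address {k : ℕ} (K : ℕ) (D : Finset ℕ) (e : Expr k) : Expr k :=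
  .add (.mul (.not (.not (Code.hasDomain K e D))) (Code.index e fun i => (D.orderIsoOfFin rfl i : ℕ)))
    (.mul (.not (Code.hasDomain K e D)) (.pow Code.univ D.card))

/-- Write the next team to the output and make it the current one. -/
def writeStmt (K : ℕ) (D : Finset ℕ) : Stmt 0 :=
  .loop (Code.total K) (.seq (.set (currentBit (.var 0)) (.mem (nextBit (.var 0))))
    (.out (address K D (.var 0)) (.mem (nextBit (.var 0)))))

/-- Compute the next team. -/
def nextStmt (φ : Formula σ) (K : ℕ) : Stmt 0 :=
  -- The loop with one round only supplies the variable that `teamGen` and `largerGen` expect. The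
  -- answer goes to memory cell `0`, which controls the enumeration.
  .seq (.loop (.const 1) (.ask (.const 0) (.seq (teamGen φ K) (largerGen K))))
    (.seq (searchStmt φ K) (writeStmt K φ.free))

theorem ofTuple_orderIsoOfFin {n : ℕ} (D : Finset ℕ) (a : Fin D.card → Fin n) (i : Fin D.card) :
    Assignment.ofTuple D a (D.orderIsoOfFin rfl i) = some (a i) := by
  rw [Assignment.ofTuple, dif_pos (D.orderIsoOfFin rfl i).2, Subtype.coe_eta,
    OrderIso.symm_apply_apply]

theorem hasDomain_ofTuple {n : ℕ} (D : Finset ℕ) (a : Fin D.card → Fin n) :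
    (Assignment.ofTuple D a).HasDomain D := by
  intro v
  by_cases h : v ∈ D <;> simp [Assignment.ofTuple, h]

theorem exists_ofTuple {n : ℕ} {D : Finset ℕ} {s : Assignment n} (h : s.HasDomain D) :
    ∃ a, s = Assignment.ofTuple D a := by
  have : ∀ i, ∃ c, s (D.orderIsoOfFin rfl i) = some c := fun i =>
    Option.isSome_iff_exists.1 ((h _).2 (D.orderIsoOfFin rfl i).2)
  choose a ha using this
  refine ⟨a, funext fun v => ?_⟩
  by_cases hv : v ∈ D
  · have := ha ((D.orderIsoOfFin rfl).symm ⟨v, hv⟩)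
    simpa [Assignment.ofTuple, hv] using this
  · simpa [Assignment.ofTuple, hv] using (not_congr (h v)).2 hv

theorem ofTuple_injective {n : ℕ} (D : Finset ℕ) :
    Function.Injective (Assignment.ofTuple (n := n) D) := by
  intro a b h
  funext i
  have := congrFun h (D.orderIsoOfFin rfl i)
  rw [ofTuple_orderIsoOfFin, ofTuple_orderIsoOfFin] at this
  exact Option.some.inj this

/-- Assignments with another domain are sent to position `n ^ |D|`, just behind the code word. Hence
every position inside the word belongs to exactly one assignment. -/
theorem address_eq_iff {x : List Bool} {m : ℕ → Bool} {k : ℕ} {env : Fin k → ℕ} {e : Expr k}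
    {D : Finset ℕ} (hD : ∀ v ∈ D, v < K) (j : Fin (leadingOnes x ^ D.card)) :
    (address K D e).eval x m env = j ↔ decode (leadingOnes x) K (e.eval x m env) =
      Assignment.ofTuple D (finFunctionFinEquiv.symm j) := by
  have h := Code.hasDomain_iff (x := x) (m := m) (env := env) (a := e) hD
  by_cases hd : (Code.hasDomain K e D).eval x m env = 0
  · simp only [address, Expr.eval_add, Expr.eval_mul, Expr.eval_not, hd, Expr.eval_pow,
      Code.eval_univ]
    constructor
    · intro h'
      have := j.2
      simp at h'
      omega
    · intro h'
      exact absurd hd (h.2 (h' ▸ hasDomain_ofTuple _ _))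
  · obtain ⟨a, ha⟩ := exists_ofTuple (h.1 hd)
    have hi : (Code.index e fun i => (D.orderIsoOfFin rfl i : ℕ)).eval x m env =
        finFunctionFinEquiv a :=
      Code.eval_index (K := K) (fun i => hD _ (D.orderIsoOfFin rfl i).2)
        (by funext i; rw [ha]; exact ofTuple_orderIsoOfFin D a i)
    rw [ha, (ofTuple_injective D).eq_iff, Equiv.eq_symm_apply]
    rw [address, Expr.eval_add, Expr.eval_mul, hi]
    simp only [Expr.eval_not, Expr.eval_mul, hd, Fin.ext_iff]
    simp

theorem run_loop (L : Language Bool) (x : List Bool) {k : ℕ} (b : Expr k) (p : Stmt (k + 1))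
    (env : Fin k → ℕ) (s : Store) : (Stmt.loop b p).run L x env s =
      (List.range (b.eval x s.mem env)).foldl (fun s i => p.run L x (Matrix.vecCons i env) s) s :=
  rfl

/-- Binary prefix search: once the bits of the least element `μ` below `i` are known, its bit `i` is
`0` if and only if some admissible team has these bits and a `0` at `i`. Without an admissible team
the bits found are meaningless, but cell `0` is still kept. -/
theorem run_search {φ : Formula σ} (hK : φ.Below K) {x : List Bool} (s : Store) :
    let s' := (searchStmt φ K).run satLanguage x ![] s
    s'.mem 0 = s.mem 0 ∧ ∀ μ : BitTeam x K,
      IsLeast {y | y ∈ satTeams φ x K ∧ restrict x K (current s.mem) < y} μ →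
        restrict x K (next s'.mem) = μ := by
  intro s'
  have key : s'.mem 0 = s.mem 0 ∧ current s'.mem = current s.mem ∧ ∀ μ : BitTeam x K,
      IsLeast {y | y ∈ satTeams φ x K ∧ restrict x K (current s.mem) < y} μ →
        -- The bound on `l` is automatic; it is stated so that this is the loop invariant after the
        -- last round.
        ∀ l : Fin ((leadingOnes x + 1) ^ K), (l : ℕ) < (leadingOnes x + 1) ^ K →
          next s'.mem l = ofLex μ l := by
    simp only [s', searchStmt, run_loop, Code.eval_total]
    refine foldl_range_induction _ s (fun i t => t.mem 0 = s.mem 0 ∧ current t.mem = current s.mem ∧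
      ∀ μ : BitTeam x K, IsLeast {y | y ∈ satTeams φ x K ∧ restrict x K (current s.mem) < y} μ →
        ∀ l : Fin ((leadingOnes x + 1) ^ K), (l : ℕ) < i → next t.mem l = ofLex μ l) _
      ⟨rfl, rfl, fun μ _ l hl => absurd hl (by omega)⟩ ?_
    rintro i hi t ⟨h0, hc, hn⟩
    have hq := teamGen_larger_prefix_mem hK (x := x) (m := t.mem) ⟨i, hi⟩
    rw [hc] at hq
    have hbit : ∀ μ : BitTeam x K,
        IsLeast {y | y ∈ satTeams φ x K ∧ restrict x K (current s.mem) < y} μ →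
        ((∃ y ∈ satTeams φ x K, restrict x K (current s.mem) < y ∧
          (∀ l < (⟨i, hi⟩ : Fin _), ofLex y l = next t.mem l) ∧ ofLex y ⟨i, hi⟩ = false) ↔
            ofLex μ ⟨i, hi⟩ = false) := by
      intro μ hμ
      constructor
      · rintro ⟨y, hy, hlt, hp, hyi⟩
        by_contra hne
        -- If `μ` had a one at `i`, then `y`, which agrees with it below `i`, would be smaller.
        refine (hμ.2 ⟨hy, hlt⟩).not_gt
          ⟨⟨i, hi⟩, fun l hl => ?_, Bool.lt_iff.2 ⟨hyi, by simpa using hne⟩⟩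
        exact (hp l hl).trans (hn μ hμ l hl)
      · intro h
        exact ⟨μ, hμ.1.1, hμ.1.2, fun l hl => (hn μ hμ l hl).symm, h⟩
    obtain ⟨v, hv, hmem⟩ : ∃ v, (∀ μ : BitTeam x K,
        IsLeast {y | y ∈ satTeams φ x K ∧ restrict x K (current s.mem) < y} μ →
          v = ofLex μ ⟨i, hi⟩) ∧
        ((Stmt.seq (.ask (nextBit (.var 0)) (.seq (teamGen φ K) (.seq (largerGen K)
          prefixGen))) (.set (nextBit (.var 0)) (.not (.mem (nextBit (.var 0)))))).run satLanguage x
            ![i] t).mem = Function.update t.mem (i + i + 2) v := by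
      classical
      -- The query asks for a zero at `i`, so the bit is the negated answer.
      refine ⟨!decide ((Gen.seq (teamGen φ K) (.seq (largerGen K) prefixGen)).word x t.mem ![i] ∈
        satLanguage), fun μ hμ => ?_, ?_⟩
      · have hq' := hq.trans (hbit μ hμ)
        cases hb : ofLex μ ⟨i, hi⟩ <;> rw [hb] at hq' <;> simp [hq']
      · simp only [Stmt.run, nextBit, Expr.eval_add, Expr.eval_var, Expr.eval_const,
          Matrix.cons_val_zero, Expr.eval_not, Expr.eval_mem, Function.update_self,
          Function.update_idem]
        congr 1
        by_cases h : (Gen.seq (teamGen φ K) (.seq (largerGen K) prefixGen)).word x t.mem ![i] ∈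
          satLanguage <;> simp [h]
    refine ⟨?_, funext fun j => ?_, fun μ hμ l hl => ?_⟩
    · rw [hmem, Function.update_of_ne (by omega), h0]
    · rw [current, hmem, Function.update_of_ne (by omega), ← hc, current]
    · rw [next, hmem]
      obtain h | h := Nat.lt_succ_iff_lt_or_eq.1 hl
      · rw [Function.update_of_ne (by omega)]
        exact hn μ hμ l h
      · obtain rfl : l = ⟨i, hi⟩ := Fin.ext h
        rw [← hv μ hμ]
        exact Function.update_self ..
  exact ⟨key.1, fun μ hμ => ofLex.injective (funext fun l => key.2.2 μ hμ l l.2)⟩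

/-- Cell `0` holds the flag, odd cells the current team, and even cells from `2` on the next team.
Copying therefore disturbs neither the flag nor its own source. -/
theorem run_write {x : List Bool} (L : Language Bool) (s : Store) {D : Finset ℕ}
    (hD : ∀ v ∈ D, v < K) :
    let s' := (writeStmt K D).run L x ![] s
    s'.mem 0 = s.mem 0 ∧ restrict x K (current s'.mem) = restrict x K (next s.mem) ∧
      readWord s'.out (leadingOnes x ^ D.card) =
        Team.code D (restrict x K (next s.mem)).toTeam := by
  intro s'
  set N := (leadingOnes x + 1) ^ K with hN
  have key : s'.mem 0 = s.mem 0 ∧ next s'.mem = next s.mem ∧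
      (∀ l < N, current s'.mem l = next s.mem l) ∧
      ∀ j : Fin (leadingOnes x ^ D.card), ∀ l < N, decode (leadingOnes x) K l =
        Assignment.ofTuple D (finFunctionFinEquiv.symm j) → s'.out j = next s.mem l := by
    simp only [s', writeStmt, run_loop, Code.eval_total]
    refine foldl_range_induction _ s (fun i t => t.mem 0 = s.mem 0 ∧ next t.mem = next s.mem ∧
      (∀ l < i, current t.mem l = next s.mem l) ∧
      ∀ j : Fin (leadingOnes x ^ D.card), ∀ l < i, decode (leadingOnes x) K l =
        Assignment.ofTuple D (finFunctionFinEquiv.symm j) → t.out j = next s.mem l) _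
      ⟨rfl, rfl, by simp, by simp⟩ ?_
    rintro i hi t ⟨h0, hn, hc, ho⟩
    have hmem : ((Stmt.set (currentBit (.var 0)) (.mem (nextBit (.var 0)))).run L x ![i] t).mem =
        Function.update t.mem (i + i + 1) (next s.mem i) := by
      rw [← hn]
      simp [Stmt.run, currentBit, nextBit, next]
    set t₁ := (Stmt.set (currentBit (.var 0)) (.mem (nextBit (.var 0)))).run L x ![i] t
    have hn₁ : next t₁.mem = next s.mem := by
      rw [← hn]
      funext j
      rw [next, hmem, Function.update_of_ne (by omega), next]
    refine ⟨?_, hn₁, fun l hl => ?_, fun j l hl hj => ?_⟩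
    · rw [← h0]
      exact (congrFun hmem 0).trans (Function.update_of_ne (by omega) _ _)
    · change t₁.mem _ = _
      rw [hmem]
      obtain h | rfl := Nat.lt_succ_iff_lt_or_eq.1 hl
      · rw [Function.update_of_ne (by omega)]
        exact hc l h
      · exact Function.update_self ..
    · change Function.update t.out ((address K D (.var 0)).eval x t₁.mem ![i]) _ _ = _
      have ha := address_eq_iff (x := x) (m := t₁.mem) (env := ![i]) (e := .var 0) hD j
      obtain h | rfl := Nat.lt_succ_iff_lt_or_eq.1 hl
      -- Round `i` cannot overwrite position `j`, as two numbers with the same address inside the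
      -- word would decode to the same assignment.
      · rw [Function.update_of_ne, ho j l h hj]
        intro he
        have := decode_injOn hi (h.trans hi) ((ha.1 he.symm).trans hj.symm)
        omega
      · rw [ha.2 hj, Function.update_self]
        have : t₁.mem (l + l + 2) = next s.mem l := congrFun hn₁ l
        change ((t₁.mem (l + l + 2)).toNat != 0) = _
        rw [this]
        cases next s.mem l <;> rfl
  refine ⟨key.1, ofLex.injective (funext fun l => key.2.2.1 l l.2), ?_⟩
  apply List.ext_getElem
  · simp [readWord, Team.code, length_tupleSetCode]
  · intro j hj _
    have hj' : j < leadingOnes x ^ D.card := by simpa [readWord] using hj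
    have hs : Supported K (Assignment.ofTuple D
        (finFunctionFinEquiv.symm (⟨j, hj'⟩ : Fin (leadingOnes x ^ D.card)))) := fun v hv => by
      rw [Assignment.ofTuple, dif_neg fun h => absurd (hD v h) (by omega)]
    obtain ⟨l, hl, hlj⟩ := exists_decode hs
    have h := key.2.2.2 ⟨j, hj'⟩ l hl hlj
    have hmem : Assignment.ofTuple D (finFunctionFinEquiv.symm (⟨j, hj'⟩ : Fin _)) ∈
        (restrict x K (next s.mem)).toTeam ↔ next s.mem l = true := by
      constructor
      · rintro ⟨l', h₁, h₂⟩
        rw [← hlj] at h₁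
        rw [← decode_injOn l'.2 hl h₁]
        exact h₂
      · exact fun h => ⟨⟨l, hl⟩, hlj, h⟩
    have hout : s'.out j = next s.mem l := h
    simp only [readWord, Team.code, tupleSetCode, List.getElem_map, List.getElem_range,
      List.getElem_ofFn, Set.mem_ofPred_eq, hmem, hout]
    simp

/-- From the current team on, all larger teams that satisfy the formula are enumerated. -/
theorem exists_iterates {φ : Formula σ} (hK : φ.Below K) (x : List Bool) (w : BitTeam x K) :
    ∀ s : Store, restrict x K (current s.mem) = w → ∃ ys : List (BitTeam x K), ys.Nodup ∧
      (∀ y, y ∈ ys ↔ y ∈ satTeams φ x K ∧ w < y) ∧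
      Iterates satLanguage x (nextStmt φ K) (.pow Code.univ φ.free.card) s
        (ys.map fun y => Team.code φ.free y.toTeam) := by
  -- The bit strings form a finite linear order, so moving upwards is well-founded.
  induction w using WellFoundedGT.induction with
  | ind w ih =>
    rintro s rfl
    classical
    set w := restrict x K (current s.mem) with hw
    set s₁ := (Stmt.loop (.const 1) (.ask (.const 0)
      (.seq (teamGen φ K) (largerGen K)))).run satLanguage x ![] s with hs₁
    have hs₁m : s₁.mem = Function.update s.mem 0
        (decide (∃ y ∈ satTeams φ x K, w < y)) := by
      simp [hs₁, Stmt.run, teamGen_larger_mem hK, hw]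
    have hc₁ : restrict x K (current s₁.mem) = w := by
      rw [hw]
      refine congrArg (restrict x K) (funext fun j => ?_)
      rw [current, hs₁m, Function.update_of_ne (by omega), current]
    have hrun : (nextStmt φ K).run satLanguage x ![] s =
      (writeStmt K φ.free).run satLanguage x ![] ((searchStmt φ K).run satLanguage x ![] s₁) := rfl
    by_cases hex : ∃ y ∈ satTeams φ x K, w < y
    · obtain ⟨μ, hμS, hμ⟩ := Set.exists_min_image {y | y ∈ satTeams φ x K ∧ w < y} id
        (Set.toFinite _) hex
      obtain ⟨h0, hn⟩ := run_search hK (x := x) s₁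
      replace hn := hn μ (by rw [hc₁]; exact ⟨hμS, fun y hy => hμ y hy⟩)
      obtain ⟨h0', hc, ho⟩ := run_write (K := K) satLanguage
        ((searchStmt φ K).run satLanguage x ![] s₁) hK.free_lt
      rw [← hrun] at h0' hc ho
      rw [hn] at hc ho
      obtain ⟨ys, hnd, hys, hit⟩ := ih μ hμS.2 _ hc
      refine ⟨μ :: ys, List.nodup_cons.2 ⟨fun h => lt_irrefl _ ((hys μ).1 h).2, hnd⟩,
        fun y => ?_, ?_⟩
      · rw [List.mem_cons, hys]
        constructor
        · rintro (rfl | ⟨h₁, h₂⟩)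
          · exact hμS
          · exact ⟨h₁, hμS.2.trans h₂⟩
        · rintro ⟨h₁, h₂⟩
          obtain h | h := (show μ ≤ y from hμ y ⟨h₁, h₂⟩).eq_or_lt
          · exact .inl h.symm
          · exact .inr ⟨h₁, h⟩
      · rw [List.map_cons, ← ho]
        have := Iterates.output (l := .pow Code.univ φ.free.card) (s := s) ?_ hit
        · simpa using this
        · rw [h0', h0, hs₁m, Function.update_self]
          simpa using hex
    -- Search and writing are executed in the last round as well, but they leave the negative answer
    -- in cell `0`.
    · have h0 : ((nextStmt φ K).run satLanguage x ![] s).mem 0 = false := by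
        rw [hrun, (run_write (K := K) satLanguage _ hK.free_lt).1, (run_search hK s₁).1, hs₁m,
          Function.update_self]
        simpa using hex
      refine ⟨[], List.nodup_nil, fun y => ?_, .halt h0⟩
      simpa using fun h₁ h₂ => hex ⟨y, h₁, h₂⟩

/-! ### Bit strings, teams and their code words -/

theorem BitTeam.exists_toTeam_eq {x : List Bool} {X : Team (leadingOnes x)} {D : Finset ℕ}
    (hD : ∀ v ∈ D, v < K) (hX : X.HasDomain D) : ∃ y : BitTeam x K, y.toTeam = X := by
  classical
  refine ⟨toLex fun s => decide (decode (leadingOnes x) K s ∈ X), ?_⟩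
  ext a
  constructor
  · rintro ⟨s, rfl, h⟩
    simpa using h
  · intro h
    obtain ⟨s, hs, rfl⟩ := exists_decode (K := K) (a := a) fun v hv => by
      have := (not_congr (hX a h v)).2 fun h' => absurd (hD v h') (by omega)
      simpa using this
    exact ⟨⟨s, hs⟩, rfl, by simpa using h⟩

theorem BitTeam.toTeam_injective {x : List Bool} :
    Function.Injective (BitTeam.toTeam : BitTeam x K → Team (leadingOnes x)) := by
  intro y z h
  refine ofLex.injective (funext fun s => ?_)
  have mem : ∀ y : BitTeam x K, decode (leadingOnes x) K s ∈ y.toTeam ↔ ofLex y s = true := by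
    intro y
    constructor
    · rintro ⟨t, ht, hy⟩
      rwa [← Fin.ext (decode_injOn t.2 s.2 ht)]
    · exact fun hy => ⟨s, rfl, hy⟩
  rw [Bool.eq_iff_iff, ← mem y, ← mem z, h]

/-- The zero string is the least one and describes the empty team; starting the enumeration above it
excludes just this team. -/
theorem BitTeam.bot_lt_iff {x : List Bool} {y : BitTeam x K} :
    restrict x K (fun _ => false) < y ↔ y.toTeam.Nonempty := by
  constructor
  · rintro ⟨s, -, hs⟩
    exact ⟨_, s, rfl, (Bool.lt_iff.1 hs).2⟩
  · rintro ⟨a, s, -, hs⟩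
    refine lt_of_le_of_ne (Pi.toLex_monotone fun s => Bool.false_le _) ?_
    rintro rfl
    simp [restrict] at hs

/-- Distinct teams have distinct output words, so absence of repetitions carries over from teams to
words. Both domains must be `D`, because the code ignores all other assignments. -/
theorem Team.code_injOn {n : ℕ} {D : Finset ℕ} {X Y : Team n} (hX : X.HasDomain D)
    (hY : Y.HasDomain D) (h : Team.code D X = Team.code D Y) : X = Y := by
  have mem : ∀ a, Assignment.ofTuple D a ∈ X ↔ Assignment.ofTuple D a ∈ Y := by
    intro a
    have := congrFun (List.ofFn_injective h) (finFunctionFinEquiv a)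
    simpa using this
  ext s
  constructor
  · intro hs
    obtain ⟨a, rfl⟩ := exists_ofTuple (hX s hs)
    exact (mem a).1 hs
  · intro hs
    obtain ⟨a, rfl⟩ := exists_ofTuple (hY s hs)
    exact (mem a).2 hs

end TeamLogic

theorem mainTheorem3 (σ : TeamLogic.Vocabulary) (φ : TeamLogic.Formula σ) :
    TeamLogic.ESatTeam φ ∈ EnumComplexity.Del EnumComplexity.NP := by
  open TeamLogic EnumComplexity in
  obtain ⟨K, hK⟩ := φ.exists_below
  refine Loop.mem_Del_of_iterates satLanguage_mem_NP (nextStmt φ K)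
    (.pow Code.univ φ.free.card) _ fun x => ?_
  obtain ⟨ys, hnd, hys, hit⟩ := exists_iterates hK x (restrict x K fun _ => false)
    ⟨fun _ => false, fun _ => false⟩ rfl
  refine ⟨_, ?_, ?_, hit⟩
  · refine hnd.map_on fun y hy z hz h => ?_
    obtain ⟨⟨_, _, hdy, _⟩, -⟩ := (hys y).1 hy
    obtain ⟨⟨_, _, hdz, _⟩, -⟩ := (hys z).1 hz
    exact BitTeam.toTeam_injective (Team.code_injOn hdy hdz h)
  · ext w
    simp only [ESatTeam, Set.mem_ofPred_eq, List.mem_map, hys, BitTeam.bot_lt_iff]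
    constructor
    · rintro ⟨n, A, X, hA, hD, hS, hne, rfl⟩
      -- The size of the universe is determined by the input word, so all structures encoded by it
      -- live on the same universe.
      obtain rfl : n = leadingOnes x := by rw [← hA, A.leadingOnes_code]
      obtain ⟨y, rfl⟩ := BitTeam.exists_toTeam_eq hK.free_lt hD
      exact ⟨y, ⟨⟨A, hA, hD, hS⟩, hne⟩, rfl⟩
    · rintro ⟨y, ⟨⟨A, hA, hD, hS⟩, hne⟩, rfl⟩
      exact ⟨_, A, _, hA, hD, hS, hne, rfl⟩
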